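/- Call $(a,b,c)\in\mathbb C^3$ generic if $a,b,c,c-a,c-b\notin\mathbb Z$; generic triples form a connected open set. Let $y\in\mathbb C\setminus(\{0\}\cup[1,+\infty))$. Write $\beta(s,t)=\Gamma(s)\Gamma(t)/\Gamma(s+t)$. Let $F(a,b,c;\cdot)$ be the holomorphic continuation to $\mathbb C\setminus[1,+\infty)$ of $\sum_{n\ge0}\frac{(a)_n(b)_n}{(c)_n}\frac{y^n}{n!}$ ($|y|<1$). Choose a determination of $\log y$ and one of $\log(-1)$, and let $\mathcal G(a,b,c;y)$ be the holomorphic continuation to generic $(a,b,c)$ of $$\int_\infty^{y^{-1}}x^b(1-x)^{c-b}(1-yx)^{-a}\frac{dx}{x(1-x)}\qquad(\mathrm{Re}\,c<\mathrm{Re}\,a+1<2),$$ taken along $x=\frac1{yt}$, $t\in(0,1)$, with the branches $\log x=-\log y-\log t$, $\log(1-x)=\log(-1)+\log(1-yt)-\log y-\log t$ and $\log(1-yx)=\log(-1)+\log(1-t)-\log t$, where $\log(1-yt)$ is the principal branch. Put $$G(a,b,c;y)=\frac{\sin(\pi a)\sin(\pi(c-a))}{\pi\sin(\pi c)}\,\beta(b,c-b)^{-1}\,\mathcal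 G(a,b,c;y).$$ At the point $\overline y$ the function $G$ is formed with the complex conjugate determinations of $\log y$ and $\log(-1)$. Let $\beta^{\mathbf s}(s_0,s_1)$ be the holomorphic continuation to $s_0,s_1,s_0+s_1\notin\mathbb Z$ of $\frac1{2\pi i}\iint_{\mathbb C}|z|^{2s_0}|1-z|^{2s_1}\frac{d\overline z\wedge dz}{|z|^2|1-z|^2}$ ($\mathrm{Re}\,s_0,\mathrm{Re}\,s_1>0$, $\mathrm{Re}(s_0+s_1)<1$), and let $\mathcal F^{\mathbf s}$, $\mathcal G^{\mathbf s}$ be the holomorphic continuations to generic $(a,b,c)$ of $$\mathcal F^{\mathbf s}(a,b,c;y)=\frac1{2\pi i}\iint_{\mathbb C}|z|^{2b}|1-z|^{2(c-b)}|1-zy|^{-2a}\frac{d\overline z\wedge dz}{|z|^2|1-z|^2}\qquad(0<\mathrm{Re}\,b<\mathrm{Re}\,c<\mathrm{Re}\,a+1<2),$$ $$\mathcal G^{\mathbf s}(a,b,c;y)=\frac1{2\pi i}\iint_{\mathbb C}|z|^{2b}|1-z|^{2(c-b)}|1-zy|^{-2a}\frac{\overline y\,d\overline z\wedge dz}{(1-\overline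 y\,\overline z)z(1-z)}\qquad(-\tfrac12<\mathrm{Re}\,b<\mathrm{Re}\,c+\tfrac12<\mathrm{Re}\,a+1<\tfrac32).$$ The single-valued versions of $F$ and $G$ are $$F^{\mathbf s}(a,b,c;y)=\beta^{\mathbf s}(b,c-b)^{-1}\mathcal F^{\mathbf s}(a,b,c;y),\qquad G^{\mathbf s}(a,b,c;y)=\frac{a(c-a)}{c}\,\beta^{\mathbf s}(b,c-b)^{-1}\mathcal G^{\mathbf s}(a,b,c;y).$$ Then for all generic $(a,b,c)$, all $y\in\mathbb C\setminus(\{0\}\cup[1,+\infty))$ and all determinations of $\log y$ and $\log(-1)$, with $w_{s,t}=\dfrac{\pi\sin(\pi(s+t))}{\sin(\pi s)\sin(\pi t)}$, $$F^{\mathbf s}(a,b,c;y)=F(a,b,c;y)\,F(a,b,c;\overline y)-w_{a,c-a}\,w_{b,c-b}\,G(a,b,c;y)\,G(a,b,c;\overline y)$$ and $$G^{\mathbf s}(a,b,c;y)=\frac{a(c-a)b(c-b)\,\overline y}{c^2(1+c)}\Big(F(a,b,c;y)\,F(b+1,a+1,c+2;\overline y)-w_{a,c-a}\,w_{b,c-b}\,G(a,b,c;y)\,G(b+1,a+1,c+2;\overline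 y)\Big).$$ -/

import Mathlib

open scoped ComplexConjugate

noncomputable section

/-- Holomorphic continuation: the value at `p` of the holomorphic function on the open set `D`
which agrees with `I` on `D ∩ U` (and `0` if there is no such function).  It is used only where
`D` is open and connected and `D ∩ U` is open and nonempty, so that there is at most one such
function on `D`. -/
def holoCont {E : Type*} [NormedAddCommGroup E] [NormedSpace ℂ E]
    (D U : Set E) (I : E → ℂ) (p : E) : ℂ :=
  open Classical in
  if h : ∃ f : E → ℂ, DifferentiableOn ℂ f D ∧ Set.EqOn f I (D ∩ U) then h.choose p else 0

/-- `s` is not an integer. -/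
def NotInt (s : ℂ) : Prop := ∀ n : ℤ, s ≠ n

/-- The generic parameters `(a, b, c)`: none of `a, b, c, c - a, c - b` is an integer. -/
def genericParams : Set (ℂ × ℂ × ℂ) :=
  {p | NotInt p.1 ∧ NotInt p.2.1 ∧ NotInt p.2.2 ∧ NotInt (p.2.2 - p.1) ∧ NotInt (p.2.2 - p.2.1)}

/-- The plane cut along `[1, +∞)`. -/
def cutPlane : Set ℂ := {y | 1 - y ∈ Complex.slitPlane}

/-- Gauss' hypergeometric function `F(a,b,c;y)` on the cut plane: the holomorphic continuation in
`y` of the hypergeometric power series on the open unit disc. -/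
def hypF (a b c y : ℂ) : ℂ :=
  holoCont cutPlane (Metric.ball 0 1) (fun x => ordinaryHypergeometric a b c x) y

/-- Euler's beta function. -/
def eulerBeta (s t : ℂ) : ℂ := Complex.Gamma s * Complex.Gamma t / Complex.Gamma (s + t)

/-- The integral `∫_∞^{1/y} x^b (1-x)^(c-b) (1-yx)^(-a) dx/(x(1-x))` along the path `x = 1/(yt)`,
`0 < t < 1`.  Here `lam` is the chosen determination of `log y` and `mu` that of `log (-1)`; on the
path, `log x = -lam - log t`, `log (1-x) = mu + log (1-yt) - lam - log t` and
`log (1-yx) = mu + log (1-t) - log t`. -/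
def calGIntegral (a b c y lam mu : ℂ) : ℂ :=
  ∫ t in (0 : ℝ)..1,
    Complex.exp (b * (-lam - Real.log t)
      + (c - b) * (mu + Complex.log (1 - y * t) - lam - Real.log t)
      - a * (mu + Real.log (1 - t) - Real.log t))
    * (-1 / (y * (t : ℂ) ^ 2)) / ((1 / (y * t)) * (1 - 1 / (y * t)))

/-- The companion function `𝒢(a,b,c;y)`: the holomorphic continuation to all generic parameters of
the integral above, which converges for `Re c < Re a + 1 < 2`. -/
def calG (a b c y lam mu : ℂ) : ℂ :=
  holoCont genericParams {p | p.2.2.re < p.1.re + 1 ∧ p.1.re + 1 < 2}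
    (fun p => calGIntegral p.1 p.2.1 p.2.2 y lam mu) (a, b, c)

/-- The normalised companion function `G(a,b,c;y)`. -/
def hypG (a b c y lam mu : ℂ) : ℂ :=
  Complex.sin (Real.pi * a) * Complex.sin (Real.pi * (c - a)) / (Real.pi * Complex.sin (Real.pi * c))
    * (eulerBeta b (c - b))⁻¹ * calG a b c y lam mu

/-- `(1/(2πi)) ∬_ℂ f(z) dz̄ ∧ dz`, where `dz̄ ∧ dz = 2i dx ∧ dy` and `volume` is `dx dy`. -/
def svIntegral (f : ℂ → ℂ) : ℂ :=
  1 / (2 * Real.pi * Complex.I) * ∫ z : ℂ, f z * (2 * Complex.I)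

/-- The single-valued beta function `β^s(s₀,s₁)`: the continuation to `s₀, s₁, s₀ + s₁ ∉ ℤ` of
`(1/(2πi)) ∬ |z|^(2s₀) |1-z|^(2s₁) dz̄ ∧ dz / (|z|² |1-z|²)`. -/
def svBeta (s₀ s₁ : ℂ) : ℂ :=
  holoCont {p : ℂ × ℂ | NotInt p.1 ∧ NotInt p.2 ∧ NotInt (p.1 + p.2)}
    {p : ℂ × ℂ | 0 < p.1.re ∧ 0 < p.2.re ∧ (p.1 + p.2).re < 1}
    (fun p => svIntegral fun z =>
      (‖z‖ : ℂ) ^ (2 * p.1) * (‖1 - z‖ : ℂ) ^ (2 * p.2) / ((‖z‖ : ℂ) ^ 2 * (‖1 - z‖ : ℂ) ^ 2))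
    (s₀, s₁)

/-- The weight `|z|^(2b) |1-z|^(2(c-b)) |1-zy|^(-2a)`. -/
def svWeight (a b c y z : ℂ) : ℂ :=
  (‖z‖ : ℂ) ^ (2 * b) * (‖1 - z‖ : ℂ) ^ (2 * (c - b)) * (‖1 - z * y‖ : ℂ) ^ (-2 * a)

/-- The single-valued version `ℱ^s(a,b,c;y)` of `β(b,c-b) F(a,b,c;y)`: the continuation to all
generic parameters of `(1/(2πi)) ∬ |z|^(2b) |1-z|^(2(c-b)) |1-zy|^(-2a) dz̄ ∧ dz / (|z|² |1-z|²)`. -/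
def svCalF (a b c y : ℂ) : ℂ :=
  holoCont genericParams
    {p | 0 < p.2.1.re ∧ p.2.1.re < p.2.2.re ∧ p.2.2.re < p.1.re + 1 ∧ p.1.re + 1 < 2}
    (fun p => svIntegral fun z =>
      svWeight p.1 p.2.1 p.2.2 y z / ((‖z‖ : ℂ) ^ 2 * (‖1 - z‖ : ℂ) ^ 2))
    (a, b, c)

/-- The single-valued version `𝒢^s(a,b,c;y)` of `𝒢(a,b,c;y)`: the continuation to all generic
parameters of
`(1/(2πi)) ∬ |z|^(2b) |1-z|^(2(c-b)) |1-zy|^(-2a) ȳ dz̄ ∧ dz / ((1 - ȳ z̄) z (1-z))`. -/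
def svCalG (a b c y : ℂ) : ℂ :=
  holoCont genericParams
    {p | -(1 / 2) < p.2.1.re ∧ p.2.1.re < p.2.2.re + 1 / 2 ∧ p.2.2.re + 1 / 2 < p.1.re + 1 ∧
      p.1.re + 1 < 3 / 2}
    (fun p => svIntegral fun z =>
      svWeight p.1 p.2.1 p.2.2 y z * conj y / ((1 - conj y * conj z) * z * (1 - z)))
    (a, b, c)

/-- The single-valued hypergeometric function `F^s(a,b,c;y)`. -/
def svF (a b c y : ℂ) : ℂ := (svBeta b (c - b))⁻¹ * svCalF a b c y

/-- The single-valued companion function `G^s(a,b,c;y)`. -/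
def svG (a b c y : ℂ) : ℂ := a * (c - a) / c * (svBeta b (c - b))⁻¹ * svCalG a b c y

/-- `w_{s,t} = π sin(π(s+t)) / (sin(πs) sin(πt))`. -/
def wFactor (s t : ℂ) : ℂ :=
  Real.pi * Complex.sin (Real.pi * (s + t))
    / (Complex.sin (Real.pi * s) * Complex.sin (Real.pi * t))

end

open scoped ComplexConjugate
open MeasureTheory Filter Topology Set

noncomputable section

/-! Take first `y` off the half line `[0, +∞)` and write `y = e^(-w)` with `0 < Im w < 2π`, `z =
e^u`, `u = ρ + iθ`. In these coordinates the plane integrand is `f(u) g(ū)` with `f`, `g` of the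
form `stripKernel`. They are holomorphic away from the horizontal lines through the branch points `z
= 1` and `z = 1/y` (and the conjugate lines for `g`), and their exponents differ by integers: by
zero for `F^s`, by the shift `(a,b,c) ↦ (a+1,b+1,c+2)` for `G^s`.

The correlation `N(δ) = ∫ f(u) g(u - δ) du` along a horizontal line is holomorphic in `δ`, and the
radial integral at angle `θ` is `N(2iθ)`. Cauchy's theorem in a half strip therefore turns the
angular integral over `[θ₁, θ₂]` into `(i/2)(P(θ₂) - P(θ₁))`, where `P(θ) = ∫ f(ρ+iθ) ∫_{σ<ρ}
g(σ-iθ) dσ dρ` (`StripPair.integral_eq`). As `P` is `2π`-periodic, the integral over the whole plane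
is determined by the jumps of `P` across the two singular lines. At such a line the boundary values
of `f` and `g` from the two sides differ by phases beyond the branch point. Where both variables lie
on the same side of the branch point the phases cancel, because the exponents differ by integers.
Only the region `σ < 0 < ρ` survives, where the double integral is a product
(`PairMaj.boundaryPairing_sub`). So the plane integral is a combination of two products of ray
integrals (`KernelPair.integral_eq`).

The ray integrals of `f` run over `(0,1)`, `(1,∞)`, `(0,1/y)` and `(1/y,∞)`. Cauchy's theorem in the
two sectors gives two linear relations between them (`ray_relations`). The first is a multiple of
`F` and the last a multiple of `G`; expressing the other two through these makes the mixed terms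
`F·G` cancel, and a diagonal bilinear form remains (`plane_formula_F`, `plane_formula_G`). For `0 <
y < 1`, where the two singular lines coincide, the formula follows by continuity along the circle
`|z| = y`.

The rest is continuation. `F` extends jointly in parameters and argument by Euler's integral and
contiguous relations (`hypContinues_hypStrip`); `𝒢` is an explicit exponential times the second
solution at the origin (`calG_eq`); the plane integrals are holomorphic where they converge. The
identity theorem, applied on complex lines, which leave the generic set only in a countable set,
spreads the formulas to all generic parameters (`svCalF_eq`, `svCalG_eq`). The case `a = 0` of the
same computation evaluates `β^s` (`svBeta_eq`), and the reflection formula for `Γ` matches the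
constants. -/

/-- A countable subset of a convex open set of the plane can be avoided by a connected set joining
two given points. -/
theorem exists_isPreconnected_avoiding {T Z : Set ℂ} (hT : IsOpen T) (hTc : Convex ℝ T)
    (hZc : Z.Countable) (h0 : (0 : ℂ) ∈ T \ Z) (h1 : (1 : ℂ) ∈ T \ Z) :
    ∃ S ⊆ T \ Z, IsPreconnected S ∧ (0 : ℂ) ∈ S ∧ (1 : ℂ) ∈ S := by
  have hhalf : (1 / 2 : ℂ) ∈ T := by
    have := hTc h0.1 h1.1 (a := 1 / 2) (b := 1 / 2) (by norm_num) (by norm_num) (by norm_num)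
    simpa using this
  obtain ⟨δ, hδ, hball⟩ := Metric.isOpen_iff.1 hT _ hhalf
  -- The path goes from `0` to `1` through the apex `1/2 + i s`. For every point of it other than
  -- the two ends, `φ` recovers `s`. The countable set `φ '' Z` cannot fill an interval, so some
  -- small `s` gives a path that misses `Z`.
  let φ : ℂ → ℝ := fun z => if z.re ≤ 1 / 2 then z.im / (2 * z.re) else z.im / (2 * (1 - z.re))
  have hcount : (φ '' Z).Countable := hZc.image φ
  have hnc : ¬ (Ioo (0 : ℝ) δ).Countable := by
    intro h
    have := Cardinal.mk_Ioo_real hδ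
    have h2 := Cardinal.le_aleph0_iff_set_countable.2 h
    rw [this] at h2
    exact absurd h2 (not_le.2 Cardinal.aleph0_lt_continuum)
  have : ∃ s ∈ Ioo (0 : ℝ) δ, s ∉ φ '' Z := by
    by_contra hcon
    push Not at hcon
    exact hnc (hcount.mono hcon)
  obtain ⟨s, hs, hsZ⟩ := this
  let m : ℂ := 1 / 2 + s * Complex.I
  have hm : m ∈ T := by
    apply hball
    simp [m, abs_of_pos hs.1, hs.2]
  have hre : m.re = 1 / 2 := by simp [m]
  have him : m.im = s := by simp [m]
  refine ⟨segment ℝ 0 m ∪ segment ℝ m 1, ?_, ?_, ?_, ?_⟩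
  · rintro z (hz | hz)
    · refine ⟨hTc.segment_subset h0.1 hm hz, fun hzZ => ?_⟩
      rw [segment_eq_image] at hz
      obtain ⟨x, hx, rfl⟩ := hz
      rcases eq_or_lt_of_le hx.1 with h | h
      · subst h; simp at hzZ; exact h0.2 hzZ
      apply hsZ
      refine ⟨_, hzZ, ?_⟩
      have h2 : x * (1 / 2) ≤ 1 / 2 := by linarith [hx.2]
      simp only [φ]
      simp only [smul_zero, zero_add, Complex.real_smul, Complex.re_ofReal_mul, hre,
        Complex.im_ofReal_mul, him, if_pos h2]
      field_simp
    · refine ⟨hTc.segment_subset hm h1.1 hz, fun hzZ => ?_⟩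
      rw [segment_eq_image] at hz
      obtain ⟨x, hx, rfl⟩ := hz
      rcases eq_or_lt_of_le hx.2 with h | h
      · subst h; simp at hzZ; exact h1.2 hzZ
      apply hsZ
      refine ⟨_, hzZ, ?_⟩
      have hx1 := hx.1
      simp only [φ]
      simp only [Complex.add_re, Complex.add_im, Complex.real_smul, Complex.re_ofReal_mul, hre,
        Complex.im_ofReal_mul, him, Complex.one_re, Complex.one_im]
      have h1x : 1 - x ≠ 0 := by linarith
      split_ifs with h2
      · have : x = 0 := by linarith
        subst this
        norm_num
      · have : 2 * (1 - ((1 - x) * (1 / 2) + x * 1)) = 1 - x := by ring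
        rw [this]
        field_simp
        ring
  · exact IsPreconnected.union m (right_mem_segment ℝ _ _) (left_mem_segment ℝ _ _)
      (convex_segment _ _).isPreconnected (convex_segment _ _).isPreconnected
  · exact Or.inl (left_mem_segment ℝ _ _)
  · exact Or.inr (right_mem_segment ℝ _ _)

/-! ### Identity theorem along complex lines; uniqueness of continuation -/

section Lines

variable {E : Type*} [NormedAddCommGroup E] [NormedSpace ℂ E]

/-- Every complex line through two points of `G` leaves `G` in a countable set only. -/
def LineGeneric (G : Set E) : Prop :=
  ∀ p ∈ G, ∀ q ∈ G, {t : ℂ | q + t • (p - q) ∉ G}.Countable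

/-- The identity theorem on a convex open set minus a set which is countable on lines, for
functions which are holomorphic on lines. -/
theorem eq_of_eventuallyEq_on_lines {V G : Set E} (hV : IsOpen V) (hVc : Convex ℝ V)
    (hG : IsOpen G) (hGl : LineGeneric G) {f g : E → ℂ} {p q : E} (hp : p ∈ V ∩ G)
    (hq : q ∈ V ∩ G)
    (hf : DifferentiableOn ℂ (fun t : ℂ => f (q + t • (p - q))) {t | q + t • (p - q) ∈ V ∩ G})
    (hg : DifferentiableOn ℂ (fun t : ℂ => g (q + t • (p - q))) {t | q + t • (p - q) ∈ V ∩ G})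
    (hfg : f =ᶠ[𝓝 q] g) : f p = g p := by
  have hcont : Continuous fun t : ℂ => q + t • (p - q) := by fun_prop
  set T : Set ℂ := {t | q + t • (p - q) ∈ V} with hTdef
  set Z : Set ℂ := {t | q + t • (p - q) ∉ G} with hZdef
  have hTopen : IsOpen T := hV.preimage hcont
  have hTconv : Convex ℝ T := by
    intro x hx z hz a b ha hb hab
    have := hVc hx hz ha hb hab
    have e : q + (a • x + b • z) • (p - q) = a • (q + x • (p - q)) + b • (q + z • (p - q)) := by
      generalize p - q = w
      have hab' : q = a • q + b • q := by rw [← add_smul, hab, one_smul]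
      simp only [add_smul, smul_add, smul_assoc]
      nth_rewrite 1 [hab']
      abel
    change q + (a • x + b • z) • (p - q) ∈ V
    rw [e]
    exact this
  have hset : {t : ℂ | q + t • (p - q) ∈ V ∩ G} = T \ Z := by
    ext t; simp [hTdef, hZdef]
  have h0 : (0 : ℂ) ∈ T \ Z := by rw [← hset]; simpa using hq
  have h1 : (1 : ℂ) ∈ T \ Z := by rw [← hset]; simpa using hp
  obtain ⟨S, hS, hSc, hS0, hS1⟩ := exists_isPreconnected_avoiding hTopen hTconv
    (hGl p hp.2 q hq.2) h0 h1
  have hopen : IsOpen (T \ Z) := by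
    rw [← hset]; exact (hV.inter hG).preimage hcont
  -- The connected set through `0` and `1` puts both points in one component of `T \ Z`, where the
  -- one-variable identity theorem carries the germ at `0`, that is at `q`, to `1`, that is to `p`.
  set C := connectedComponentIn (T \ Z) 0
  have hCo : IsOpen C := hopen.connectedComponentIn
  have hCs : C ⊆ T \ Z := connectedComponentIn_subset _ _
  have h1C : (1 : ℂ) ∈ C := hSc.subset_connectedComponentIn hS0 hS hS1
  have h0C : (0 : ℂ) ∈ C := mem_connectedComponentIn h0
  rw [hset] at hf hg
  have hfa := ((hf.mono hCs).analyticOnNhd hCo)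
  have hga := ((hg.mono hCs).analyticOnNhd hCo)
  have hev : (fun t : ℂ => f (q + t • (p - q))) =ᶠ[𝓝 0] fun t : ℂ => g (q + t • (p - q)) := by
    have ht : Tendsto (fun t : ℂ => q + t • (p - q)) (𝓝 0) (𝓝 q) := by
      have := hcont.tendsto 0
      simpa using this
    exact ht.eventually hfg
  have := hfa.eqOn_of_preconnected_of_eventuallyEq hga isPreconnected_connectedComponentIn h0C hev
    h1C
  simpa using this

/-- The identity theorem on a convex open set minus a set which is countable on lines. -/
theorem eqOn_of_eventuallyEq_of_lineGeneric {V G : Set E} (hV : IsOpen V) (hVc : Convex ℝ V)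
    (hG : IsOpen G) (hGl : LineGeneric G) {f g : E → ℂ} {q : E} (hq : q ∈ V ∩ G)
    (hf : DifferentiableOn ℂ f (V ∩ G)) (hg : DifferentiableOn ℂ g (V ∩ G))
    (hfg : f =ᶠ[𝓝 q] g) : EqOn f g (V ∩ G) := by
  intro p hp
  have hd (t : ℂ) : DifferentiableAt ℂ (fun t : ℂ => q + t • (p - q)) t := by fun_prop
  exact eq_of_eventuallyEq_on_lines hV hVc hG hGl hp hq
    (hf.comp (fun t _ => (hd t).differentiableWithinAt) fun t ht => ht)
    (hg.comp (fun t _ => (hd t).differentiableWithinAt) fun t ht => ht) hfg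

/-- A holomorphic function on `D` which agrees with `I` on `D ∩ U` is the holomorphic
continuation. -/
theorem holoCont_eq_of_unique {D U : Set E} {I f : E → ℂ} {p : E}
    (hf : DifferentiableOn ℂ f D) (hfI : EqOn f I (D ∩ U))
    (huniq : ∀ g : E → ℂ, DifferentiableOn ℂ g D → EqOn g f (D ∩ U) → g p = f p) :
    holoCont D U I p = f p := by
  have h : ∃ f : E → ℂ, DifferentiableOn ℂ f D ∧ Set.EqOn f I (D ∩ U) := ⟨f, hf, hfI⟩
  rw [holoCont, dif_pos h]
  exact huniq _ h.choose_spec.1 (h.choose_spec.2.trans hfI.symm)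

/-- To evaluate a continuation in the parameters it is enough to exhibit a holomorphic candidate
that agrees with the integral on its region of convergence: line-genericity of `D` makes the
candidate unique, as a connectedness argument would. -/
theorem holoCont_eq_of_lineGeneric {D U : Set E} (hD : IsOpen D) (hDl : LineGeneric D)
    (hU : IsOpen U) (hne : (D ∩ U).Nonempty) {I f : E → ℂ} (hf : DifferentiableOn ℂ f D)
    (hfI : EqOn f I (D ∩ U)) {p : E} (hp : p ∈ D) : holoCont D U I p = f p := by
  refine holoCont_eq_of_unique hf hfI fun g hg hgf => ?_
  obtain ⟨q, hq⟩ := hne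
  have := eqOn_of_eventuallyEq_of_lineGeneric isOpen_univ convex_univ hD hDl (f := g) (g := f)
    (q := q) ⟨mem_univ _, hq.1⟩ (by simpa using hg) (by simpa using hf)
    (hgf.eventuallyEq_of_mem ((hD.inter hU).mem_nhds hq))
  exact this ⟨mem_univ _, hp⟩

/-- The set where countably many affine functions are not integers is line generic. -/
theorem lineGeneric_iInter_notInt {ι : Type*} [Countable ι] (L : ι → E →ₗ[ℂ] ℂ) :
    LineGeneric {p : E | ∀ i, NotInt (L i p)} := by
  intro p hp q hq
  have : {t : ℂ | q + t • (p - q) ∉ {p : E | ∀ i, NotInt (L i p)}} ⊆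
      ⋃ (x : ι × ℤ), {t : ℂ | L x.1 (q + t • (p - q)) = x.2} := by
    intro t ht
    simp only [mem_ofPred_eq, not_forall, NotInt, not_not, ne_eq] at ht
    obtain ⟨i, n, h⟩ := ht
    exact mem_iUnion.2 ⟨(i, n), h⟩
  refine (countable_iUnion fun x => ?_).mono this
  apply Set.Subsingleton.countable
  intro s hs t ht
  simp only [mem_ofPred_eq, map_add, map_smul, smul_eq_mul] at hs ht
  have h1 : (s - t) * L x.1 (p - q) = 0 := by linear_combination hs - ht
  rcases mul_eq_zero.1 h1 with h | h
  · exact sub_eq_zero.1 h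
  · rw [h, mul_zero, add_zero] at hs
    exact absurd hs (hq x.1 x.2)

end Lines

theorem isOpen_setOf_notInt : IsOpen {s : ℂ | NotInt s} := by
  have : {s : ℂ | NotInt s} = (range ((↑) : ℤ → ℂ))ᶜ := by
    ext s; simp [NotInt, eq_comm]
  rw [this]
  exact Complex.isClosed_range_intCast.isOpen_compl

/-! ### The generic parameter set -/

section Generic

def genericForms : Fin 5 → (ℂ × ℂ × ℂ →ₗ[ℂ] ℂ) :=
  let a := LinearMap.fst ℂ ℂ (ℂ × ℂ)
  let b := (LinearMap.fst ℂ ℂ ℂ).comp (LinearMap.snd ℂ ℂ (ℂ × ℂ))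
  let c := (LinearMap.snd ℂ ℂ ℂ).comp (LinearMap.snd ℂ ℂ (ℂ × ℂ))
  ![a, b, c, c - a, c - b]

theorem genericParams_eq : genericParams = {p | ∀ i, NotInt (genericForms i p)} := by
  ext p
  simp [genericParams, genericForms, Fin.forall_fin_succ]

theorem isOpen_genericParams : IsOpen genericParams := by
  have e : genericParams = ⋂ i, {p | NotInt (genericForms i p)} := by
    rw [genericParams_eq]; ext; simp
  rw [e]
  exact isOpen_iInter_of_finite fun i =>
    isOpen_setOf_notInt.preimage (genericForms i).continuous_of_finiteDimensional

theorem lineGeneric_genericParams : LineGeneric genericParams := by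
  rw [genericParams_eq]; exact lineGeneric_iInter_notInt _

end Generic

/-! ### Holomorphic dependence of integrals on parameters -/

section Parametric

variable {E : Type*} [NormedAddCommGroup E] [NormedSpace ℂ E]
variable {X : Type*} [MeasurableSpace X] {μ : Measure X}

/-- In a basis the derivative is a finite sum of directional derivatives, and each of these is an
almost everywhere limit of measurable difference quotients. -/
theorem aestronglyMeasurable_fderiv_param [FiniteDimensional ℂ E] {f : E → X → ℂ} {p₀ : E}
    {r : ℝ} (hr : 0 < r) (hmeas : ∀ p ∈ Metric.ball p₀ r, AEStronglyMeasurable (f p) μ)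
    (hdiff : ∀ᵐ x ∂μ, DifferentiableAt ℂ (fun p => f p x) p₀) :
    AEStronglyMeasurable (fun x => fderiv ℂ (fun p => f p x) p₀) μ := by
  let B := Module.finBasis ℂ E
  have hdecomp (L : E →L[ℂ] ℂ) :
      L = ∑ i, L (B i) • (LinearMap.toContinuousLinearMap (B.coord i)) := by
    ext v
    conv_lhs => rw [← B.sum_repr v]
    rw [map_sum]
    simp [mul_comm]
  have hfun : (fun x => fderiv ℂ (fun p => f p x) p₀) = fun x =>
      ∑ i, (fderiv ℂ (fun p => f p x) p₀ (B i)) • (LinearMap.toContinuousLinearMap (B.coord i)) :=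
    funext fun x => hdecomp _
  rw [hfun]
  refine Finset.aestronglyMeasurable_fun_sum _ fun i _ => ?_
  refine AEStronglyMeasurable.smul_const ?_ _
  -- Starting the sequence of steps `1/(n + N + 1)` at this `N` keeps all evaluation points inside
  -- the ball where measurability is known.
  obtain ⟨N, hN⟩ := exists_nat_gt (‖B i‖ / r)
  refine aestronglyMeasurable_of_tendsto_ae atTop
    (f := fun n : ℕ => fun x => (((n + N + 1 : ℕ) : ℂ)) •
      (f (p₀ + (((n + N + 1 : ℕ) : ℂ)⁻¹) • B i) x - f p₀ x)) (fun n => ?_) ?_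
  · refine ((AEStronglyMeasurable.sub (hmeas _ ?_)
      (hmeas _ (Metric.mem_ball_self hr))).const_smul ((n + N + 1 : ℕ) : ℂ))
    rw [mem_ball_iff_norm, add_sub_cancel_left, norm_smul, norm_inv, Complex.norm_natCast]
    have h1 : (0 : ℝ) < ((n + N + 1 : ℕ) : ℝ) := by positivity
    rw [inv_mul_lt_iff₀ h1]
    rw [div_lt_iff₀ hr] at hN
    refine hN.trans_le ?_
    gcongr
    linarith [(Nat.cast_nonneg n : (0 : ℝ) ≤ n)]
  · filter_upwards [hdiff] with x hx
    refine hx.hasFDerivAt.lim (B i) ?_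
    simp only [Complex.norm_natCast]
    exact (tendsto_natCast_atTop_atTop (R := ℝ)).comp (tendsto_add_atTop_nat (N + 1))

/-- A parameter integral of holomorphic functions with local domination is holomorphic. -/
theorem differentiableAt_integral_of_dominated [FiniteDimensional ℂ E] {f : E → X → ℂ} {p₀ : E}
    {r : ℝ} (hr : 0 < r) {bound : X → ℝ}
    (hmeas : ∀ p ∈ Metric.ball p₀ r, AEStronglyMeasurable (f p) μ)
    (hdiff : ∀ᵐ x ∂μ, DifferentiableOn ℂ (fun p => f p x) (Metric.ball p₀ r))
    (hbound : ∀ᵐ x ∂μ, ∀ p ∈ Metric.ball p₀ r, ‖f p x‖ ≤ bound x)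
    (hint : Integrable bound μ) :
    DifferentiableAt ℂ (fun p => ∫ x, f p x ∂μ) p₀ := by
  have hr2 : 0 < r / 2 := by positivity
  -- No bound on the derivative is assumed: Cauchy's estimate on balls of radius `r / 2` supplies
  -- one. The factor `2` comes from bounding `f(z) - f(p)`.
  refine (hasFDerivAt_integral_of_dominated_of_fderiv_le (𝕜 := ℂ)
    (F' := fun p x => fderiv ℂ (fun p => f p x) p) (bound := fun x => 2 * bound x / (r / 2))
    (s := Metric.ball p₀ (r / 2)) (Metric.ball_mem_nhds _ hr2) ?_ ?_ ?_ ?_ ?_ ?_).differentiableAt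
  · filter_upwards [Metric.ball_mem_nhds _ hr] with p hp using hmeas p hp
  · refine hint.mono' (hmeas _ (Metric.mem_ball_self hr)) ?_
    filter_upwards [hbound] with x hx using hx _ (Metric.mem_ball_self hr)
  · refine aestronglyMeasurable_fderiv_param hr hmeas ?_
    filter_upwards [hdiff] with x hx
    exact hx.differentiableAt (Metric.ball_mem_nhds _ hr)
  · filter_upwards [hdiff, hbound] with x hd hb p hp
    have hsub : Metric.ball p (r / 2) ⊆ Metric.ball p₀ r := by
      refine Metric.ball_subset_ball' ?_
      have := Metric.mem_ball.1 hp
      linarith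
    refine Complex.norm_fderiv_le_div_of_mapsTo_ball (hd.mono hsub) (fun z hz => ?_) hr2
    rw [mem_closedBall_iff_norm]
    refine (norm_sub_le _ _).trans ?_
    have h1 := hb z (hsub hz)
    have h2 := hb p (hsub (Metric.mem_ball_self hr2))
    linarith
  · exact (hint.const_mul 2).div_const _
  · filter_upwards [hdiff] with x hd p hp
    have hp' : p ∈ Metric.ball p₀ r := Metric.ball_subset_ball (by linarith) hp
    exact (hd.differentiableAt (Metric.isOpen_ball.mem_nhds hp')).hasFDerivAt

end Parametric

/-! ### The plane cut along `[1, +∞)` -/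

section CutPlane

theorem isOpen_cutPlane : IsOpen cutPlane :=
  Complex.isOpen_slitPlane.preimage (by fun_prop)

/-- The slit plane is star-shaped about `1`, and `1 - yt` runs over the segment from `1` to `1 - y`.
This keeps the third factor of Euler's integrand on the principal branch. -/
theorem one_sub_mul_mem_slitPlane {y : ℂ} (hy : y ∈ cutPlane) {t : ℝ} (ht : t ∈ Icc (0 : ℝ) 1) :
    1 - y * t ∈ Complex.slitPlane := by
  have h := Complex.starConvex_one_slitPlane.add_smul_mem (x := (1 : ℂ)) (y := -y)
    (by simpa [sub_eq_add_neg, cutPlane] using hy) ht.1 ht.2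
  have e : (1 : ℂ) - y * t = 1 + t • (-y) := by
    rw [Complex.real_smul]; ring
  rwa [e]

theorem ball_subset_cutPlane : Metric.ball (0 : ℂ) 1 ⊆ cutPlane := by
  intro y hy
  have := Complex.mem_slitPlane_of_norm_lt_one (z := -y) (by simpa using hy)
  simpa [cutPlane, sub_eq_add_neg] using this

theorem zero_mem_cutPlane : (0 : ℂ) ∈ cutPlane :=
  ball_subset_cutPlane (Metric.mem_ball_self one_pos)

theorem isPreconnected_cutPlane : IsPreconnected cutPlane := by
  have : StarConvex ℝ (0 : ℂ) cutPlane := by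
    rw [starConvex_iff_forall_pos zero_mem_cutPlane]
    intro y hy s t hs ht hst
    have := one_sub_mul_mem_slitPlane hy (t := t) ⟨ht.le, by linarith⟩
    change 1 - (s • (0:ℂ) + t • y) ∈ Complex.slitPlane
    simpa [mul_comm] using this
  exact (this.isPathConnected zero_mem_cutPlane).isConnected.isPreconnected

theorem conj_mem_cutPlane {y : ℂ} (hy : y ∈ cutPlane) : conj y ∈ cutPlane := by
  have h : 1 - y ∈ Complex.slitPlane := hy
  change 1 - conj y ∈ Complex.slitPlane
  rw [Complex.mem_slitPlane_iff] at h ⊢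
  simpa using h

end CutPlane

/-! ### The hypergeometric series and two contiguous relations -/

section Series

theorem _root_.HasSum.congr_term {f g : ℕ → ℂ} {s : ℂ} (hf : HasSum f s) (h : ∀ n, f n = g n) :
    HasSum g s := funext h ▸ hf

/-- The coefficients of the hypergeometric series. -/
def hypCoeff (a b c : ℂ) (n : ℕ) : ℂ :=
  (n.factorial : ℂ)⁻¹ * (ascPochhammer ℂ n).eval a * (ascPochhammer ℂ n).eval b *
    ((ascPochhammer ℂ n).eval c)⁻¹

theorem ascPochhammer_eval_succ_left (a : ℂ) (n : ℕ) :
    (ascPochhammer ℂ (n + 1)).eval a = a * (ascPochhammer ℂ n).eval (a + 1) := by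
  simp [ascPochhammer_succ_left]

theorem ascPochhammer_eval_ne_zero {c : ℂ} (hc : ∀ k : ℕ, c ≠ -k) (n : ℕ) :
    (ascPochhammer ℂ n).eval c ≠ 0 := by
  induction n with
  | zero => simp
  | succ n ih =>
    rw [ascPochhammer_succ_eval]
    exact mul_ne_zero ih fun h => hc n (by linear_combination h)

/-- The radius is `1` unless the series terminates, when it is infinite; the terminating cases have
to be separated. -/
theorem one_le_radius_hyp {a b c : ℂ} (hc : ∀ k : ℕ, c ≠ -k) :
    1 ≤ (ordinaryHypergeometricSeries ℂ a b c).radius := by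
  by_cases ha : ∃ k : ℕ, (k : ℂ) = -a
  · obtain ⟨k, hk⟩ := ha
    have : a = -k := by rw [hk, neg_neg]
    subst this
    rw [ordinaryHypergeometric_radius_top_of_neg_nat₁]; exact le_top
  by_cases hb : ∃ k : ℕ, (k : ℂ) = -b
  · obtain ⟨k, hk⟩ := hb
    have : b = -k := by rw [hk, neg_neg]
    subst this
    rw [ordinaryHypergeometric_radius_top_of_neg_nat₂]; exact le_top
  push Not at ha hb
  rw [ordinaryHypergeometricSeries_radius_eq_one]
  exact fun k => ⟨ha k, hb k, fun h => hc k (by rw [h, neg_neg])⟩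

theorem hasSum_hyp {a b c : ℂ} (hc : ∀ k : ℕ, c ≠ -k) {y : ℂ} (hy : y ∈ Metric.ball (0 : ℂ) 1) :
    HasSum (fun n => hypCoeff a b c n * y ^ n) (ordinaryHypergeometric a b c y) := by
  have hy' : y ∈ Metric.eball (0 : ℂ) (ordinaryHypergeometricSeries ℂ a b c).radius := by
    refine Metric.eball_subset_eball (one_le_radius_hyp hc) ?_
    rw [← ENNReal.ofReal_one, Metric.eball_ofReal]
    exact hy
  have := (ordinaryHypergeometricSeries ℂ a b c).hasSum hy'
  simp only [ordinaryHypergeometricSeries_apply_eq, smul_eq_mul] at this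
  exact this

/-- Both functions on the right have `c - b` raised by `1`, with `b` unchanged or raised. Iteration
moves `Re (c - b)` into the half plane where Euler's integral converges. -/
theorem hyp_contiguous_c {a b c : ℂ} (hc : ∀ k : ℕ, c ≠ -k) {y : ℂ}
    (hy : y ∈ Metric.ball (0 : ℂ) 1) :
    ordinaryHypergeometric a b c y = ordinaryHypergeometric a b (c + 1) y
      + a * b * y / (c * (c + 1)) * ordinaryHypergeometric (a + 1) (b + 1) (c + 2) y := by
  have hc1 : ∀ k : ℕ, c + 1 ≠ -k := fun k h => hc (k + 1) (by push_cast; linear_combination h)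
  have hc2 : ∀ k : ℕ, c + 2 ≠ -k := fun k h => hc (k + 2) (by push_cast; linear_combination h)
  -- The constant terms agree and are dropped. The factor `y` of the last series then shifts its
  -- index, so that all coefficients of `y^(n+1)` are compared at once.
  have h1 := (hasSum_nat_add_iff' 1).2 (hasSum_hyp (a := a) (b := b) hc hy)
  have h2 := (hasSum_nat_add_iff' 1).2 (hasSum_hyp (a := a) (b := b) hc1 hy)
  have h3 := (hasSum_hyp (a := a + 1) (b := b + 1) hc2 hy).mul_left (a * b * y / (c * (c + 1)))
  have hc0 : c ≠ 0 := by simpa using hc 0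
  have hc10 : c + 1 ≠ 0 := by simpa using hc1 0
  have h4 := h1.unique ((h2.add h3).congr_term fun n => ?_)
  · simp [hypCoeff] at h4
    linear_combination h4
  · have hn1 : c + 1 + n ≠ 0 := fun h => hc1 n (by linear_combination h)
    have hP := ascPochhammer_eval_ne_zero hc1 n
    have e1 := ascPochhammer_eval_succ_left (c + 1) n
    rw [ascPochhammer_succ_eval, show c + 1 + 1 = c + 2 by ring] at e1
    have e2 : (ascPochhammer ℂ n).eval (c + 2) =
        (ascPochhammer ℂ n).eval (c + 1) * (c + 1 + n) / (c + 1) := by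
      rw [eq_div_iff hc10, e1]; ring
    have hn : (n : ℂ) + 1 ≠ 0 := by exact_mod_cast n.succ_ne_zero
    have hf : (n.factorial : ℂ) ≠ 0 := by exact_mod_cast n.factorial_ne_zero
    simp only [hypCoeff, ascPochhammer_eval_succ_left a, ascPochhammer_eval_succ_left b,
      ascPochhammer_eval_succ_left c, ascPochhammer_succ_eval n (c + 1), e2, Nat.factorial_succ]
    push_cast
    field_simp
    ring

/-- Here both functions on the right have `b` raised by `1`, with `c - b` unchanged or raised, so
iteration moves `Re b` into the half plane of convergence. -/
theorem hyp_contiguous_b {a b c : ℂ} (hc : ∀ k : ℕ, c ≠ -k) {y : ℂ}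
    (hy : y ∈ Metric.ball (0 : ℂ) 1) :
    ordinaryHypergeometric a b c y = ordinaryHypergeometric a (b + 1) (c + 1) y
      - a * (c - b) * y / (c * (c + 1)) * ordinaryHypergeometric (a + 1) (b + 1) (c + 2) y := by
  have hc1 : ∀ k : ℕ, c + 1 ≠ -k := fun k h => hc (k + 1) (by push_cast; linear_combination h)
  have hc2 : ∀ k : ℕ, c + 2 ≠ -k := fun k h => hc (k + 2) (by push_cast; linear_combination h)
  have h1 := (hasSum_nat_add_iff' 1).2 (hasSum_hyp (a := a) (b := b) hc hy)
  have h2 := (hasSum_nat_add_iff' 1).2 (hasSum_hyp (a := a) (b := b + 1) hc1 hy)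
  have h3 := (hasSum_hyp (a := a + 1) (b := b + 1) hc2 hy).mul_left
    (a * (c - b) * y / (c * (c + 1)))
  have hc0 : c ≠ 0 := by simpa using hc 0
  have hc10 : c + 1 ≠ 0 := by simpa using hc1 0
  have h4 := h1.unique ((h2.sub h3).congr_term fun n => ?_)
  · simp [hypCoeff] at h4
    linear_combination h4
  · have hn1 : c + 1 + n ≠ 0 := fun h => hc1 n (by linear_combination h)
    have hP := ascPochhammer_eval_ne_zero hc1 n
    have e1 := ascPochhammer_eval_succ_left (c + 1) n
    rw [ascPochhammer_succ_eval, show c + 1 + 1 = c + 2 by ring] at e1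
    have e2 : (ascPochhammer ℂ n).eval (c + 2) =
        (ascPochhammer ℂ n).eval (c + 1) * (c + 1 + n) / (c + 1) := by
      rw [eq_div_iff hc10, e1]; ring
    have hn : (n : ℂ) + 1 ≠ 0 := by exact_mod_cast n.succ_ne_zero
    have hf : (n.factorial : ℂ) ≠ 0 := by exact_mod_cast n.factorial_ne_zero
    simp only [hypCoeff, ascPochhammer_eval_succ_left a, ascPochhammer_eval_succ_left b,
      ascPochhammer_eval_succ_left c, ascPochhammer_succ_eval n (c + 1),
      ascPochhammer_succ_eval n (b + 1), e2, Nat.factorial_succ]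
    push_cast
    field_simp
    ring

end Series

/-! ### Euler's integral: convergence, holomorphy, expansion in the disc -/

section Euler

/-- Euler's integral for the hypergeometric function. -/
def eulerIntegral (a b c y : ℂ) : ℂ :=
  ∫ t in Ioo (0 : ℝ) 1, (t : ℂ) ^ (b - 1) * (1 - (t : ℂ)) ^ (c - b - 1) * (1 - y * t) ^ (-a)

theorem integrableOn_beta_kernel {s t : ℝ} (hs : 0 < s) (ht : 0 < t) :
    IntegrableOn (fun x : ℝ => x ^ (s - 1) * (1 - x) ^ (t - 1)) (Ioo 0 1) := by
  have h := (Complex.betaIntegral_convergent (u := s) (v := t) (by simpa) (by simpa)).1.norm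
  rw [← restrict_Ioo_eq_restrict_Ioc] at h
  refine (integrable_congr ?_).1 h
  refine (ae_restrict_mem measurableSet_Ioo).mono fun x hx => ?_
  have h1 : (0 : ℝ) < 1 - x := by linarith [hx.2]
  have e : (1 : ℂ) - x = ((1 - x : ℝ) : ℂ) := by push_cast; ring
  simp only [norm_mul, e]
  rw [Complex.norm_cpow_eq_rpow_re_of_pos hx.1, Complex.norm_cpow_eq_rpow_re_of_pos h1]
  simp

theorem norm_euler_kernel_le {b d : ℂ} {β δ : ℝ} (hb : β ≤ b.re) (hd : δ ≤ d.re) {t : ℝ}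
    (ht : t ∈ Ioo (0 : ℝ) 1) :
    ‖(t : ℂ) ^ (b - 1) * (1 - (t : ℂ)) ^ (d - 1)‖ ≤ t ^ (β - 1) * (1 - t) ^ (δ - 1) := by
  have h1 : (0 : ℝ) < 1 - t := by linarith [ht.2]
  have e : (1 : ℂ) - t = ((1 - t : ℝ) : ℂ) := by push_cast; ring
  rw [norm_mul, e, Complex.norm_cpow_eq_rpow_re_of_pos ht.1,
    Complex.norm_cpow_eq_rpow_re_of_pos h1]
  refine mul_le_mul ?_ ?_ (by positivity) (by have := ht.1; positivity)
  · exact Real.rpow_le_rpow_of_exponent_ge ht.1 ht.2.le (by simpa using hb)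
  · exact Real.rpow_le_rpow_of_exponent_ge h1 (by linarith [ht.1]) (by simpa using hd)

theorem continuousOn_euler_kernel {a b d y : ℂ} (hy : y ∈ cutPlane) :
    ContinuousOn (fun t : ℝ => (t : ℂ) ^ (b - 1) * (1 - (t : ℂ)) ^ (d - 1) * (1 - y * t) ^ (-a))
      (Ioo 0 1) := by
  have hc : Continuous fun t : ℝ => (t : ℂ) := Complex.continuous_ofReal
  refine ((ContinuousOn.cpow_const hc.continuousOn fun t ht => ?_).mul
    (ContinuousOn.cpow_const (by fun_prop) fun t ht => ?_)).mul
    (ContinuousOn.cpow_const (by fun_prop) fun t ht => ?_)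
  · exact Complex.ofReal_mem_slitPlane.2 ht.1
  · have e : (1 : ℂ) - t = ((1 - t : ℝ) : ℂ) := by push_cast; ring
    rw [e]
    exact Complex.ofReal_mem_slitPlane.2 (by linarith [ht.2])
  · exact one_sub_mul_mem_slitPlane hy (Ioo_subset_Icc_self ht)

/-- The parameters for which Euler's integral converges. -/
def eulerDomain : Set (ℂ × ℂ × ℂ × ℂ) :=
  {p | 0 < p.2.1.re ∧ 0 < (p.2.2.1 - p.2.1).re ∧ p.2.2.2 ∈ cutPlane}

/-- Near `p₀` the real parts of `b` and `c - b` stay above half their values, which gives one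
integrable beta kernel as majorant. The remaining factor is continuous on a compact set, because `1
- yt` avoids the cut up to both ends of `[0,1]`. -/
theorem euler_local_bound {p₀ : ℂ × ℂ × ℂ × ℂ} (hp₀ : p₀ ∈ eulerDomain) :
    ∃ r > 0, Metric.ball p₀ r ⊆ eulerDomain ∧ ∃ bound : ℝ → ℝ, IntegrableOn bound (Ioo 0 1) ∧
      ∀ t ∈ Ioo (0 : ℝ) 1, ∀ p ∈ Metric.ball p₀ r,
        ‖(t : ℂ) ^ (p.2.1 - 1) * (1 - (t : ℂ)) ^ (p.2.2.1 - p.2.1 - 1)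
          * (1 - p.2.2.2 * t) ^ (-p.1)‖ ≤ bound t := by
  obtain ⟨hb, hd, hy⟩ := hp₀
  let W : Set (ℂ × ℂ × ℂ × ℂ) := {p | p₀.2.1.re / 2 < p.2.1.re ∧
    (p₀.2.2.1 - p₀.2.1).re / 2 < (p.2.2.1 - p.2.1).re ∧ p.2.2.2 ∈ cutPlane}
  have hW : IsOpen W := by
    have h1 : Continuous fun p : ℂ × ℂ × ℂ × ℂ => p.2.1.re :=
      Complex.continuous_re.comp (by fun_prop)
    have h2 : Continuous fun p : ℂ × ℂ × ℂ × ℂ => (p.2.2.1 - p.2.1).re :=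
      Complex.continuous_re.comp (by fun_prop)
    have h3 : Continuous fun p : ℂ × ℂ × ℂ × ℂ => p.2.2.2 := by fun_prop
    exact (isOpen_lt continuous_const h1).inter ((isOpen_lt continuous_const h2).inter
      (isOpen_cutPlane.preimage h3))
  have hpW : p₀ ∈ W := ⟨by linarith, by linarith, hy⟩
  obtain ⟨r, hr, hrW⟩ := Metric.nhds_basis_closedBall.mem_iff.1 (hW.mem_nhds hpW)
  have hcomp : IsCompact (Metric.closedBall p₀ r ×ˢ Icc (0 : ℝ) 1) :=
    (isCompact_closedBall _ _).prod isCompact_Icc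
  have hcont : ContinuousOn (fun x : (ℂ × ℂ × ℂ × ℂ) × ℝ => (1 - x.1.2.2.2 * x.2) ^ (-x.1.1))
      (Metric.closedBall p₀ r ×ˢ Icc (0 : ℝ) 1) := by
    refine ContinuousOn.cpow (by fun_prop) (by fun_prop) fun x hx => ?_
    exact one_sub_mul_mem_slitPlane (hrW hx.1).2.2 hx.2
  obtain ⟨K, hK⟩ := hcomp.exists_bound_of_continuousOn hcont
  refine ⟨r, hr, fun p hp => ?_, fun t => t ^ (p₀.2.1.re / 2 - 1)
    * (1 - t) ^ ((p₀.2.2.1 - p₀.2.1).re / 2 - 1) * K, ?_, ?_⟩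
  · have := hrW (Metric.ball_subset_closedBall hp)
    exact ⟨by linarith [this.1], by linarith [this.2.1], this.2.2⟩
  · exact (integrableOn_beta_kernel (by linarith) (by linarith)).mul_const K
  · intro t ht p hp
    have hp' := Metric.ball_subset_closedBall hp
    have := hrW hp'
    rw [norm_mul]
    have h1 : (0 : ℝ) < 1 - t := by linarith [ht.2]
    have h0 := ht.1
    exact mul_le_mul (norm_euler_kernel_le this.1.le this.2.1.le ht)
      (hK (p, t) ⟨hp', Ioo_subset_Icc_self ht⟩) (norm_nonneg _) (by positivity)

theorem integrableOn_euler {a b c y : ℂ} (hb : 0 < b.re) (hd : 0 < (c - b).re)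
    (hy : y ∈ cutPlane) :
    IntegrableOn (fun t : ℝ => (t : ℂ) ^ (b - 1) * (1 - (t : ℂ)) ^ (c - b - 1)
      * (1 - y * t) ^ (-a)) (Ioo 0 1) := by
  obtain ⟨r, hr, -, bound, hint, hb'⟩ := euler_local_bound (p₀ := (a, b, c, y)) ⟨hb, hd, hy⟩
  have hm := (continuousOn_euler_kernel (a := a) (b := b) (d := c - b) hy).aestronglyMeasurable
    (μ := volume) measurableSet_Ioo
  refine Integrable.mono' hint hm ?_
  refine (ae_restrict_mem measurableSet_Ioo).mono fun t ht => ?_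
  exact hb' t ht (a, b, c, y) (Metric.mem_ball_self hr)

theorem differentiableAt_eulerIntegral {p₀ : ℂ × ℂ × ℂ × ℂ} (hp₀ : p₀ ∈ eulerDomain) :
    DifferentiableAt ℂ (fun p : ℂ × ℂ × ℂ × ℂ => eulerIntegral p.1 p.2.1 p.2.2.1 p.2.2.2) p₀ := by
  obtain ⟨r, hr, hsub, bound, hint, hb'⟩ := euler_local_bound hp₀
  refine differentiableAt_integral_of_dominated hr (bound := bound) (fun p hp => ?_) ?_ ?_ hint
  · exact (continuousOn_euler_kernel (hsub hp).2.2).aestronglyMeasurable measurableSet_Ioo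
  · refine (ae_restrict_mem measurableSet_Ioo).mono fun t ht => ?_
    intro p hp
    apply DifferentiableAt.differentiableWithinAt
    have h0 : (t : ℂ) ≠ 0 := by exact_mod_cast ht.1.ne'
    have h1 : (1 : ℂ) - t ≠ 0 := by
      have : (1 - t : ℝ) ≠ 0 := by linarith [ht.2]
      exact_mod_cast this
    have h2 := one_sub_mul_mem_slitPlane (hsub hp).2.2 (Ioo_subset_Icc_self ht)
    refine ((DifferentiableAt.const_cpow (by fun_prop) (Or.inl h0)).mul
      (DifferentiableAt.const_cpow (by fun_prop) (Or.inl h1))).mul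
      (DifferentiableAt.cpow (by fun_prop) (by fun_prop) h2)
  · exact (ae_restrict_mem measurableSet_Ioo).mono fun t ht => hb' t ht

theorem Gamma_add_nat {z : ℂ} (hz : ∀ k : ℕ, z ≠ -k) (n : ℕ) :
    Complex.Gamma (z + n) = (ascPochhammer ℂ n).eval z * Complex.Gamma z := by
  rw [← Complex.Gamma_add_nat_div_Gamma_eq z hz, div_mul_cancel₀ _ (Complex.Gamma_ne_zero hz)]

theorem ne_neg_nat_of_re_pos {z : ℂ} (hz : 0 < z.re) (k : ℕ) : z ≠ -k := by
  rintro rfl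
  simp at hz
  linarith [(Nat.cast_nonneg k : (0 : ℝ) ≤ k)]

theorem hasSum_one_sub_cpow {a x : ℂ} (hx : ‖x‖ < 1) :
    HasSum (fun n => (n.factorial : ℂ)⁻¹ * (ascPochhammer ℂ n).eval a * x ^ n)
      ((1 - x) ^ (-a)) := by
  have h := (Complex.one_div_one_sub_cpow_hasFPowerSeriesOnBall_zero a).hasSum (y := x) (by
    rw [← ENNReal.ofReal_one, Metric.eball_ofReal]; simpa using hx)
  simp only [FormalMultilinearSeries.ofScalars_apply_eq, zero_add, smul_eq_mul, one_div] at h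
  rw [Complex.cpow_neg]
  refine h.congr_term fun n => ?_
  have e : (n.factorial : ℂ) * Ring.choose (a + n - 1) n = (ascPochhammer ℂ n).eval a := by
    have := Ring.factorial_nsmul_multichoose_eq_ascPochhammer a n
    rw [Polynomial.ascPochhammer_smeval_eq_eval, nsmul_eq_mul] at this
    rw [← this, Ring.choose, show a + n - 1 - n + 1 = a by ring]
  rw [← e]
  have hf : (n.factorial : ℂ) ≠ 0 := by exact_mod_cast n.factorial_ne_zero
  field_simp

/-- Expand `(1 - yt)^(-a)` by the binomial series and integrate term by term: each term is a beta
integral. The series converges absolutely already at `t = 1`, which dominates all `t`. -/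
theorem eulerIntegral_eq_of_norm_lt_one {a b c y : ℂ} (hb : 0 < b.re) (hd : 0 < (c - b).re)
    (hy : y ∈ Metric.ball (0 : ℂ) 1) :
    eulerIntegral a b c y = eulerBeta b (c - b) * ordinaryHypergeometric a b c y := by
  have hy1 : ‖y‖ < 1 := by simpa using hy
  have hc : 0 < c.re := by simp at hd; linarith
  have hsum := (hasSum_hyp (a := a) (b := b) (ne_neg_nat_of_re_pos hc) hy).mul_left
    (eulerBeta b (c - b))
  refine HasSum.unique ?_ hsum
  have hterm (n : ℕ) : ∫ t in Ioo (0 : ℝ) 1, (t : ℂ) ^ (b - 1) * (1 - (t : ℂ)) ^ (c - b - 1)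
      * ((n.factorial : ℂ)⁻¹ * (ascPochhammer ℂ n).eval a * (y * t) ^ n)
      = eulerBeta b (c - b) * (hypCoeff a b c n * y ^ n) := by
    have e : ∀ t ∈ Ioo (0 : ℝ) 1, (t : ℂ) ^ (b - 1) * (1 - (t : ℂ)) ^ (c - b - 1)
      * ((n.factorial : ℂ)⁻¹ * (ascPochhammer ℂ n).eval a * (y * t) ^ n)
      = ((n.factorial : ℂ)⁻¹ * (ascPochhammer ℂ n).eval a * y ^ n) *
        ((t : ℂ) ^ (b + n - 1) * (1 - (t : ℂ)) ^ (c - b - 1)) := by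
      intro t ht
      have h0 : (t : ℂ) ≠ 0 := by exact_mod_cast ht.1.ne'
      rw [show b + n - 1 = (b - 1) + n by ring, Complex.cpow_add _ _ h0, Complex.cpow_natCast]
      ring
    rw [setIntegral_congr_fun measurableSet_Ioo e, integral_const_mul]
    have hbn : 0 < (b + n).re := by
      simp; linarith [(Nat.cast_nonneg n : (0 : ℝ) ≤ n)]
    have hB : ∫ t in Ioo (0 : ℝ) 1, (t : ℂ) ^ (b + n - 1) * (1 - (t : ℂ)) ^ (c - b - 1)
        = Complex.betaIntegral (b + n) (c - b) := by
      rw [Complex.betaIntegral, intervalIntegral.integral_of_le zero_le_one,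
        integral_Ioc_eq_integral_Ioo]
    rw [hB, Complex.betaIntegral_eq_Gamma_mul_div _ _ hbn hd,
      show b + n + (c - b) = c + n by ring, Gamma_add_nat (ne_neg_nat_of_re_pos hb),
      Gamma_add_nat (ne_neg_nat_of_re_pos hc), eulerBeta, hypCoeff,
      show b + (c - b) = c by ring]
    have := ascPochhammer_eval_ne_zero (ne_neg_nat_of_re_pos hc) n
    field_simp
  simp_rw [← hterm]
  have hS : Summable fun n : ℕ => ‖(n.factorial : ℂ)⁻¹ * (ascPochhammer ℂ n).eval a * y ^ n‖ :=
    (hasSum_one_sub_cpow hy1).summable.norm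
  refine hasSum_integral_of_dominated_convergence
    (bound := fun n t => t ^ (b.re - 1) * (1 - t) ^ ((c - b).re - 1) *
      ‖(n.factorial : ℂ)⁻¹ * (ascPochhammer ℂ n).eval a * y ^ n‖) (fun n => ?_) (fun n => ?_) ?_ ?_ ?_
  · have h1 := (integrableOn_euler (a := 0) hb hd
      (ball_subset_cutPlane (Metric.mem_ball_self one_pos))).aestronglyMeasurable
    simp only [zero_mul, sub_zero, Complex.one_cpow, mul_one] at h1
    exact h1.mul (by fun_prop)
  · refine (ae_restrict_mem measurableSet_Ioo).mono fun t ht => ?_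
    have h1 : (0 : ℝ) < 1 - t := by linarith [ht.2]
    have h0 := ht.1
    rw [norm_mul]
    refine mul_le_mul (norm_euler_kernel_le le_rfl le_rfl ht) ?_ (norm_nonneg _) (by positivity)
    rw [mul_pow, ← mul_assoc, norm_mul _ ((t : ℂ) ^ n)]
    refine mul_le_of_le_one_right (norm_nonneg _) ?_
    rw [norm_pow, Complex.norm_real, Real.norm_of_nonneg h0.le]
    exact pow_le_one₀ h0.le ht.2.le
  · exact Eventually.of_forall fun t => hS.mul_left _
  · simp_rw [tsum_mul_left]
    exact (integrableOn_beta_kernel hb hd).mul_const _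
  · refine (ae_restrict_mem measurableSet_Ioo).mono fun t ht => ?_
    refine (hasSum_one_sub_cpow ?_).mul_left _
    rw [norm_mul, Complex.norm_real, Real.norm_of_nonneg ht.1.le]
    exact mul_lt_one_of_nonneg_of_lt_one_left (norm_nonneg _) hy1 ht.2.le

end Euler

/-! ### Joint continuation of the hypergeometric function -/

section HypF

theorem hypF_eq_of_differentiableOn {a b c : ℂ} {f : ℂ → ℂ} (hf : DifferentiableOn ℂ f cutPlane)
    (hfe : ∀ y ∈ Metric.ball (0 : ℂ) 1, f y = ordinaryHypergeometric a b c y) {y : ℂ}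
    (hy : y ∈ cutPlane) : hypF a b c y = f y := by
  refine holoCont_eq_of_unique hf (fun x hx => hfe x hx.2) fun g hg hgf => ?_
  refine (hg.analyticOnNhd isOpen_cutPlane).eqOn_of_preconnected_of_eventuallyEq
    (hf.analyticOnNhd isOpen_cutPlane) isPreconnected_cutPlane zero_mem_cutPlane ?_ hy
  rw [inter_eq_right.2 ball_subset_cutPlane] at hgf
  exact hgf.eventuallyEq_of_mem (Metric.ball_mem_nhds _ one_pos)

/-- The hypergeometric function continues to the cut plane, holomorphically in all variables, for
parameters in `S`. -/
def HypContinues (S : Set (ℂ × ℂ × ℂ)) : Prop :=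
  (∀ p ∈ S, ∀ y ∈ Metric.ball (0 : ℂ) 1,
    hypF p.1 p.2.1 p.2.2 y = ordinaryHypergeometric p.1 p.2.1 p.2.2 y) ∧
  DifferentiableOn ℂ (fun p : ℂ × ℂ × ℂ × ℂ => hypF p.1 p.2.1 p.2.2.1 p.2.2.2)
    {p | (p.1, p.2.1, p.2.2.1) ∈ S ∧ p.2.2.2 ∈ cutPlane}

/-- The cut plane is connected, so any jointly holomorphic expression that sums to the series on the
disc is `hypF`. Joint holomorphy is thereby transferred to `hypF`, although `hypF` is defined one
parameter triple at a time. -/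
theorem HypContinues.of_candidate {S : Set (ℂ × ℂ × ℂ)} {f : ℂ × ℂ × ℂ × ℂ → ℂ}
    (hf : DifferentiableOn ℂ f {p | (p.1, p.2.1, p.2.2.1) ∈ S ∧ p.2.2.2 ∈ cutPlane})
    (hfe : ∀ p ∈ S, ∀ y ∈ Metric.ball (0 : ℂ) 1,
      f (p.1, p.2.1, p.2.2, y) = ordinaryHypergeometric p.1 p.2.1 p.2.2 y) :
    HypContinues S ∧ ∀ p ∈ S, ∀ y ∈ cutPlane, hypF p.1 p.2.1 p.2.2 y = f (p.1, p.2.1, p.2.2, y) := by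
  have key : ∀ p ∈ S, ∀ y ∈ cutPlane,
      hypF p.1 p.2.1 p.2.2 y = f (p.1, p.2.1, p.2.2, y) := by
    intro p hp y hy
    refine hypF_eq_of_differentiableOn (f := fun y => f (p.1, p.2.1, p.2.2, y)) ?_ (hfe p hp) hy
    exact hf.comp (by fun_prop) fun x hx => ⟨hp, hx⟩
  refine ⟨⟨fun p hp y hy => ?_, hf.congr fun p hp => key (p.1, p.2.1, p.2.2.1) hp.1 _ hp.2⟩, key⟩
  rw [key p hp y (ball_subset_cutPlane hy), hfe p hp y hy]

theorem eulerBeta_ne_zero {b d : ℂ} (hb : ∀ k : ℕ, b ≠ -k) (hd : ∀ k : ℕ, d ≠ -k)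
    (hc : ∀ k : ℕ, b + d ≠ -k) : eulerBeta b d ≠ 0 :=
  div_ne_zero (mul_ne_zero (Complex.Gamma_ne_zero hb) (Complex.Gamma_ne_zero hd))
    (Complex.Gamma_ne_zero hc)

theorem DifferentiableAt.div_of_ne {E : Type*} [NormedAddCommGroup E] [NormedSpace ℂ E]
    {f g : E → ℂ} {x : E} (hf : DifferentiableAt ℂ f x) (hg : DifferentiableAt ℂ g x)
    (h : g x ≠ 0) : DifferentiableAt ℂ (fun p => f p / g p) x := by
  simpa only [div_eq_mul_inv] using hf.fun_mul (hg.fun_inv h)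

theorem DifferentiableAt.eulerBeta {E : Type*} [NormedAddCommGroup E] [NormedSpace ℂ E]
    {f g : E → ℂ} {x : E} (hf : DifferentiableAt ℂ f x) (hg : DifferentiableAt ℂ g x)
    (h1 : ∀ k : ℕ, f x ≠ -k) (h2 : ∀ k : ℕ, g x ≠ -k) (h3 : ∀ k : ℕ, f x + g x ≠ -k) :
    DifferentiableAt ℂ (fun p => eulerBeta (f p) (g p)) x := by
  have g1 := (Complex.differentiableAt_Gamma _ h1).comp x hf
  have g2 := (Complex.differentiableAt_Gamma _ h2).comp x hg
  have g3 : DifferentiableAt ℂ (fun p => Complex.Gamma (f p + g p)) x :=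
    (Complex.differentiableAt_Gamma _ h3).comp x (hf.add hg)
  exact DifferentiableAt.div_of_ne (g1.mul g2) g3 (Complex.Gamma_ne_zero h3)

theorem HypContinues.euler :
    HypContinues {p | 0 < p.2.1.re ∧ 0 < (p.2.2 - p.2.1).re} ∧
    ∀ a b c : ℂ, 0 < b.re → 0 < (c - b).re → ∀ y ∈ cutPlane,
      eulerIntegral a b c y = eulerBeta b (c - b) * hypF a b c y := by
  have hne : ∀ b c : ℂ, 0 < b.re → 0 < (c - b).re → eulerBeta b (c - b) ≠ 0 := by
    intro b c hb hd
    refine eulerBeta_ne_zero (ne_neg_nat_of_re_pos hb) (ne_neg_nat_of_re_pos hd)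
      (ne_neg_nat_of_re_pos ?_)
    simp at hd ⊢
    linarith
  have h := HypContinues.of_candidate (S := {p | 0 < p.2.1.re ∧ 0 < (p.2.2 - p.2.1).re})
    (f := fun p => (eulerBeta p.2.1 (p.2.2.1 - p.2.1))⁻¹
      * eulerIntegral p.1 p.2.1 p.2.2.1 p.2.2.2) ?_ ?_
  · refine ⟨h.1, fun a b c hb hd y hy => ?_⟩
    have h2 := h.2 (a, b, c) ⟨hb, hd⟩ y hy
    simp only at h2
    rw [h2, mul_inv_cancel_left₀ (hne b c hb hd)]
  · rintro ⟨a, b, c, y⟩ ⟨⟨hb, hd⟩, hy⟩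
    simp only at hb hd hy
    apply DifferentiableAt.differentiableWithinAt
    have hc : 0 < (b + (c - b)).re := by simp at hd ⊢; linarith
    refine DifferentiableAt.mul ?_ (differentiableAt_eulerIntegral ⟨hb, hd, hy⟩)
    refine DifferentiableAt.inv ?_ (hne b c hb hd)
    exact DifferentiableAt.eulerBeta (f := fun p : ℂ × ℂ × ℂ × ℂ => p.2.1)
      (g := fun p : ℂ × ℂ × ℂ × ℂ => p.2.2.1 - p.2.1) (by fun_prop) (by fun_prop)
      (ne_neg_nat_of_re_pos hb) (ne_neg_nat_of_re_pos hd) (ne_neg_nat_of_re_pos hc)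
  · rintro ⟨a, b, c⟩ ⟨hb, hd⟩ y hy
    simp only at hb hd ⊢
    rw [eulerIntegral_eq_of_norm_lt_one hb hd hy, inv_mul_cancel_left₀ (hne b c hb hd)]

theorem eulerIntegral_eq {a b c y : ℂ} (hb : 0 < b.re) (hd : 0 < (c - b).re) (hy : y ∈ cutPlane) :
    eulerIntegral a b c y = eulerBeta b (c - b) * hypF a b c y :=
  HypContinues.euler.2 a b c hb hd y hy

/-- Third parameter not a nonpositive integer, and lower bounds for the real parts. -/
def hypStrip (n m : ℕ) : Set (ℂ × ℂ × ℂ) :=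
  {p | -(n : ℝ) < p.2.1.re ∧ -(m : ℝ) < (p.2.2 - p.2.1).re ∧ ∀ k : ℕ, p.2.2 ≠ -k}

theorem HypContinues.shift {S T : Set (ℂ × ℂ × ℂ)} (hS : HypContinues S) (u v w : ℂ)
    (h : ∀ p ∈ T, (p.1 + u, p.2.1 + v, p.2.2 + w) ∈ S) :
    DifferentiableOn ℂ
      (fun p : ℂ × ℂ × ℂ × ℂ => hypF (p.1 + u) (p.2.1 + v) (p.2.2.1 + w) p.2.2.2)
      {p | (p.1, p.2.1, p.2.2.1) ∈ T ∧ p.2.2.2 ∈ cutPlane} :=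
  hS.2.comp (f := fun p : ℂ × ℂ × ℂ × ℂ => (p.1 + u, p.2.1 + v, p.2.2.1 + w, p.2.2.2))
    (by fun_prop) fun p hp => ⟨h (p.1, p.2.1, p.2.2.1) hp.1, hp.2⟩

theorem ne_neg_nat_add {c : ℂ} (hc : ∀ k : ℕ, c ≠ -k) (m k : ℕ) : c + m ≠ -k :=
  fun h => hc (m + k) (by push_cast; linear_combination h)

/-- Euler's integral settles the strip `(0,0)`, and each contiguous relation widens the strip by one
unit in one direction, its right-hand side being known on the narrower strip. The denominators `c (c
+ 1)` explain why `c` must avoid the nonpositive integers. -/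
theorem hypContinues_hypStrip (n m : ℕ) : HypContinues (hypStrip n m) := by
  have base : HypContinues (hypStrip 0 0) := by
    have h := HypContinues.euler.1
    have hs : hypStrip 0 0 ⊆ {p | 0 < p.2.1.re ∧ 0 < (p.2.2 - p.2.1).re} := by
      rintro p ⟨h1, h2, -⟩
      exact ⟨by simpa using h1, by simpa using h2⟩
    exact ⟨fun p hp => h.1 p (hs hp), h.2.mono fun p hp => ⟨hs hp.1, hp.2⟩⟩
  have stepc : ∀ n m, HypContinues (hypStrip n m) → HypContinues (hypStrip n (m + 1)) := by
    intro n m h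
    have hT1 : ∀ p ∈ hypStrip n (m + 1), (p.1 + 0, p.2.1 + 0, p.2.2 + 1) ∈ hypStrip n m := by
      rintro p ⟨h1, h2, h3⟩
      refine ⟨by simpa using h1, ?_, fun k => by simpa using ne_neg_nat_add h3 1 k⟩
      push_cast at h2; simp at h2 ⊢; linarith
    have hT2 : ∀ p ∈ hypStrip n (m + 1), (p.1 + 1, p.2.1 + 1, p.2.2 + 2) ∈ hypStrip n m := by
      rintro p ⟨h1, h2, h3⟩
      refine ⟨?_, ?_, fun k => by simpa using ne_neg_nat_add h3 2 k⟩
      · simp; linarith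
      · push_cast at h2; simp at h2 ⊢; linarith
    refine (HypContinues.of_candidate (f := fun p : ℂ × ℂ × ℂ × ℂ =>
      hypF (p.1 + 0) (p.2.1 + 0) (p.2.2.1 + 1) p.2.2.2 + p.1 * p.2.1 * p.2.2.2
        / (p.2.2.1 * (p.2.2.1 + 1)) * hypF (p.1 + 1) (p.2.1 + 1) (p.2.2.1 + 2) p.2.2.2) ?_ ?_).1
    · have hd : DifferentiableOn ℂ (fun p : ℂ × ℂ × ℂ × ℂ => p.1 * p.2.1 * p.2.2.2
          / (p.2.2.1 * (p.2.2.1 + 1)))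
          {p | (p.1, p.2.1, p.2.2.1) ∈ hypStrip n (m + 1) ∧ p.2.2.2 ∈ cutPlane} := by
        refine fun p hp => (DifferentiableAt.div_of_ne (by fun_prop) (by fun_prop)
          ?_).differentiableWithinAt
        exact mul_ne_zero (by simpa using hp.1.2.2 0) (by simpa using ne_neg_nat_add hp.1.2.2 1 0)
      exact (h.shift _ _ _ hT1).add (hd.mul (h.shift _ _ _ hT2))
    · intro p hp y hy
      have e1 := h.1 _ (hT1 p hp) y hy
      have e2 := h.1 _ (hT2 p hp) y hy
      simp only at e1 e2 ⊢
      rw [e1, e2, hyp_contiguous_c hp.2.2 hy]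
      simp
  have stepb : ∀ n m, HypContinues (hypStrip n m) → HypContinues (hypStrip (n + 1) m) := by
    intro n m h
    have hT1 : ∀ p ∈ hypStrip (n + 1) m, (p.1 + 0, p.2.1 + 1, p.2.2 + 1) ∈ hypStrip n m := by
      rintro p ⟨h1, h2, h3⟩
      refine ⟨?_, ?_, fun k => by simpa using ne_neg_nat_add h3 1 k⟩
      · push_cast at h1; simp; linarith
      · simpa using h2
    have hT2 : ∀ p ∈ hypStrip (n + 1) m, (p.1 + 1, p.2.1 + 1, p.2.2 + 2) ∈ hypStrip n m := by
      rintro p ⟨h1, h2, h3⟩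
      refine ⟨?_, ?_, fun k => by simpa using ne_neg_nat_add h3 2 k⟩
      · push_cast at h1; simp; linarith
      · simp at h2 ⊢; linarith
    refine (HypContinues.of_candidate (f := fun p : ℂ × ℂ × ℂ × ℂ =>
      hypF (p.1 + 0) (p.2.1 + 1) (p.2.2.1 + 1) p.2.2.2 - p.1 * (p.2.2.1 - p.2.1) * p.2.2.2
        / (p.2.2.1 * (p.2.2.1 + 1)) * hypF (p.1 + 1) (p.2.1 + 1) (p.2.2.1 + 2) p.2.2.2) ?_ ?_).1
    · have hd : DifferentiableOn ℂ (fun p : ℂ × ℂ × ℂ × ℂ => p.1 * (p.2.2.1 - p.2.1) * p.2.2.2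
          / (p.2.2.1 * (p.2.2.1 + 1)))
          {p | (p.1, p.2.1, p.2.2.1) ∈ hypStrip (n + 1) m ∧ p.2.2.2 ∈ cutPlane} := by
        refine fun p hp => (DifferentiableAt.div_of_ne (by fun_prop) (by fun_prop)
          ?_).differentiableWithinAt
        exact mul_ne_zero (by simpa using hp.1.2.2 0) (by simpa using ne_neg_nat_add hp.1.2.2 1 0)
      exact (h.shift _ _ _ hT1).sub (hd.mul (h.shift _ _ _ hT2))
    · intro p hp y hy
      have e1 := h.1 _ (hT1 p hp) y hy
      have e2 := h.1 _ (hT2 p hp) y hy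
      simp only at e1 e2 ⊢
      rw [e1, e2, hyp_contiguous_b hp.2.2 hy]
      simp
  have h1 : HypContinues (hypStrip 0 m) := by
    induction m with
    | zero => exact base
    | succ m ih => exact stepc 0 m ih
  induction n with
  | zero => exact h1
  | succ n ih => exact stepb n m ih

theorem exists_mem_hypStrip {a b c : ℂ} (hc : ∀ k : ℕ, c ≠ -k) :
    ∃ n m : ℕ, (a, b, c) ∈ hypStrip n m := by
  obtain ⟨n, hn⟩ := exists_nat_gt (-b.re)
  obtain ⟨m, hm⟩ := exists_nat_gt (-(c - b).re)
  exact ⟨n, m, by simp only [hypStrip, mem_ofPred_eq]; exact ⟨by linarith, by linarith, hc⟩⟩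

theorem differentiableAt_hypF {a b c y : ℂ} (hc : ∀ k : ℕ, c ≠ -k) (hy : y ∈ cutPlane) :
    DifferentiableAt ℂ (fun p : ℂ × ℂ × ℂ × ℂ => hypF p.1 p.2.1 p.2.2.1 p.2.2.2) (a, b, c, y) := by
  obtain ⟨n, m, h⟩ := exists_mem_hypStrip (a := a) (b := b) hc
  refine (hypContinues_hypStrip n m).2.differentiableAt ?_
  have hopen : IsOpen {s : ℂ | ∀ k : ℕ, s ≠ -k} := by
    have : {s : ℂ | ∀ k : ℕ, s ≠ -k} = {s : ℂ | ∀ n : ℤ, n ≤ 0 → s ≠ n} := by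
      ext s
      constructor
      · rintro hs n hn rfl
        obtain ⟨k, hk⟩ := Int.exists_eq_neg_ofNat hn
        exact hs k (by rw [hk]; simp)
      · rintro hs k rfl
        exact hs (-k) (by simp) (by simp)
    rw [this]
    have h2 : {s : ℂ | ∀ n : ℤ, n ≤ 0 → s ≠ n} = (((↑) : ℤ → ℂ) '' Iic 0)ᶜ := by
      ext s; simp [eq_comm]
    rw [h2]
    exact (Complex.isClosedEmbedding_intCast.isClosedMap _ isClosed_Iic).isOpen_compl
  have h1 : Continuous fun p : ℂ × ℂ × ℂ × ℂ => p.2.1.re := Complex.continuous_re.comp (by fun_prop)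
  have h2 : Continuous fun p : ℂ × ℂ × ℂ × ℂ => (p.2.2.1 - p.2.1).re :=
    Complex.continuous_re.comp (by fun_prop)
  have h3 : Continuous fun p : ℂ × ℂ × ℂ × ℂ => p.2.2.2 := by fun_prop
  have h4 : Continuous fun p : ℂ × ℂ × ℂ × ℂ => p.2.2.1 := by fun_prop
  exact (((isOpen_lt continuous_const h1).inter ((isOpen_lt continuous_const h2).inter
    (hopen.preimage h4))).inter (isOpen_cutPlane.preimage h3)).mem_nhds ⟨h, hy⟩

theorem hypF_symm (a b c : ℂ) {y : ℂ} : hypF a b c y = hypF b a c y := by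
  have : (fun x : ℂ => ordinaryHypergeometric a b c x) = ordinaryHypergeometric b a c := by
    funext x
    rw [ordinaryHypergeometric, ordinaryHypergeometric, ordinaryHypergeometricSeries_symm]
  rw [hypF, hypF, this]

end HypF

/-! ### The companion function and the second solution at the origin -/

section Companion

/-- The second solution at the origin of the hypergeometric equation, divided by `y ^ (1 - c)` and
normalised by its Euler integral. -/
def compH (a b c y : ℂ) : ℂ :=
  eulerBeta (1 + a - c) (1 - a) * hypF (1 + b - c) (1 + a - c) (2 - c) y

/-- On the path the integrand is a constant exponential times `t^(a-c) (1-t)^(-a) (1-yt)^(c-b-1)`,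
which is Euler's integrand for the parameters `(1+b-c, 1+a-c, 2-c)`. All dependence on the chosen
logarithms sits in the constant. -/
theorem calGIntegral_eq {a b c y lam : ℂ} (mu : ℂ) (hac : c.re < a.re + 1) (ha : a.re + 1 < 2)
    (hy : y ∈ cutPlane) (hlam : Complex.exp lam = y) :
    calGIntegral a b c y lam mu
      = Complex.exp ((1 - c) * lam + (c - b - a) * mu) * compH a b c y := by
  have hb' : 0 < (1 + a - c).re := by simp; linarith
  have hd' : 0 < (2 - c - (1 + a - c)).re := by simp; linarith
  have hE := eulerIntegral_eq (a := 1 + b - c) hb' hd' hy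
  rw [show 2 - c - (1 + a - c) = 1 - a by ring] at hE
  rw [compH, ← hE, eulerIntegral, ← integral_const_mul, calGIntegral,
    intervalIntegral.integral_of_le zero_le_one, integral_Ioc_eq_integral_Ioo]
  refine setIntegral_congr_fun measurableSet_Ioo fun t ht => ?_
  have hy0 : y ≠ 0 := by rw [← hlam]; exact Complex.exp_ne_zero _
  have h0 : (t : ℂ) ≠ 0 := by exact_mod_cast ht.1.ne'
  have h1t : (0 : ℝ) < 1 - t := by linarith [ht.2]
  have e1 : (1 : ℂ) - t = ((1 - t : ℝ) : ℂ) := by push_cast; ring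
  have h1 : (1 : ℂ) - t ≠ 0 := by rw [e1]; exact_mod_cast h1t.ne'
  have h2 := Complex.slitPlane_ne_zero (one_sub_mul_mem_slitPlane hy (Ioo_subset_Icc_self ht))
  -- The form `dx/(x(1-x))` pulls back to `y/(1-yt) dt`. Written as an exponential, it lets all
  -- branches be collected in a single exponent.
  have hrat : (-1 / (y * (t : ℂ) ^ 2)) / ((1 / (y * t)) * (1 - 1 / (y * t)))
      = Complex.exp (lam - Complex.log (1 - y * t)) := by
    rw [Complex.exp_sub, hlam, Complex.exp_log h2]
    have h3 : (1 : ℂ) / (y * t) * (1 - 1 / (y * t)) = - (1 - y * t) / (y * t) ^ 2 := by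
      field_simp; ring
    rw [h3]
    field_simp
  rw [mul_div_assoc, hrat, Complex.cpow_def_of_ne_zero h0, Complex.cpow_def_of_ne_zero h1,
    Complex.cpow_def_of_ne_zero h2, ← Complex.ofReal_log ht.1.le, e1,
    ← Complex.ofReal_log h1t.le, ← Complex.exp_add, ← Complex.exp_add, ← Complex.exp_add,
    ← Complex.exp_add]
  congr 1
  ring

theorem NotInt.ne_neg_nat {s : ℂ} (hs : NotInt s) (k : ℕ) : s ≠ -k := by
  have := hs (-k); simpa using this

theorem NotInt.int_add {s : ℂ} (hs : NotInt s) (m : ℤ) : NotInt (m + s) := fun n h =>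
  hs (n - m) (by push_cast; linear_combination h)

theorem NotInt.int_sub {s : ℂ} (hs : NotInt s) (m : ℤ) : NotInt (m - s) := fun n h =>
  hs (m - n) (by push_cast; linear_combination -h)

theorem differentiableAt_compH {p : ℂ × ℂ × ℂ} (hp : p ∈ genericParams) {y : ℂ}
    (hy : y ∈ cutPlane) :
    DifferentiableAt ℂ (fun p : ℂ × ℂ × ℂ => compH p.1 p.2.1 p.2.2 y) p := by
  obtain ⟨ha, hb, hc, hca, hcb⟩ := hp
  have h1 : ∀ k : ℕ, 1 + p.1 - p.2.2 ≠ -k := fun k h =>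
    hca.int_sub 1 |>.ne_neg_nat k (by rw [← h]; push_cast; ring)
  have h2 : ∀ k : ℕ, 1 - p.1 ≠ -k := fun k h =>
    ha.int_sub 1 |>.ne_neg_nat k (by rw [← h]; push_cast; ring)
  have h3 : ∀ k : ℕ, 2 - p.2.2 ≠ -k := fun k h =>
    hc.int_sub 2 |>.ne_neg_nat k (by rw [← h]; push_cast; ring)
  refine DifferentiableAt.mul (DifferentiableAt.eulerBeta (by fun_prop) (by fun_prop) h1 h2
    fun k h => h3 k (by rw [← h]; ring)) ?_
  exact DifferentiableAt.comp p (differentiableAt_hypF (a := 1 + p.2.1 - p.2.2)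
    (b := 1 + p.1 - p.2.2) h3 hy)
    (f := fun p : ℂ × ℂ × ℂ => (1 + p.2.1 - p.2.2, 1 + p.1 - p.2.2, 2 - p.2.2, y)) (by fun_prop)

/-- Shifting generic parameters by integers gives generic parameters. -/
theorem mem_genericParams_shift {a b c : ℂ} (h : (a, b, c) ∈ genericParams) (l m n : ℤ) :
    (l + a, m + b, n + c) ∈ genericParams := by
  obtain ⟨ha, hb, hc, hca, hcb⟩ := h
  refine ⟨ha.int_add l, hb.int_add m, hc.int_add n, ?_, ?_⟩
  · have := hca.int_add (n - l)
    convert this using 1; push_cast; ring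
  · have := hcb.int_add (n - m)
    convert this using 1; push_cast; ring

/-- Along a direction on which none of the five linear forms vanishes, each integer value of each
form is taken at most once. Hence only countably many small displacements of a point fail to be
generic. -/
theorem exists_generic_mem_of_isOpen {U : Set (ℂ × ℂ × ℂ)} (hU : IsOpen U) (hne : U.Nonempty) :
    (genericParams ∩ U).Nonempty := by
  obtain ⟨p, hp⟩ := hne
  -- The forms `a, b, c, c - a, c - b` take the values `i, 3i, 2i, i, -i` here, all nonzero and
  -- nonreal.
  let q : ℂ × ℂ × ℂ := (Complex.I, 3 * Complex.I, 2 * Complex.I)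
  have hq : q ∈ genericParams := by
    have key (x : ℝ) (hx : x ≠ 0) : NotInt (x * Complex.I) := fun n h => by
      have := congrArg Complex.im h
      simp at this
      exact hx this
    refine ⟨?_, ?_, ?_, ?_, ?_⟩
    · simpa [q] using key 1 one_ne_zero
    · simpa [q] using key 3 three_ne_zero
    · simpa [q] using key 2 two_ne_zero
    · have := key 1 one_ne_zero
      convert this using 1; simp [q]; ring
    · have := key (-1) (by norm_num)
      convert this using 1; simp [q]; ring
  obtain ⟨ε, hε, hsub⟩ := Metric.isOpen_iff.1
    (hU.preimage (f := fun t : ℝ => p + (t : ℂ) • q) (by fun_prop)) 0 (by simpa using hp)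
  have hcnt : {t : ℝ | p + (t : ℂ) • q ∉ genericParams}.Countable := by
    rw [genericParams_eq]
    have : {t : ℝ | p + (t : ℂ) • q ∉ {p | ∀ i, NotInt (genericForms i p)}} ⊆
        ⋃ (x : Fin 5 × ℤ), {t : ℝ | genericForms x.1 (p + (t : ℂ) • q) = x.2} := by
      intro t ht
      simp only [mem_ofPred_eq, not_forall, NotInt, not_not, ne_eq] at ht
      obtain ⟨i, n, h⟩ := ht
      exact mem_iUnion.2 ⟨(i, n), h⟩
    refine (countable_iUnion fun x => ?_).mono this
    apply Set.Subsingleton.countable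
    intro s hs t ht
    simp only [mem_ofPred_eq, map_add, map_smul, smul_eq_mul] at hs ht
    have h1 : ((s : ℂ) - t) * genericForms x.1 q = 0 := by linear_combination hs - ht
    rcases mul_eq_zero.1 h1 with h | h
    · exact_mod_cast sub_eq_zero.1 h
    · have hq' := hq
      rw [genericParams_eq] at hq'
      exact absurd h (by simpa using hq' x.1 0)
  have hnc : ¬ (Ioo (0 : ℝ) ε).Countable := by
    intro h
    have := Cardinal.mk_Ioo_real hε
    have h2 := Cardinal.le_aleph0_iff_set_countable.2 h
    rw [this] at h2
    exact absurd h2 (not_le.2 Cardinal.aleph0_lt_continuum)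
  have : ∃ t ∈ Ioo (0 : ℝ) ε, t ∉ {t : ℝ | p + (t : ℂ) • q ∉ genericParams} := by
    by_contra hcon
    push Not at hcon
    exact hnc (hcnt.mono hcon)
  obtain ⟨t, ht, htg⟩ := this
  refine ⟨_, not_not.1 htg, hsub ?_⟩
  simp [abs_of_pos ht.1, ht.2]

theorem isOpen_setOf_re_lt {E : Type*} [TopologicalSpace E] {f g : E → ℂ} (hf : Continuous f)
    (hg : Continuous g) : IsOpen {x | (f x).re < (g x).re} :=
  isOpen_lt (Complex.continuous_re.comp hf) (Complex.continuous_re.comp hg)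

theorem calG_eq {a b c y lam : ℂ} (mu : ℂ) (h : (a, b, c) ∈ genericParams) (hy : y ∈ cutPlane)
    (hlam : Complex.exp lam = y) :
    calG a b c y lam mu = Complex.exp ((1 - c) * lam + (c - b - a) * mu) * compH a b c y := by
  have hU : IsOpen {p : ℂ × ℂ × ℂ | p.2.2.re < p.1.re + 1 ∧ p.1.re + 1 < 2} := by
    have h1 := isOpen_setOf_re_lt (f := fun p : ℂ × ℂ × ℂ => p.2.2) (g := fun p => p.1 + 1)
      (by fun_prop) (by fun_prop)
    have h2 := isOpen_setOf_re_lt (f := fun p : ℂ × ℂ × ℂ => p.1 + 1) (g := fun p => 2)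
      (by fun_prop) (by fun_prop)
    simp at h1 h2
    exact h1.inter h2
  refine holoCont_eq_of_lineGeneric isOpen_genericParams lineGeneric_genericParams hU
    (exists_generic_mem_of_isOpen hU ⟨0, by simp⟩)
    (f := fun p : ℂ × ℂ × ℂ => Complex.exp ((1 - p.2.2) * lam + (p.2.2 - p.2.1 - p.1) * mu)
      * compH p.1 p.2.1 p.2.2 y) ?_ ?_ h
  · intro p hp
    exact (DifferentiableAt.mul (by fun_prop) (differentiableAt_compH hp hy)).differentiableWithinAt
  · intro p hp
    exact (calGIntegral_eq mu hp.2.1 hp.2.2 hy hlam).symm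

end Companion

/-! ### Cauchy's theorem in strips and the correlation of two functions -/

section Strip

theorem mem_uIcc_reProdIm {x₁ x₂ y₁ y₂ : ℝ} {z : ℂ} (hy : y₁ ≤ y₂)
    (hz : z ∈ uIcc x₁ x₂ ×ℂ uIcc y₁ y₂) : y₁ ≤ z.im ∧ z.im ≤ y₂ := by
  have := hz.2
  rw [uIcc_of_le hy] at this
  exact this

/-- Cauchy's theorem for a horizontal strip. -/
theorem integral_horizontal_eq {h : ℂ → ℂ} {m : ℝ → ℝ} {θ₁ θ₂ : ℝ} (hθ : θ₁ ≤ θ₂)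
    (hd : ∀ z : ℂ, θ₁ ≤ z.im → z.im ≤ θ₂ → DifferentiableAt ℂ h z)
    (hm : Integrable m) (htop : Tendsto m atTop (𝓝 0)) (hbot : Tendsto m atBot (𝓝 0))
    (hb : ∀ ρ θ : ℝ, θ₁ ≤ θ → θ ≤ θ₂ → ‖h (ρ + θ * Complex.I)‖ ≤ m ρ) :
    ∫ ρ : ℝ, h (ρ + θ₁ * Complex.I) = ∫ ρ : ℝ, h (ρ + θ₂ * Complex.I) := by
  have hline (θ : ℝ) (h1 : θ₁ ≤ θ) (h2 : θ ≤ θ₂) :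
      Integrable fun ρ : ℝ => h (ρ + θ * Complex.I) := by
    refine hm.mono' (Continuous.aestronglyMeasurable ?_) (ae_of_all _ fun ρ => hb ρ θ h1 h2)
    rw [continuous_iff_continuousAt]
    intro ρ
    exact (hd (ρ + θ * Complex.I) (by simpa using h1) (by simpa using h2)).continuousAt.comp
      (f := fun ρ : ℝ => (ρ : ℂ) + θ * Complex.I) (by fun_prop)
  have hlim (θ : ℝ) (h1 : θ₁ ≤ θ) (h2 : θ ≤ θ₂) :
      Tendsto (fun T : ℝ => ∫ ρ in (-T)..T, h (ρ + θ * Complex.I)) atTop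
        (𝓝 (∫ ρ : ℝ, h (ρ + θ * Complex.I))) :=
    intervalIntegral_tendsto_integral (hline θ h1 h2) tendsto_neg_atTop_atBot tendsto_id
  have hvert (s : ℝ → ℝ) (hs : Tendsto (fun T => m (s T)) atTop (𝓝 0)) :
      Tendsto (fun T : ℝ => Complex.I • ∫ θ in θ₁..θ₂, h (s T + θ * Complex.I)) atTop (𝓝 0) := by
    refine squeeze_zero_norm (fun T => ?_) (by simpa using hs.mul_const |θ₂ - θ₁|)
    rw [norm_smul, Complex.norm_I, one_mul]
    refine intervalIntegral.norm_integral_le_of_norm_le_const fun θ hθ' => ?_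
    rw [uIoc_of_le hθ] at hθ'
    exact hb _ _ hθ'.1.le hθ'.2
  have hrect (T : ℝ) := Complex.integral_boundary_rect_eq_zero_of_differentiableOn h
    ((-T : ℝ) + θ₁ * Complex.I) (T + θ₂ * Complex.I) (fun z hz => by
      have := mem_uIcc_reProdIm (by simpa using hθ) hz
      exact (hd z (by simpa using this.1) (by simpa using this.2)).differentiableWithinAt)
  have hL := (((hlim θ₁ le_rfl hθ).sub (hlim θ₂ hθ le_rfl)).add (hvert (fun T => T) htop)).sub
    (hvert (fun T => -T) (hbot.comp tendsto_neg_atTop_atBot))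
  have h0 : (fun T : ℝ => (∫ ρ in (-T)..T, h (ρ + θ₁ * Complex.I))
      - (∫ ρ in (-T)..T, h (ρ + θ₂ * Complex.I))
      + Complex.I • (∫ θ in θ₁..θ₂, h (T + θ * Complex.I))
      - Complex.I • ∫ θ in θ₁..θ₂, h ((-T : ℝ) + θ * Complex.I)) = fun _ => 0 := by
    funext T
    simpa using hrect T
  rw [h0] at hL
  have := tendsto_nhds_unique hL tendsto_const_nhds
  simpa [sub_eq_zero] using this

/-- Cauchy's theorem for a horizontal half strip. -/
theorem integral_half_strip {N : ℂ → ℂ} {K lam : ℝ} (hlam : 0 < lam) {η₁ η₂ : ℝ} (hη : η₁ ≤ η₂)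
    (hd : ∀ z : ℂ, η₁ ≤ z.im → z.im ≤ η₂ → DifferentiableAt ℂ N z)
    (hb : ∀ τ η : ℝ, η₁ ≤ η → η ≤ η₂ → ‖N (τ + η * Complex.I)‖ ≤ K * Real.exp (-lam * τ)) :
    (∫ τ in Ioi (0 : ℝ), N (τ + η₁ * Complex.I)) - ∫ τ in Ioi (0 : ℝ), N (τ + η₂ * Complex.I)
      = Complex.I * ∫ η in η₁..η₂, N (η * Complex.I) := by
  have hexp : IntegrableOn (fun τ : ℝ => K * Real.exp (-lam * τ)) (Ioi 0) :=
    (integrableOn_exp_mul_Ioi (by linarith) 0).const_mul K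
  have hlim (η : ℝ) (h1 : η₁ ≤ η) (h2 : η ≤ η₂) :
      Tendsto (fun T : ℝ => ∫ τ in (0 : ℝ)..T, N (τ + η * Complex.I)) atTop
        (𝓝 (∫ τ in Ioi (0 : ℝ), N (τ + η * Complex.I))) := by
    refine intervalIntegral_tendsto_integral_Ioi 0 ?_ tendsto_id
    refine Integrable.mono' hexp (Continuous.aestronglyMeasurable ?_)
      (ae_of_all _ fun τ => hb τ η h1 h2)
    rw [continuous_iff_continuousAt]
    intro ρ
    exact (hd (ρ + η * Complex.I) (by simpa using h1) (by simpa using h2)).continuousAt.comp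
      (f := fun ρ : ℝ => (ρ : ℂ) + η * Complex.I) (by fun_prop)
  have hK : Tendsto (fun T : ℝ => K * Real.exp (-lam * T)) atTop (𝓝 0) := by
    have : Tendsto (fun T : ℝ => -lam * T) atTop atBot :=
      tendsto_id.const_mul_atTop_of_neg (by linarith)
    simpa using (Real.tendsto_exp_atBot.comp this).const_mul K
  have hvert : Tendsto (fun T : ℝ => Complex.I • ∫ η in η₁..η₂, N (T + η * Complex.I)) atTop
      (𝓝 0) := by
    refine squeeze_zero_norm (fun T => ?_) (by simpa using hK.mul_const |η₂ - η₁|)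
    rw [norm_smul, Complex.norm_I, one_mul]
    refine intervalIntegral.norm_integral_le_of_norm_le_const fun η hη' => ?_
    rw [uIoc_of_le hη] at hη'
    simpa using hb T η hη'.1.le hη'.2
  have hrect (T : ℝ) := Complex.integral_boundary_rect_eq_zero_of_differentiableOn N
    ((0 : ℝ) + η₁ * Complex.I) (T + η₂ * Complex.I) (fun z hz => by
      have := mem_uIcc_reProdIm (by simpa using hη) hz
      exact (hd z (by simpa using this.1) (by simpa using this.2)).differentiableWithinAt)
  have hL := (((hlim η₁ le_rfl hη).sub (hlim η₂ hη le_rfl)).add hvert)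
  have h0 : (fun T : ℝ => (∫ τ in (0 : ℝ)..T, N (τ + η₁ * Complex.I))
      - (∫ τ in (0 : ℝ)..T, N (τ + η₂ * Complex.I))
      + Complex.I • (∫ η in η₁..η₂, N (T + η * Complex.I)))
      = fun _ => Complex.I * ∫ η in η₁..η₂, N (η * Complex.I) := by
    funext T
    have := hrect T
    simp at this
    simp only [smul_eq_mul]
    linear_combination this
  rw [h0] at hL
  have := tendsto_nhds_unique hL tendsto_const_nhds
  simpa using this

variable {f g : ℂ → ℂ} {α β lam K : ℝ} {m : ℝ → ℝ}

/-- The correlation of `f` on a line and `g` on the opposite line, as a function of a complex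
shift. -/
def correlation (f g : ℂ → ℂ) (δ : ℂ) : ℂ :=
  ∫ ρ : ℝ, f (ρ + (δ.im / 2 : ℝ) * Complex.I) * g (ρ + (δ.im / 2 : ℝ) * Complex.I - δ)

/-- Holomorphy and growth of a pair of functions on opposite strips. -/
structure StripPair (f g : ℂ → ℂ) (α β lam K : ℝ) (m : ℝ → ℝ) : Prop where
  diff_f : ∀ z : ℂ, α < z.im → z.im < β → DifferentiableAt ℂ f z
  diff_g : ∀ z : ℂ, -β < z.im → z.im < -α → DifferentiableAt ℂ g z
  pos : 0 < lam
  integrable : Integrable m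
  top : Tendsto m atTop (𝓝 0)
  bot : Tendsto m atBot (𝓝 0)
  bound_f : ∀ ρ θ : ℝ, α < θ → θ < β → ‖f (ρ + θ * Complex.I)‖ ≤ m ρ * Real.exp (-lam * ρ)
  bound_g : ∀ ρ θ : ℝ, -β < θ → θ < -α → ‖g (ρ + θ * Complex.I)‖ ≤ K * Real.exp (lam * ρ)

theorem StripPair.norm_mul_le (H : StripPair f g α β lam K m) {θ : ℝ} {δ : ℂ} (h1 : α < θ)
    (h2 : θ < β) (h3 : -β < θ - δ.im) (h4 : θ - δ.im < -α) (ρ : ℝ) :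
    ‖f (ρ + θ * Complex.I) * g (ρ + θ * Complex.I - δ)‖ ≤ m ρ * (K * Real.exp (-lam * δ.re)) := by
  have hf := H.bound_f ρ θ h1 h2
  have hg := H.bound_g (ρ - δ.re) (θ - δ.im) h3 h4
  have e : ((ρ - δ.re : ℝ) : ℂ) + ((θ - δ.im : ℝ) : ℂ) * Complex.I = ρ + θ * Complex.I - δ := by
    apply Complex.ext <;> simp
  rw [e] at hg
  rw [norm_mul]
  refine (mul_le_mul hf hg (norm_nonneg _) ((norm_nonneg _).trans hf)).trans_eq ?_
  rw [show lam * (ρ - δ.re) = lam * ρ + -lam * δ.re by ring, Real.exp_add, neg_mul, Real.exp_neg]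
  have := (Real.exp_pos (lam * ρ)).ne'
  field_simp

/-- The definition uses a line that moves with `δ`. By Cauchy's theorem any line on which both
arguments stay in their strips gives the same value, so near a given shift one fixed line can be
used. -/
theorem StripPair.correlation_eq (H : StripPair f g α β lam K m) {θ : ℝ} {δ : ℂ} (h1 : α < θ)
    (h2 : θ < β) (h3 : -β < θ - δ.im) (h4 : θ - δ.im < -α) :
    correlation f g δ = ∫ ρ : ℝ, f (ρ + θ * Complex.I) * g (ρ + θ * Complex.I - δ) := by
  have key : ∀ θ₁ θ₂ : ℝ, θ₁ ≤ θ₂ → α < θ₁ → θ₂ < β → -β < θ₁ - δ.im → θ₂ - δ.im < -α →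
      ∫ ρ : ℝ, f (ρ + θ₁ * Complex.I) * g (ρ + θ₁ * Complex.I - δ)
        = ∫ ρ : ℝ, f (ρ + θ₂ * Complex.I) * g (ρ + θ₂ * Complex.I - δ) := by
    intro θ₁ θ₂ h12 k1 k2 k3 k4
    refine integral_horizontal_eq (h := fun u => f u * g (u - δ))
      (m := fun ρ => m ρ * (K * Real.exp (-lam * δ.re))) h12 (fun z hz1 hz2 => ?_)
      (H.integrable.mul_const _) (by simpa using H.top.mul_const (K * Real.exp (-lam * δ.re)))
      (by simpa using H.bot.mul_const (K * Real.exp (-lam * δ.re))) fun ρ θ hθ1 hθ2 => ?_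
    · refine (H.diff_f z (by linarith) (by linarith)).mul ?_
      exact DifferentiableAt.comp z (g := g) (f := fun u => u - δ)
        (H.diff_g (z - δ) (by simp; linarith) (by simp; linarith)) (by fun_prop)
    · exact H.norm_mul_le (by linarith) (by linarith) (by linarith) (by linarith) ρ
  rw [correlation]
  rcases le_total (δ.im / 2) θ with h | h
  · exact key _ _ h (by linarith) h2 (by linarith) h4
  · exact (key _ _ h h1 (by linarith) h3 (by linarith)).symm

theorem StripPair.norm_correlation_le (H : StripPair f g α β lam K m) {δ : ℂ}
    (h5 : 2 * α < δ.im) (h6 : δ.im < 2 * β) :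
    ‖correlation f g δ‖ ≤ (∫ ρ, m ρ) * K * Real.exp (-lam * δ.re) := by
  rw [mul_assoc, ← integral_mul_const]
  refine norm_integral_le_of_norm_le (H.integrable.mul_const _) (ae_of_all _ fun ρ => ?_)
  exact H.norm_mul_le (by linarith) (by linarith) (by linarith) (by linarith) ρ

theorem StripPair.continuous_mul (H : StripPair f g α β lam K m) {θ : ℝ} {δ : ℂ} (h1 : α < θ)
    (h2 : θ < β) (h3 : -β < θ - δ.im) (h4 : θ - δ.im < -α) :
    Continuous fun ρ : ℝ => f (ρ + θ * Complex.I) * g (ρ + θ * Complex.I - δ) := by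
  rw [continuous_iff_continuousAt]
  intro ρ
  refine ContinuousAt.mul ?_ ?_
  · exact (H.diff_f (ρ + θ * Complex.I) (by simpa using h1) (by simpa using h2)).continuousAt.comp
      (f := fun ρ : ℝ => (ρ : ℂ) + θ * Complex.I) (by fun_prop)
  · exact (H.diff_g (ρ + θ * Complex.I - δ) (by simpa using h3)
      (by simpa using h4)).continuousAt.comp
      (f := fun ρ : ℝ => (ρ : ℂ) + θ * Complex.I - δ) (by fun_prop)

/-- With the line frozen at height `Im δ₀ / 2`, the shift enters only through the holomorphic
function `g`, and the integral is a dominated parameter integral. -/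
theorem StripPair.differentiableAt_correlation (H : StripPair f g α β lam K m) {δ₀ : ℂ}
    (h5 : 2 * α < δ₀.im) (h6 : δ₀.im < 2 * β) : DifferentiableAt ℂ (correlation f g) δ₀ := by
  set θ := δ₀.im / 2 with hθ
  have hopen : IsOpen {δ : ℂ | -β < θ - δ.im ∧ θ - δ.im < -α ∧ 2 * α < δ.im ∧ δ.im < 2 * β} := by
    have hc : Continuous fun δ : ℂ => δ.im := Complex.continuous_im
    exact (isOpen_lt continuous_const (continuous_const.sub hc)).inter
      ((isOpen_lt (continuous_const.sub hc) continuous_const).inter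
      ((isOpen_lt continuous_const hc).inter (isOpen_lt hc continuous_const)))
  have hmem : δ₀ ∈ {δ : ℂ | -β < θ - δ.im ∧ θ - δ.im < -α ∧ 2 * α < δ.im ∧ δ.im < 2 * β} :=
    ⟨by linarith, by linarith, h5, h6⟩
  obtain ⟨r, hr, hsub⟩ := Metric.isOpen_iff.1 hopen _ hmem
  have hα : α < θ := by linarith
  have hβ : θ < β := by linarith
  have hK : 0 ≤ K := by
    have := (norm_nonneg _).trans (H.bound_g 0 (-θ) (by linarith) (by linarith))
    exact nonneg_of_mul_nonneg_left this (Real.exp_pos _)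
  have hm : ∀ ρ, 0 ≤ m ρ := fun ρ => by
    have := (norm_nonneg _).trans (H.bound_f ρ θ hα hβ)
    exact nonneg_of_mul_nonneg_left this (Real.exp_pos _)
  have hd : DifferentiableAt ℂ
      (fun δ => ∫ ρ : ℝ, f (ρ + θ * Complex.I) * g (ρ + θ * Complex.I - δ)) δ₀ := by
    refine differentiableAt_integral_of_dominated hr
      (bound := fun ρ => m ρ * (K * Real.exp (-lam * (δ₀.re - r)))) (fun δ hδ => ?_)
      (ae_of_all _ fun ρ δ hδ => ?_) (ae_of_all _ fun ρ δ hδ => ?_) (H.integrable.mul_const _)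
    · obtain ⟨k1, k2, -, -⟩ := hsub hδ
      exact (H.continuous_mul hα hβ k1 k2).aestronglyMeasurable
    · obtain ⟨k1, k2, -, -⟩ := hsub hδ
      refine DifferentiableAt.differentiableWithinAt ?_
      refine DifferentiableAt.const_mul ?_ _
      exact DifferentiableAt.comp δ (g := g) (f := fun δ => (ρ : ℂ) + θ * Complex.I - δ)
        (H.diff_g _ (by simpa using k1) (by simpa using k2)) (by fun_prop)
    · obtain ⟨k1, k2, -, -⟩ := hsub hδ
      refine (H.norm_mul_le hα hβ k1 k2 ρ).trans ?_
      have : |δ.re - δ₀.re| < r := by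
        refine (Complex.abs_re_le_norm (δ - δ₀)).trans_lt ?_
        simpa [dist_eq_norm] using hδ
      have h7 := (abs_lt.1 this).1
      have h8 := H.pos
      have : -lam * δ.re ≤ -lam * (δ₀.re - r) := by nlinarith
      have := hm ρ
      gcongr
  refine hd.congr_of_eventuallyEq ?_
  filter_upwards [Metric.ball_mem_nhds δ₀ hr] with δ hδ
  obtain ⟨k1, k2, -, -⟩ := hsub hδ
  exact H.correlation_eq hα hβ k1 k2

/-- The iterated integral of `f` against the primitive of `g` on opposite lines. -/
def stripPairing (f g : ℂ → ℂ) (θ : ℝ) : ℂ :=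
  ∫ ρ : ℝ, f (ρ + θ * Complex.I) * ∫ σ in Iio ρ, g (σ - θ * Complex.I)

/-- Fubini: integrating `g(ρ - τ - iθ)` over all shifts `τ > 0` gives the primitive of `g` from `-∞`
to `ρ`. The decay of the correlation in `τ` has rate `lam`. -/
theorem StripPair.integral_correlation (H : StripPair f g α β lam K m) {θ : ℝ} (h1 : α < θ)
    (h2 : θ < β) :
    ∫ τ in Ioi (0 : ℝ), correlation f g (τ + (2 * θ : ℝ) * Complex.I) = stripPairing f g θ := by
  have him (τ : ℝ) : ((τ : ℂ) + (2 * θ : ℝ) * Complex.I).im = 2 * θ := by simp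
  have hre (τ : ℝ) : ((τ : ℂ) + (2 * θ : ℝ) * Complex.I).re = τ := by simp
  have e1 (τ : ℝ) : correlation f g (τ + (2 * θ : ℝ) * Complex.I)
      = ∫ ρ : ℝ, f (ρ + θ * Complex.I) * g ((ρ - τ : ℝ) - θ * Complex.I) := by
    rw [correlation, him]
    congr 1
    funext ρ
    congr 2
    · push_cast; ring
    · push_cast; ring
  simp_rw [e1]
  have hcont : Continuous fun x : ℝ × ℝ =>
      f (x.2 + θ * Complex.I) * g ((x.2 - x.1 : ℝ) - θ * Complex.I) := by
    rw [continuous_iff_continuousAt]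
    intro x
    refine ContinuousAt.mul ?_ ?_
    · exact (H.diff_f (x.2 + θ * Complex.I) (by simpa using h1)
        (by simpa using h2)).continuousAt.comp
        (f := fun x : ℝ × ℝ => (x.2 : ℂ) + θ * Complex.I) (by fun_prop)
    · exact (H.diff_g ((x.2 - x.1 : ℝ) - θ * Complex.I) (by simp; linarith)
        (by simp; linarith)).continuousAt.comp
        (f := fun x : ℝ × ℝ => ((x.2 - x.1 : ℝ) : ℂ) - θ * Complex.I) (by fun_prop)
  have hint : Integrable (fun x : ℝ × ℝ =>
      f (x.2 + θ * Complex.I) * g ((x.2 - x.1 : ℝ) - θ * Complex.I))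
      ((volume.restrict (Ioi (0 : ℝ))).prod volume) := by
    have hexp : Integrable (fun τ : ℝ => Real.exp (-lam * τ)) (volume.restrict (Ioi 0)) :=
      integrableOn_exp_mul_Ioi (by have := H.pos; linarith) 0
    refine ((hexp.const_mul K).mul_prod H.integrable).mono' hcont.aestronglyMeasurable
      (ae_of_all _ fun x => ?_)
    have := H.norm_mul_le (δ := x.1 + (2 * θ : ℝ) * Complex.I) h1 h2 (by rw [him]; linarith)
      (by rw [him]; linarith) x.2
    rw [hre] at this
    convert this using 1
    · congr 3
      push_cast; ring
    · ring
  rw [stripPairing, integral_integral_swap hint]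
  congr 1
  funext ρ
  rw [integral_const_mul]
  congr 1
  rw [← integral_indicator measurableSet_Ioi, ← integral_indicator measurableSet_Iio,
    ← integral_sub_left_eq_self _ volume ρ]
  congr 1
  funext τ
  by_cases hτ : τ < ρ
  · rw [indicator_of_mem (mem_Ioi.2 (sub_pos.2 hτ)), indicator_of_mem (mem_Iio.2 hτ),
      sub_sub_cancel]
  · rw [indicator_of_notMem (by simpa using hτ), indicator_of_notMem (by simpa using hτ)]

/-- The radial integral at angle `θ` is the correlation at the purely imaginary shift `2iθ`. The
integral of a holomorphic function up the short side of a half strip is the difference of its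
integrals over the two long sides, and these are the pairings. The factor `1/2` comes from the
substitution `η = 2θ`. -/
theorem StripPair.integral_eq (H : StripPair f g α β lam K m) {θ₁ θ₂ : ℝ} (h1 : α < θ₁)
    (h12 : θ₁ ≤ θ₂) (h2 : θ₂ < β) :
    ∫ θ in θ₁..θ₂, (∫ ρ : ℝ, f (ρ + θ * Complex.I) * g (ρ - θ * Complex.I))
      = Complex.I / 2 * (stripPairing f g θ₂ - stripPairing f g θ₁) := by
  have h := integral_half_strip (N := correlation f g) (K := (∫ ρ, m ρ) * K) H.pos
    (η₁ := 2 * θ₁) (η₂ := 2 * θ₂) (by linarith)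
    (fun z hz1 hz2 => H.differentiableAt_correlation (by linarith) (by linarith))
    (fun τ η h3 h4 => by
      have := H.norm_correlation_le (δ := τ + η * Complex.I) (by simp; linarith)
        (by simp; linarith)
      simpa using this)
  rw [H.integral_correlation h1 (by linarith), H.integral_correlation (by linarith) h2] at h
  have h3 := intervalIntegral.smul_integral_comp_mul_left (a := θ₁) (b := θ₂)
    (f := fun η : ℝ => correlation f g (η * Complex.I)) (c := 2)
  rw [← h3, Complex.real_smul] at h
  have e (θ : ℝ) : correlation f g ((2 * θ : ℝ) * Complex.I)
      = ∫ ρ : ℝ, f (ρ + θ * Complex.I) * g (ρ - θ * Complex.I) := by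
    rw [correlation]
    congr 1
    funext ρ
    congr 2
    · simp
    · simp; ring
  simp_rw [e] at h
  have hI := Complex.I_mul_I
  push_cast at h
  linear_combination (Complex.I / 2) * h + (∫ θ in θ₁..θ₂,
    (∫ ρ : ℝ, f (ρ + θ * Complex.I) * g (ρ - θ * Complex.I))) * hI

end Strip

/-! ### Majorants on horizontal lines -/

section Majorants

theorem integrable_exp_neg_mul_abs {κ : ℝ} (hκ : 0 < κ) :
    Integrable fun ρ : ℝ => Real.exp (-κ * |ρ|) := by
  rw [← integrableOn_univ, ← Iic_union_Ioi (a := (0 : ℝ))]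
  refine IntegrableOn.union ?_ ?_
  · refine (integrableOn_exp_mul_Iic hκ 0).congr_fun (fun ρ hρ => ?_) measurableSet_Iic
    simp only [abs_of_nonpos (mem_Iic.1 hρ)]
    ring_nf
  · refine (integrableOn_exp_mul_Ioi (a := -κ) (by linarith) 0).congr_fun (fun ρ hρ => ?_)
      measurableSet_Ioi
    simp only [abs_of_pos (mem_Ioi.1 hρ)]

theorem tendsto_exp_neg_mul_abs {κ : ℝ} (hκ : 0 < κ) :
    Tendsto (fun ρ : ℝ => Real.exp (-κ * |ρ|)) atTop (𝓝 0) ∧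
    Tendsto (fun ρ : ℝ => Real.exp (-κ * |ρ|)) atBot (𝓝 0) := by
  have h : Tendsto (fun ρ : ℝ => Real.exp (-κ * ρ)) atTop (𝓝 0) :=
    Real.tendsto_exp_atBot.comp (tendsto_id.const_mul_atTop_of_neg (by linarith))
  exact ⟨h.comp tendsto_abs_atTop_atTop, h.comp tendsto_abs_atBot_atTop⟩

/-- The majorant `e^{bρ} (1 + e^ρ)^x` without singularities. -/
def smoothMaj (b x ρ : ℝ) : ℝ := Real.exp (b * ρ) * (1 + Real.exp ρ) ^ x

/-- The majorant with a power singularity of order `q` at the origin. -/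
def singMaj (b q s ρ : ℝ) : ℝ :=
  Real.exp (b * ρ) * (|1 - Real.exp ρ| ^ q + (1 + Real.exp ρ) ^ q) * (1 + Real.exp ρ) ^ s

theorem smoothMaj_nonneg (b x ρ : ℝ) : 0 ≤ smoothMaj b x ρ := by
  unfold smoothMaj; positivity

theorem singMaj_nonneg (b q s ρ : ℝ) : 0 ≤ singMaj b q s ρ := by
  unfold singMaj; positivity

theorem continuous_smoothMaj (b x : ℝ) : Continuous (smoothMaj b x) := by
  unfold smoothMaj
  refine (by fun_prop : Continuous fun ρ => Real.exp (b * ρ)).mul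
    (Continuous.rpow_const (by fun_prop) fun ρ => Or.inl ?_)
  positivity

theorem measurable_singMaj (b q s : ℝ) : Measurable (singMaj b q s) := by
  unfold singMaj
  fun_prop

theorem rpow_le_of_mem {z R k₁ k₂ : ℝ} (hk₁ : 0 < k₁) (hR : 0 < R) (h1 : k₁ * R ≤ z)
    (h2 : z ≤ k₂ * R) (x : ℝ) : z ^ x ≤ (k₁ ^ x + k₂ ^ x) * R ^ x := by
  have hz : 0 < z := (mul_pos hk₁ hR).trans_le h1
  have hk₂ : 0 < k₂ := by
    by_contra h
    push Not at h
    nlinarith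
  rw [add_mul, ← Real.mul_rpow hk₁.le hR.le, ← Real.mul_rpow hk₂.le hR.le]
  rcases le_total 0 x with hx | hx
  · have := Real.rpow_le_rpow hz.le h2 hx
    have : 0 ≤ (k₁ * R) ^ x := by positivity
    linarith
  · have := Real.rpow_le_rpow_of_nonpos (mul_pos hk₁ hR) h1 hx
    have : 0 ≤ (k₂ * R) ^ x := by positivity
    linarith

/-- `1 + e^ρ` is comparable to `1` for `ρ ≤ 0` and to `e^ρ` for `ρ ≥ 0`, so the two exponential
rates are `b` at `-∞` and `b + x` at `+∞`. -/
theorem smoothMaj_le (b x : ℝ) (ρ : ℝ) :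
    smoothMaj b x ρ ≤ (1 + 2 ^ x) * Real.exp (-(min b (-(b + x))) * |ρ|) := by
  have hc : (0 : ℝ) ≤ 1 + 2 ^ x := by positivity
  rw [smoothMaj]
  rcases le_total ρ 0 with h | h
  · have h1 := rpow_le_of_mem (z := 1 + Real.exp ρ) (R := 1) (k₁ := 1) (k₂ := 2) one_pos one_pos
      (by linarith [Real.exp_pos ρ]) (by linarith [Real.exp_le_one_iff.2 h]) x
    rw [Real.one_rpow, mul_one] at h1
    rw [mul_comm, abs_of_nonpos h]
    refine mul_le_mul h1 (Real.exp_le_exp.2 ?_) (by positivity) hc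
    nlinarith [min_le_left b (-(b + x))]
  · have h1 := rpow_le_of_mem (z := 1 + Real.exp ρ) (R := Real.exp ρ) (k₁ := 1) (k₂ := 2) one_pos
      (Real.exp_pos _) (by linarith) (by linarith [Real.one_le_exp h]) x
    rw [Real.one_rpow] at h1
    rw [abs_of_nonneg h]
    refine (mul_le_mul_of_nonneg_left h1 (Real.exp_pos _).le).trans ?_
    rw [mul_left_comm, ← Real.exp_mul, ← Real.exp_add]
    refine mul_le_mul_of_nonneg_left (Real.exp_le_exp.2 ?_) hc
    nlinarith [min_le_right b (-(b + x))]

theorem smoothMaj_bounded {b x : ℝ} (hb : 0 ≤ b) (hbx : b + x ≤ 0) (ρ : ℝ) :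
    smoothMaj b x ρ ≤ 1 + 2 ^ x := by
  refine (smoothMaj_le b x ρ).trans (mul_le_of_le_one_right (by positivity) ?_)
  rw [Real.exp_le_one_iff, neg_mul, neg_nonpos]
  exact mul_nonneg (le_min hb (by linarith)) (abs_nonneg _)

theorem integrable_smoothMaj {b x : ℝ} (hb : 0 < b) (hbx : b + x < 0) :
    Integrable (smoothMaj b x) :=
  ((integrable_exp_neg_mul_abs (lt_min hb (by linarith : 0 < -(b + x)))).const_mul _).mono'
    (continuous_smoothMaj b x).aestronglyMeasurable
    (ae_of_all _ fun ρ => by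
      rw [Real.norm_of_nonneg (smoothMaj_nonneg _ _ _)]; exact smoothMaj_le b x ρ)

theorem tendsto_smoothMaj {b x : ℝ} (hb : 0 < b) (hbx : b + x < 0) :
    Tendsto (smoothMaj b x) atTop (𝓝 0) ∧ Tendsto (smoothMaj b x) atBot (𝓝 0) := by
  obtain ⟨h1, h2⟩ := tendsto_exp_neg_mul_abs (lt_min hb (by linarith : 0 < -(b + x)))
  exact ⟨squeeze_zero (fun _ => smoothMaj_nonneg _ _ _) (smoothMaj_le b x)
      (by simpa using h1.const_mul (1 + (2 : ℝ) ^ x)),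
    squeeze_zero (fun _ => smoothMaj_nonneg _ _ _) (smoothMaj_le b x)
      (by simpa using h2.const_mul (1 + (2 : ℝ) ^ x))⟩

theorem abs_one_sub_exp_far {ρ : ℝ} (hρ : 1 ≤ |ρ|) :
    1 / 4 * (1 + Real.exp ρ) ≤ |1 - Real.exp ρ| ∧ |1 - Real.exp ρ| ≤ 1 * (1 + Real.exp ρ) := by
  have hpos := Real.exp_pos ρ
  refine ⟨?_, ?_⟩
  · rcases le_abs'.1 hρ with h | h
    · have h1 : Real.exp ρ ≤ 1 / 2 := by
        have := Real.add_one_le_exp (-ρ)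
        rw [Real.exp_neg] at this
        have h2 : 2 ≤ (Real.exp ρ)⁻¹ := by linarith
        have := inv_anti₀ (by norm_num) h2
        rw [inv_inv] at this
        linarith
      rw [abs_of_pos (by linarith)]
      linarith
    · have h1 := Real.add_one_le_exp ρ
      rw [abs_of_neg (by linarith)]
      linarith
  · rw [one_mul, abs_le]
    constructor <;> linarith

theorem abs_one_sub_exp_near {ρ : ℝ} (hρ : |ρ| ≤ 1) :
    1 / 3 * |ρ| ≤ |1 - Real.exp ρ| ∧ |1 - Real.exp ρ| ≤ 3 * |ρ| := by
  have h1 := Real.abs_exp_sub_one_le hρ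
  rw [abs_sub_comm] at h1
  refine ⟨?_, h1.trans (by have := abs_nonneg ρ; linarith)⟩
  rcases le_total 0 ρ with h | h
  · have := Real.add_one_le_exp ρ
    rw [abs_of_nonneg h, abs_of_nonpos (by linarith)]
    linarith
  · have h2 := Real.add_one_le_exp (-ρ)
    rw [abs_of_nonpos h] at hρ ⊢
    have h3 : Real.exp ρ ≤ 1 / (1 - ρ) := by
      rw [le_div_iff₀ (by linarith)]
      have : Real.exp ρ * Real.exp (-ρ) = 1 := by rw [← Real.exp_add]; simp
      nlinarith [Real.exp_pos ρ]
    have h4 : 1 / (1 - ρ) ≤ 1 + ρ / 3 := by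
      rw [div_le_iff₀ (by linarith)]
      nlinarith
    rw [abs_of_nonneg (by have := Real.exp_le_one_iff.2 h; linarith)]
    linarith

theorem integrableOn_abs_rpow {q : ℝ} (hq : -1 < q) :
    IntegrableOn (fun ρ : ℝ => |ρ| ^ q) (Icc (-1) 1) := by
  have h1 : IntegrableOn (fun ρ : ℝ => |ρ| ^ q) (Ioc 0 1) := by
    have := (intervalIntegral.intervalIntegrable_rpow' (a := 0) (b := 1) hq).1
    exact this.congr_fun (fun ρ hρ => by simp only [abs_of_pos hρ.1]) measurableSet_Ioc
  have h2 : IntegrableOn (fun ρ : ℝ => |ρ| ^ q) (Icc (-1) 0) := by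
    have h := (intervalIntegral.intervalIntegrable_rpow' (a := 0) (b := 1) hq).comp_sub_left 0
    simp only [zero_sub, sub_zero] at h
    have h4 : IntegrableOn (fun x : ℝ => (-x) ^ q) (Icc (-1) 0) := by
      rw [integrableOn_Icc_iff_integrableOn_Ioc]
      exact h.2
    exact h4.congr_fun (fun ρ hρ => by simp only [abs_of_nonpos hρ.2]) measurableSet_Icc
  rw [← Icc_union_Ioc_eq_Icc (by norm_num : (-1 : ℝ) ≤ 0) zero_le_one]
  exact h2.union h1

/-- For `|ρ| ≤ 1` the quantity `|1 - e^ρ|` is comparable to `|ρ|`, and beyond that to `1 + e^ρ`. The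
singularity is thus that of `|ρ|^q` on `[-1,1]`, and elsewhere the smooth majorant suffices. -/
theorem singMaj_le (b q s : ℝ) : ∃ C, ∀ ρ : ℝ, ρ ≠ 0 → singMaj b q s ρ ≤
    C * (indicator (Icc (-1) 1) (fun ρ : ℝ => |ρ| ^ q) ρ + smoothMaj b (q + s) ρ) := by
  have hcont : ContinuousOn (smoothMaj b s) (Icc (-1) 1) := (continuous_smoothMaj b s).continuousOn
  obtain ⟨K, hK⟩ := isCompact_Icc.exists_bound_of_continuousOn hcont
  set c1 : ℝ := (1 / 3) ^ q + 3 ^ q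
  set c2 : ℝ := (1 / 4) ^ q + 1 ^ q
  have hc1 : 0 ≤ c1 := by positivity
  have hc2 : 0 ≤ c2 := by positivity
  have hK0 : 0 ≤ K := (norm_nonneg _).trans (hK 0 (by simp))
  refine ⟨c1 * K + c2 + 1, fun ρ hρ => ?_⟩
  have hpos : 0 < 1 + Real.exp ρ := by positivity
  have hsplit : singMaj b q s ρ = |1 - Real.exp ρ| ^ q * smoothMaj b s ρ
      + smoothMaj b (q + s) ρ := by
    rw [singMaj, smoothMaj, smoothMaj, Real.rpow_add hpos]; ring
  have hs := smoothMaj_nonneg b (q + s) ρ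
  have hs' := smoothMaj_nonneg b s ρ
  rcases le_total |ρ| 1 with h | h
  · obtain ⟨h1, h2⟩ := abs_one_sub_exp_near h
    have hmem : ρ ∈ Icc (-1 : ℝ) 1 := abs_le.1 h
    have h3 := rpow_le_of_mem (by norm_num) (abs_pos.2 hρ) h1 h2 q
    have h4 := (le_abs_self _).trans (hK ρ hmem)
    rw [hsplit, indicator_of_mem hmem]
    have h5 : 0 ≤ |ρ| ^ q := by positivity
    have h6 : |1 - Real.exp ρ| ^ q * smoothMaj b s ρ ≤ (c1 * |ρ| ^ q) * K := by gcongr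
    nlinarith [mul_nonneg hc1 hK0, mul_nonneg (add_nonneg (mul_nonneg hc1 hK0) hc2) hs,
      mul_nonneg hc2 h5]
  · obtain ⟨h1, h2⟩ := abs_one_sub_exp_far h
    have h3 := rpow_le_of_mem (by norm_num) hpos h1 h2 q
    have h5 : 0 ≤ indicator (Icc (-1) 1) (fun ρ : ℝ => |ρ| ^ q) ρ :=
      indicator_nonneg (fun _ _ => by positivity) _
    have h6 : |1 - Real.exp ρ| ^ q * smoothMaj b s ρ ≤ c2 * smoothMaj b (q + s) ρ := by
      have e : smoothMaj b (q + s) ρ = (1 + Real.exp ρ) ^ q * smoothMaj b s ρ := by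
        rw [smoothMaj, smoothMaj, Real.rpow_add hpos]; ring
      rw [e, ← mul_assoc]
      gcongr
    rw [hsplit]
    have := mul_nonneg hc1 hK0
    nlinarith [mul_nonneg this hs, mul_nonneg (by positivity : 0 ≤ c1 * K + c2 + 1) h5]

theorem integrable_singMaj {b q s : ℝ} (hb : 0 < b) (hq : -1 < q) (hbqs : b + q + s < 0) :
    Integrable (singMaj b q s) := by
  obtain ⟨C, hC⟩ := singMaj_le b q s
  have h1 : Integrable (indicator (Icc (-1) 1) (fun ρ : ℝ => |ρ| ^ q)) :=
    (integrable_indicator_iff measurableSet_Icc).2 (integrableOn_abs_rpow hq)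
  refine ((h1.add (integrable_smoothMaj (x := q + s) hb (by linarith))).const_mul C).mono'
    (measurable_singMaj b q s).aestronglyMeasurable ?_
  filter_upwards [compl_mem_ae_iff.2 (measure_singleton (0 : ℝ))] with ρ hρ
  rw [Real.norm_of_nonneg (singMaj_nonneg _ _ _ _)]
  exact hC ρ hρ

theorem exp_mul_singMaj (b q s lam ρ : ℝ) :
    singMaj b q s ρ * Real.exp (lam * ρ) = singMaj (b + lam) q s ρ := by
  simp only [singMaj, add_mul, Real.exp_add]; ring

theorem exp_mul_smoothMaj (b x lam ρ : ℝ) :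
    smoothMaj b x ρ * Real.exp (lam * ρ) = smoothMaj (b + lam) x ρ := by
  simp only [smoothMaj, add_mul, Real.exp_add]; ring

/-- The primitive of the singular majorant grows at most exponentially. -/
theorem integral_singMaj_le {b q s lam : ℝ} (hq : -1 < q) (h0 : 0 < lam) (hb : lam < b)
    (hbqs : b + q + s < lam) :
    (∀ ρ, IntegrableOn (singMaj b q s) (Iio ρ)) ∧
    ∃ C, ∀ ρ, ∫ σ in Iio ρ, singMaj b q s σ ≤ C * Real.exp (lam * ρ) := by
  -- Split `e^(bσ) = e^((b-lam)σ) e^(lam σ)`. For `σ < ρ` the second factor is at most `e^(lam ρ)`,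
  -- as `lam > 0`, and what remains is integrable over the whole line.
  have hint := integrable_singMaj (b := b - lam) (q := q) (s := s) (by linarith) hq (by linarith)
  have e (σ : ℝ) : singMaj b q s σ = singMaj (b - lam) q s σ * Real.exp (lam * σ) := by
    rw [exp_mul_singMaj]; congr 1; ring
  have hle (ρ σ : ℝ) (h : σ ∈ Iio ρ) :
      singMaj b q s σ ≤ singMaj (b - lam) q s σ * Real.exp (lam * ρ) := by
    rw [e]
    have := singMaj_nonneg (b - lam) q s σ
    have := (mem_Iio.1 h).le
    gcongr
  have hi (ρ : ℝ) : IntegrableOn (singMaj b q s) (Iio ρ) := by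
    refine Integrable.mono' (hint.mul_const (Real.exp (lam * ρ))).integrableOn
      (measurable_singMaj b q s).aestronglyMeasurable ?_
    refine (ae_restrict_mem measurableSet_Iio).mono fun σ hσ => ?_
    rw [Real.norm_of_nonneg (singMaj_nonneg _ _ _ _)]
    exact hle ρ σ hσ
  refine ⟨hi, ∫ σ, singMaj (b - lam) q s σ, fun ρ => ?_⟩
  calc ∫ σ in Iio ρ, singMaj b q s σ
      ≤ ∫ σ in Iio ρ, singMaj (b - lam) q s σ * Real.exp (lam * ρ) :=
        setIntegral_mono_on (hi ρ) (hint.mul_const _).integrableOn measurableSet_Iio (hle ρ)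
    _ ≤ ∫ σ, singMaj (b - lam) q s σ * Real.exp (lam * ρ) :=
        setIntegral_le_integral (hint.mul_const _) (ae_of_all _ fun σ =>
          mul_nonneg (singMaj_nonneg _ _ _ _) (Real.exp_pos _).le)
    _ = _ := integral_mul_const _ _

end Majorants

/-! ### The kernel in logarithmic coordinates: bounds and boundary values -/

section Kernel

theorem norm_cpow_le_exp_mul (z s : ℂ) : ‖z ^ s‖ ≤ Real.exp (Real.pi * |s.im|) * ‖z‖ ^ s.re := by
  refine (Complex.norm_cpow_le z s).trans ?_
  rw [div_eq_mul_inv, ← Real.exp_neg, mul_comm]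
  refine mul_le_mul_of_nonneg_right (Real.exp_le_exp.2 ?_) (by positivity)
  have h1 := Complex.abs_arg_le_pi z
  calc -(z.arg * s.im) ≤ |z.arg * s.im| := neg_le_abs _
    _ = |z.arg| * |s.im| := abs_mul _ _
    _ ≤ _ := by gcongr

/-- `1 - e^u` meets the cut `(-∞, 0]` only if `e^u` is real and at least `1`, which forces `Im u ∈
2πℤ`; the nonvanishing sine excludes this. -/
theorem one_sub_exp_mem_slitPlane {u : ℂ} (hu : Real.sin (u.im / 2) ≠ 0) :
    1 - Complex.exp u ∈ Complex.slitPlane := by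
  rw [Complex.mem_slitPlane_iff]
  by_cases h : Real.sin u.im = 0
  · left
    have h2 : Real.sin u.im = 2 * Real.sin (u.im / 2) * Real.cos (u.im / 2) := by
      rw [← Real.sin_two_mul]; ring_nf
    have h3 : Real.cos (u.im / 2) = 0 := by
      rw [h] at h2
      by_contra h4
      exact mul_ne_zero (mul_ne_zero two_ne_zero hu) h4 h2.symm
    have h4 : Real.cos u.im = -1 := by
      have := Real.cos_two_mul (u.im / 2)
      rw [h3] at this
      rw [show u.im = 2 * (u.im / 2) by ring, this]; norm_num
    simp only [Complex.sub_re, Complex.one_re, Complex.exp_re, h4]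
    linarith [Real.exp_pos u.re]
  · right
    simp only [Complex.sub_im, Complex.one_im, Complex.exp_im, zero_sub, neg_ne_zero]
    exact mul_ne_zero (Real.exp_pos _).ne' h

/-- With `θ = Im u` and `ρ = Re u`, one has `|1 - e^u|² = sin²(θ/2) (1 + e^ρ)² + cos²(θ/2) (1 -
e^ρ)²`. The first term gives the lower bound away from the singular lines; the last bound holds also
on them. -/
theorem norm_one_sub_exp_bounds (u : ℂ) :
    |Real.sin (u.im / 2)| * (1 + Real.exp u.re) ≤ ‖1 - Complex.exp u‖ ∧
    ‖1 - Complex.exp u‖ ≤ 1 + Real.exp u.re ∧ |1 - Real.exp u.re| ≤ ‖1 - Complex.exp u‖ := by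
  refine ⟨?_, ?_, ?_⟩
  · apply le_of_sq_le_sq _ (norm_nonneg _)
    rw [mul_pow, sq_abs, Real.sin_sq_eq_half_sub, Complex.sq_norm, Complex.normSq_apply]
    simp only [Complex.sub_re, Complex.one_re, Complex.exp_re, Complex.sub_im, Complex.one_im,
      Complex.exp_im]
    rw [show 2 * (u.im / 2) = u.im by ring]
    nlinarith [Real.sin_sq_add_cos_sq u.im, Real.neg_one_le_cos u.im,
      mul_nonneg (by linarith [Real.neg_one_le_cos u.im] : 0 ≤ 1 + Real.cos u.im)
        (sq_nonneg (1 - Real.exp u.re))]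
  · have := norm_sub_le (1 : ℂ) (Complex.exp u)
    simpa [Complex.norm_exp] using this
  · have := abs_norm_sub_norm_le (1 : ℂ) (Complex.exp u)
    simpa [Complex.norm_exp] using this

theorem norm_cpow_le_of_mem {z s : ℂ} {R k₁ k₂ : ℝ} (hk₁ : 0 < k₁) (hR : 0 < R)
    (h1 : k₁ * R ≤ ‖z‖) (h2 : ‖z‖ ≤ k₂ * R) :
    ‖z ^ s‖ ≤ Real.exp (Real.pi * |s.im|) * (k₁ ^ s.re + k₂ ^ s.re) * R ^ s.re := by
  refine (norm_cpow_le_exp_mul z s).trans ?_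
  rw [mul_assoc]
  gcongr
  exact rpow_le_of_mem hk₁ hR h1 h2 _

theorem norm_one_sub_exp_sub_cpow_le (w s : ℂ) {c : ℝ} (hc : 0 < c) :
    ∃ C, 0 ≤ C ∧ ∀ ρ θ : ℝ, c ≤ |Real.sin ((θ - w.im) / 2)| →
      ‖(1 - Complex.exp (ρ + θ * Complex.I - w)) ^ s‖ ≤ C * (1 + Real.exp ρ) ^ s.re := by
  -- `k₁` and `k₂` absorb the translation by `Re w`, which compares `1 + e^(ρ - Re w)` with `1 +
  -- e^ρ`, and the lower bound `c` of the sine.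
  set k₁ := c * min 1 (Real.exp (-w.re))
  set k₂ := max 1 (Real.exp (-w.re))
  have hk₁ : 0 < k₁ := mul_pos hc (lt_min one_pos (Real.exp_pos _))
  have hk₂ : 0 ≤ k₂ := zero_le_one.trans (le_max_left _ _)
  refine ⟨Real.exp (Real.pi * |s.im|) * (k₁ ^ s.re + k₂ ^ s.re), by positivity, fun ρ θ h => ?_⟩
  have hpos := Real.exp_pos ρ
  obtain ⟨h1, h2, -⟩ := norm_one_sub_exp_bounds (ρ + θ * Complex.I - w)
  have hre : (ρ + θ * Complex.I - w : ℂ).re = ρ + -w.re := by simp; ring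
  have him : (ρ + θ * Complex.I - w : ℂ).im = θ - w.im := by simp
  rw [hre, Real.exp_add] at h1 h2
  rw [him] at h1
  refine norm_cpow_le_of_mem hk₁ (by positivity) (le_trans ?_ h1) (h2.trans ?_)
  · have h3 : min 1 (Real.exp (-w.re)) * (1 + Real.exp ρ) ≤ 1 + Real.exp ρ * Real.exp (-w.re) := by
      have := min_le_left 1 (Real.exp (-w.re))
      have := min_le_right 1 (Real.exp (-w.re))
      nlinarith
    rw [mul_assoc]
    exact mul_le_mul h h3 (by positivity) (abs_nonneg _)
  · have := le_max_left 1 (Real.exp (-w.re))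
    have := le_max_right 1 (Real.exp (-w.re))
    nlinarith

/-- The integrand `z^b (1-z)^q (1-yz)^s` in the variables `z = e^u`, `y = e^(-w)`. -/
def stripKernel (b q s w u : ℂ) : ℂ :=
  Complex.exp (b * u) * (1 - Complex.exp u) ^ q * (1 - Complex.exp (u - w)) ^ s

/-- The integrand on the real line, without phase. -/
def realKernel (b q s w : ℂ) (ρ : ℝ) : ℂ :=
  Complex.exp (b * ρ) * (|1 - Real.exp ρ| : ℝ) ^ q * (1 - Complex.exp (ρ - w)) ^ s

theorem differentiableAt_stripKernel {b q s w u : ℂ} (h1 : Real.sin (u.im / 2) ≠ 0)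
    (h2 : Real.sin ((u.im - w.im) / 2) ≠ 0) : DifferentiableAt ℂ (stripKernel b q s w) u := by
  refine DifferentiableAt.mul (DifferentiableAt.mul (by fun_prop)
    (DifferentiableAt.cpow (by fun_prop) (by fun_prop) (one_sub_exp_mem_slitPlane h1)))
    (DifferentiableAt.cpow (by fun_prop) (by fun_prop) (one_sub_exp_mem_slitPlane ?_))
  simpa using h2

theorem norm_exp_mul_le (b : ℂ) {ρ θ Θ : ℝ} (hθ : |θ| ≤ Θ) :
    ‖Complex.exp (b * (ρ + θ * Complex.I))‖ ≤ Real.exp (|b.im| * Θ) * Real.exp (b.re * ρ) := by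
  rw [Complex.norm_exp, ← Real.exp_add]
  refine Real.exp_le_exp.2 ?_
  simp
  have : -(b.im * θ) ≤ |b.im| * |θ| := by rw [← abs_mul]; exact neg_le_abs _
  have : |b.im| * |θ| ≤ |b.im| * Θ := by gcongr
  linarith

/-- Away from the singular lines the kernel has the smooth majorant. -/
theorem norm_stripKernel_le_smoothMaj (b q s w : ℂ) {c : ℝ} (hc : 0 < c) (Θ : ℝ) :
    ∃ C, 0 ≤ C ∧ ∀ ρ θ : ℝ, |θ| ≤ Θ → c ≤ |Real.sin (θ / 2)| → c ≤ |Real.sin ((θ - w.im) / 2)| →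
      ‖stripKernel b q s w (ρ + θ * Complex.I)‖ ≤ C * smoothMaj b.re (q.re + s.re) ρ := by
  obtain ⟨C1, hC1, h1⟩ := norm_one_sub_exp_sub_cpow_le 0 q hc
  obtain ⟨C2, hC2, h2⟩ := norm_one_sub_exp_sub_cpow_le w s hc
  refine ⟨Real.exp (|b.im| * Θ) * C1 * C2, by positivity, fun ρ θ hθ hs1 hs2 => ?_⟩
  have k1 := h1 ρ θ (by simpa using hs1)
  have k2 := h2 ρ θ hs2
  rw [sub_zero] at k1
  rw [stripKernel, norm_mul, norm_mul, smoothMaj, Real.rpow_add (by positivity)]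
  calc _ ≤ (Real.exp (|b.im| * Θ) * Real.exp (b.re * ρ)) * (C1 * (1 + Real.exp ρ) ^ q.re)
        * (C2 * (1 + Real.exp ρ) ^ s.re) := by
        gcongr
        exact norm_exp_mul_le b hθ
    _ = _ := by ring

/-- Near the line through the branch point `0` the kernel has the singular majorant. -/
theorem norm_stripKernel_le_singMaj (b q s w : ℂ) {c : ℝ} (hc : 0 < c) (Θ : ℝ) :
    ∃ C, 0 ≤ C ∧ ∀ ρ θ : ℝ, ρ ≠ 0 → |θ| ≤ Θ → c ≤ |Real.sin ((θ - w.im) / 2)| →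
      ‖stripKernel b q s w (ρ + θ * Complex.I)‖ ≤ C * singMaj b.re q.re s.re ρ := by
  obtain ⟨C2, hC2, h2⟩ := norm_one_sub_exp_sub_cpow_le w s hc
  refine ⟨Real.exp (|b.im| * Θ) * Real.exp (Real.pi * |q.im|) * C2, by positivity,
    fun ρ θ hρ hθ hs2 => ?_⟩
  have k2 := h2 ρ θ hs2
  have k1 : ‖(1 - Complex.exp (ρ + θ * Complex.I)) ^ q‖ ≤ Real.exp (Real.pi * |q.im|)
      * (|1 - Real.exp ρ| ^ q.re + (1 + Real.exp ρ) ^ q.re) := by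
    refine (norm_cpow_le_exp_mul _ _).trans ?_
    gcongr
    obtain ⟨-, h3, h4⟩ := norm_one_sub_exp_bounds (ρ + θ * Complex.I)
    have hre : (ρ + θ * Complex.I : ℂ).re = ρ := by simp
    rw [hre] at h3 h4
    have hpos : 0 < |1 - Real.exp ρ| := by
      rw [abs_pos, sub_ne_zero]
      intro h
      exact hρ (Real.exp_eq_one_iff ρ |>.1 h.symm)
    -- For `Re q ≥ 0` the upper bound `1 + e^ρ` of the modulus is the relevant one, for `Re q ≤ 0`
    -- the lower bound `|1 - e^ρ|`; the majorant adds both powers to cover the two signs.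
    rcases le_total 0 q.re with hq | hq
    · have := Real.rpow_le_rpow (norm_nonneg _) h3 hq
      have : 0 ≤ |1 - Real.exp ρ| ^ q.re := by positivity
      linarith
    · have := Real.rpow_le_rpow_of_nonpos hpos h4 hq
      have : 0 ≤ (1 + Real.exp ρ) ^ q.re := by positivity
      linarith
  rw [stripKernel, norm_mul, norm_mul, singMaj]
  calc _ ≤ (Real.exp (|b.im| * Θ) * Real.exp (b.re * ρ)) * (Real.exp (Real.pi * |q.im|)
        * (|1 - Real.exp ρ| ^ q.re + (1 + Real.exp ρ) ^ q.re))
        * (C2 * (1 + Real.exp ρ) ^ s.re) := by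
        gcongr
        exact norm_exp_mul_le b hθ
    _ = _ := by ring

/-- A phase on the positive half line. -/
def phaseJump (ω : ℂ) (ρ : ℝ) : ℂ := if ρ < 0 then 1 else ω

theorem tendsto_stripKernel_aux {b q s w : ℂ} (hw : Real.sin (w.im / 2) ≠ 0) {ρ : ℝ}
    {l : Filter ℝ} (hl : l ≤ 𝓝 0) {z : ℂ}
    (h : Tendsto (fun θ : ℝ => (1 - Complex.exp (ρ + θ * Complex.I)) ^ q) l (𝓝 z)) :
    Tendsto (fun θ : ℝ => stripKernel b q s w (ρ + θ * Complex.I)) l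
      (𝓝 (Complex.exp (b * ρ) * z * (1 - Complex.exp (ρ - w)) ^ s)) := by
  refine (Tendsto.mul ?_ h).mul ?_
  · have : Tendsto (fun θ : ℝ => Complex.exp (b * (ρ + θ * Complex.I))) (𝓝 0)
        (𝓝 (Complex.exp (b * (ρ + (0 : ℝ) * Complex.I)))) :=
      Continuous.tendsto (by fun_prop) 0
    simpa using this.mono_left hl
  · have hslit : 1 - Complex.exp (ρ - w) ∈ Complex.slitPlane := by
      refine one_sub_exp_mem_slitPlane ?_
      simpa [neg_div] using hw
    have h1 : ContinuousAt (fun θ : ℝ => (1 - Complex.exp (ρ + θ * Complex.I - w)) ^ s) 0 := by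
      refine ContinuousAt.cpow (by fun_prop) (by fun_prop) ?_
      simpa using hslit
    have := h1.tendsto.mono_left hl
    simpa using this

theorem tendsto_stripKernel_neg {b q s w : ℂ} (hw : Real.sin (w.im / 2) ≠ 0) {ρ : ℝ}
    (hρ : ρ < 0) : Tendsto (fun θ : ℝ => stripKernel b q s w (ρ + θ * Complex.I)) (𝓝 0)
      (𝓝 (realKernel b q s w ρ)) := by
  refine tendsto_stripKernel_aux hw le_rfl ?_
  have hpos : 0 < 1 - Real.exp ρ := by linarith [Real.exp_lt_one_iff.2 hρ]
  have h1 : ContinuousAt (fun θ : ℝ => (1 - Complex.exp (ρ + θ * Complex.I)) ^ q) 0 := by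
    refine ContinuousAt.cpow (by fun_prop) (by fun_prop) ?_
    have : (1 : ℂ) - Complex.exp (ρ + (0 : ℝ) * Complex.I) = ((1 - Real.exp ρ : ℝ) : ℂ) := by
      push_cast; simp
    rw [this]
    exact Complex.ofReal_mem_slitPlane.2 hpos
  have := h1.tendsto
  rw [abs_of_pos hpos]
  simpa using this

theorem tendsto_cpow_of_tendsto_log {q : ℂ} {l : Filter ℝ} {f : ℝ → ℂ} {x : ℝ} (hx : x ≠ 0)
    (hf : ∀ᶠ θ in l, f θ ≠ 0) {ι : ℂ}
    (h : Tendsto (fun θ => Complex.log (f θ)) l (𝓝 (Real.log |x| + ι))) :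
    Tendsto (fun θ => f θ ^ q) l (𝓝 (Complex.exp (ι * q) * (|x| : ℝ) ^ q)) := by
  have h1 := (Complex.continuous_exp.tendsto _).comp (h.mul_const q)
  have hx' : ((|x| : ℝ) : ℂ) ≠ 0 := by exact_mod_cast abs_ne_zero.2 hx
  rw [add_mul, add_comm, Complex.exp_add] at h1
  rw [Complex.cpow_def_of_ne_zero hx', ← Complex.ofReal_log (abs_nonneg x)]
  refine h1.congr' ?_
  filter_upwards [hf] with θ hθ
  rw [Function.comp, Complex.cpow_def_of_ne_zero hθ]

theorem tendsto_one_sub_exp_line (ρ : ℝ) :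
    Tendsto (fun θ : ℝ => 1 - Complex.exp (ρ + θ * Complex.I)) (𝓝 0)
      (𝓝 ((1 - Real.exp ρ : ℝ) : ℂ)) := by
  have h1 : Continuous fun θ : ℝ => 1 - Complex.exp (ρ + θ * Complex.I) := by fun_prop
  have := h1.tendsto 0
  simpa using this

theorem im_one_sub_exp_line (ρ θ : ℝ) :
    (1 - Complex.exp (ρ + θ * Complex.I)).im = -(Real.exp ρ * Real.sin θ) := by
  simp [Complex.exp_im]

/-- For `ρ > 0` and `θ ↓ 0` the point `1 - e^(ρ+iθ)` reaches the negative axis from below, where the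
logarithm has imaginary part `-π`; hence the phase `e^(-πiq)`. For `ρ < 0` there is no phase. -/
theorem tendsto_stripKernel_right {b q s w : ℂ} (hw : Real.sin (w.im / 2) ≠ 0) {ρ : ℝ}
    (hρ : ρ ≠ 0) : Tendsto (fun θ : ℝ => stripKernel b q s w (ρ + θ * Complex.I)) (𝓝[>] 0)
      (𝓝 (phaseJump (Complex.exp (-Real.pi * Complex.I * q)) ρ * realKernel b q s w ρ)) := by
  rcases lt_or_gt_of_ne hρ with h | h
  · rw [phaseJump, if_pos h, one_mul]
    exact (tendsto_stripKernel_neg hw h).mono_left nhdsWithin_le_nhds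
  · rw [phaseJump, if_neg h.le.not_gt]
    have hneg : 1 - Real.exp ρ < 0 := by linarith [Real.one_lt_exp_iff.2 h]
    have him : ∀ᶠ θ : ℝ in 𝓝[>] (0 : ℝ), (1 - Complex.exp (ρ + θ * Complex.I)).im < 0 := by
      filter_upwards [Ioo_mem_nhdsGT Real.pi_pos] with θ hθ
      rw [im_one_sub_exp_line, neg_lt_zero]
      exact mul_pos (Real.exp_pos _) (Real.sin_pos_of_pos_of_lt_pi hθ.1 hθ.2)
    have hlog := (Complex.tendsto_log_nhdsWithin_im_neg_of_re_neg_of_im_zero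
      (z := ((1 - Real.exp ρ : ℝ) : ℂ)) (by rw [Complex.ofReal_re]; exact hneg) (Complex.ofReal_im _)).comp
      (tendsto_nhdsWithin_iff.2 ⟨(tendsto_one_sub_exp_line ρ).mono_left nhdsWithin_le_nhds, him⟩)
    have hne : ∀ᶠ θ : ℝ in 𝓝[>] (0 : ℝ), 1 - Complex.exp (ρ + (θ : ℝ) * Complex.I) ≠ 0 := by
      filter_upwards [him] with θ hθ h0
      rw [h0] at hθ
      simp at hθ
    rw [Complex.norm_real, Real.norm_eq_abs, sub_eq_add_neg] at hlog
    have h3 := tendsto_cpow_of_tendsto_log (q := q) (x := 1 - Real.exp ρ) hneg.ne hne hlog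
    have h4 := tendsto_stripKernel_aux (b := b) (s := s) hw nhdsWithin_le_nhds h3
    convert h4 using 2
    rw [realKernel]
    ring_nf

/-- For `ρ > 0` and `θ ↑ 0` the negative axis is approached from above, so the phase is the inverse
of the one on the right. -/
theorem tendsto_stripKernel_left {b q s w : ℂ} (hw : Real.sin (w.im / 2) ≠ 0) {ρ : ℝ}
    (hρ : ρ ≠ 0) : Tendsto (fun θ : ℝ => stripKernel b q s w (ρ + θ * Complex.I)) (𝓝[<] 0)
      (𝓝 (phaseJump (Complex.exp (Real.pi * Complex.I * q)) ρ * realKernel b q s w ρ)) := by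
  rcases lt_or_gt_of_ne hρ with h | h
  · rw [phaseJump, if_pos h, one_mul]
    exact (tendsto_stripKernel_neg hw h).mono_left nhdsWithin_le_nhds
  · rw [phaseJump, if_neg h.le.not_gt]
    have hneg : 1 - Real.exp ρ < 0 := by linarith [Real.one_lt_exp_iff.2 h]
    have him : ∀ᶠ θ : ℝ in 𝓝[<] (0 : ℝ), 0 < (1 - Complex.exp (ρ + θ * Complex.I)).im := by
      filter_upwards [Ioo_mem_nhdsLT (neg_lt_zero.2 Real.pi_pos)] with θ hθ
      rw [im_one_sub_exp_line, neg_pos]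
      exact mul_neg_of_pos_of_neg (Real.exp_pos _) (Real.sin_neg_of_neg_of_neg_pi_lt hθ.2 hθ.1)
    have hlog := (Complex.tendsto_log_nhdsWithin_im_nonneg_of_re_neg_of_im_zero
      (z := ((1 - Real.exp ρ : ℝ) : ℂ)) (by rw [Complex.ofReal_re]; exact hneg) (Complex.ofReal_im _)).comp
      (tendsto_nhdsWithin_iff.2 ⟨(tendsto_one_sub_exp_line ρ).mono_left nhdsWithin_le_nhds,
        him.mono fun θ h => h.le⟩)
    have hne : ∀ᶠ θ : ℝ in 𝓝[<] (0 : ℝ), 1 - Complex.exp (ρ + (θ : ℝ) * Complex.I) ≠ 0 := by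
      filter_upwards [him] with θ hθ h0
      rw [h0] at hθ
      simp at hθ
    rw [Complex.norm_real, Real.norm_eq_abs] at hlog
    have h3 := tendsto_cpow_of_tendsto_log (q := q) (x := 1 - Real.exp ρ) hneg.ne hne hlog
    have h4 := tendsto_stripKernel_aux (b := b) (s := s) hw nhdsWithin_le_nhds h3
    convert h4 using 2
    rw [realKernel]
    ring_nf

end Kernel

/-! ### Pairings on a boundary line -/

section Boundary

/-- Majorants which make the pairings `∫ F(ρ) ∫_{σ<ρ} G(σ)` absolutely convergent. -/
structure PairMaj (mf mg : ℝ → ℝ) (lam C : ℝ) : Prop where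
  int_g : ∀ ρ, IntegrableOn mg (Iio ρ)
  le_g : ∀ ρ, ∫ σ in Iio ρ, mg σ ≤ C * Real.exp (lam * ρ)
  int_f : Integrable fun ρ => Real.exp (lam * ρ) * mf ρ

variable {mf mg : ℝ → ℝ} {lam C : ℝ} {F G : ℝ → ℂ}

theorem PairMaj.norm_le (H : PairMaj mf mg lam C) (hF : ∀ᵐ ρ, ‖F ρ‖ ≤ mf ρ)
    (hG : ∀ᵐ σ, ‖G σ‖ ≤ mg σ) :
    ∀ᵐ ρ : ℝ, ‖F ρ * ∫ σ in Iio ρ, G σ‖ ≤ C * (Real.exp (lam * ρ) * mf ρ) := by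
  filter_upwards [hF] with ρ hρ
  rw [norm_mul]
  have h1 : ‖∫ σ in Iio ρ, G σ‖ ≤ C * Real.exp (lam * ρ) :=
    (norm_integral_le_of_norm_le (H.int_g ρ) (ae_restrict_of_ae hG)).trans (H.le_g ρ)
  calc _ ≤ mf ρ * (C * Real.exp (lam * ρ)) :=
        mul_le_mul hρ h1 (norm_nonneg _) ((norm_nonneg _).trans hρ)
    _ = _ := by ring

theorem aestronglyMeasurable_integral_Iio (hG : AEStronglyMeasurable G) :
    AEStronglyMeasurable fun ρ : ℝ => ∫ σ in Iio ρ, G σ := by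
  have h1 : (fun ρ : ℝ => ∫ σ in Iio ρ, G σ)
      = fun ρ : ℝ => ∫ σ, ({x : ℝ × ℝ | x.2 < x.1}.indicator fun x => hG.mk G x.2) (ρ, σ) := by
    funext ρ
    rw [← integral_indicator measurableSet_Iio]
    refine integral_congr_ae ?_
    filter_upwards [hG.ae_eq_mk] with σ hσ
    by_cases h : σ < ρ
    · rw [indicator_of_mem (mem_Iio.2 h), indicator_of_mem (by exact h), hσ]
    · rw [indicator_of_notMem (by simpa using h), indicator_of_notMem (by exact h)]
  rw [h1]
  refine StronglyMeasurable.aestronglyMeasurable (StronglyMeasurable.integral_prod_right' ?_)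
  exact (hG.stronglyMeasurable_mk.comp_measurable measurable_snd).indicator
    (measurableSet_lt measurable_snd measurable_fst)

theorem PairMaj.integrable (H : PairMaj mf mg lam C) (hF : ∀ᵐ ρ, ‖F ρ‖ ≤ mf ρ)
    (hG : ∀ᵐ σ, ‖G σ‖ ≤ mg σ) (hFm : AEStronglyMeasurable F) (hGm : AEStronglyMeasurable G) :
    Integrable fun ρ : ℝ => F ρ * ∫ σ in Iio ρ, G σ :=
  (H.int_f.const_mul C).mono' (hFm.mul (aestronglyMeasurable_integral_Iio hGm)) (H.norm_le hF hG)

/-- Dominated convergence is used twice: for the primitive of `g` with majorant `mg`, then for the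
outer integral, where the growth `e^(lam ρ)` of that primitive is paid for by `mf`. -/
theorem PairMaj.tendsto (H : PairMaj mf mg lam C) {l : Filter ℝ} [l.IsCountablyGenerated]
    {f g : ℝ → ℝ → ℂ} (hf : ∀ᶠ θ in l, ∀ᵐ ρ, ‖f θ ρ‖ ≤ mf ρ) (hg : ∀ᶠ θ in l, ∀ᵐ ρ, ‖g θ ρ‖ ≤ mg ρ)
    (hfm : ∀ᶠ θ in l, AEStronglyMeasurable (f θ)) (hgm : ∀ᶠ θ in l, AEStronglyMeasurable (g θ))
    (hfl : ∀ᵐ ρ, Tendsto (fun θ => f θ ρ) l (𝓝 (F ρ)))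
    (hgl : ∀ᵐ ρ, Tendsto (fun θ => g θ ρ) l (𝓝 (G ρ))) :
    Tendsto (fun θ => ∫ ρ : ℝ, f θ ρ * ∫ σ in Iio ρ, g θ σ) l
      (𝓝 (∫ ρ : ℝ, F ρ * ∫ σ in Iio ρ, G σ)) := by
  refine tendsto_integral_filter_of_dominated_convergence
    (fun ρ => C * (Real.exp (lam * ρ) * mf ρ)) ?_ ?_ (H.int_f.const_mul C) ?_
  · filter_upwards [hfm, hgm] with θ h1 h2
    exact h1.mul (aestronglyMeasurable_integral_Iio h2)
  · filter_upwards [hf, hg] with θ h1 h2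
    exact H.norm_le h1 h2
  · filter_upwards [hfl] with ρ hρ
    refine hρ.mul (tendsto_integral_filter_of_dominated_convergence mg ?_ ?_ (H.int_g ρ)
      (ae_restrict_of_ae hgl))
    · filter_upwards [hgm] with θ h using h.restrict
    · filter_upwards [hg] with θ h using ae_restrict_of_ae h

/-- The limit of the pairing on a boundary line. -/
def boundaryPairing (ω ω' : ℂ) (F G : ℝ → ℂ) : ℂ :=
  ∫ ρ : ℝ, (phaseJump ω ρ * F ρ) * ∫ σ in Iio ρ, phaseJump ω' σ * G σ

theorem measurable_phaseJump (ω : ℂ) : Measurable (phaseJump ω) :=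
  Measurable.ite measurableSet_Iio measurable_const measurable_const

theorem norm_phaseJump_le (ω : ℂ) (ρ : ℝ) : ‖phaseJump ω ρ‖ ≤ 1 + ‖ω‖ := by
  have := norm_nonneg ω
  rw [phaseJump]
  split_ifs <;> simp

theorem PairMaj.scale (H : PairMaj mf mg lam C) (c d : ℝ) (hd : 0 ≤ d) :
    PairMaj (fun ρ => c * mf ρ) (fun ρ => d * mg ρ) lam (d * C) where
  int_g ρ := (H.int_g ρ).const_mul d
  le_g ρ := by
    rw [integral_const_mul, mul_assoc]
    exact mul_le_mul_of_nonneg_left (H.le_g ρ) hd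
  int_f := by
    refine (H.int_f.const_mul c).congr (ae_of_all _ fun ρ => ?_)
    simp only
    ring

/-- In the region `σ < ρ` the phases are `1` when both variables are negative and `ω ω'` when both
are positive, so by `hω` these parts cancel in the difference. The part `σ < 0 < ρ` carries only the
phase of `F`, and there the double integral factorises. -/
theorem PairMaj.boundaryPairing_sub (H : PairMaj mf mg lam C) (hF : ∀ᵐ ρ, ‖F ρ‖ ≤ mf ρ)
    (hG : ∀ᵐ σ, ‖G σ‖ ≤ mg σ) (hFm : AEStronglyMeasurable F) (hGm : AEStronglyMeasurable G)
    {ω₁ ω₂ ω₁' ω₂' : ℂ} (hω : ω₁ * ω₁' = ω₂ * ω₂') :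
    boundaryPairing ω₁ ω₁' F G - boundaryPairing ω₂ ω₂' F G
      = (ω₁ - ω₂) * (∫ σ in Iio 0, G σ) * ∫ ρ in Ioi 0, F ρ := by
  have key (ω ω' : ℂ) : Integrable fun ρ : ℝ =>
      (phaseJump ω ρ * F ρ) * ∫ σ in Iio ρ, phaseJump ω' σ * G σ := by
    refine (H.scale (1 + ‖ω‖) (1 + ‖ω'‖) (by positivity)).integrable ?_ ?_
      ((measurable_phaseJump ω).aestronglyMeasurable.mul hFm)
      ((measurable_phaseJump ω').aestronglyMeasurable.mul hGm)
    · filter_upwards [hF] with ρ h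
      rw [norm_mul]
      exact mul_le_mul (norm_phaseJump_le _ _) h (norm_nonneg _) (by positivity)
    · filter_upwards [hG] with ρ h
      rw [norm_mul]
      exact mul_le_mul (norm_phaseJump_le _ _) h (norm_nonneg _) (by positivity)
  have hGi (ρ : ℝ) : IntegrableOn G (Iio ρ) :=
    (H.int_g ρ).mono' hGm.restrict (ae_restrict_of_ae hG)
  have hneg (ω : ℂ) {ρ : ℝ} (hρ : ρ ≤ 0) :
      ∫ σ in Iio ρ, phaseJump ω σ * G σ = ∫ σ in Iio ρ, G σ := by
    refine setIntegral_congr_fun measurableSet_Iio fun σ hσ => ?_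
    simp only [phaseJump, if_pos (lt_of_lt_of_le hσ hρ), one_mul]
  have hpos (ω : ℂ) {ρ : ℝ} (hρ : 0 ≤ ρ) : ∫ σ in Iio ρ, phaseJump ω σ * G σ
      = (∫ σ in Iio 0, G σ) + ω * ∫ σ in Ico 0 ρ, G σ := by
    have h1 : IntegrableOn (fun σ => phaseJump ω σ * G σ) (Iio ρ) :=
      ((H.int_g ρ).const_mul (1 + ‖ω‖)).mono'
        ((measurable_phaseJump ω).aestronglyMeasurable.mul hGm).restrict
        (ae_restrict_of_ae (by
          filter_upwards [hG] with σ h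
          rw [norm_mul]
          exact mul_le_mul (norm_phaseJump_le _ _) h (norm_nonneg _) (by positivity)))
    rw [← Iio_union_Ico_eq_Iio hρ, setIntegral_union _ measurableSet_Ico
      (h1.mono_set (Iio_subset_Iio hρ)) (h1.mono_set Ico_subset_Iio_self), hneg ω le_rfl,
      ← integral_const_mul]
    · congr 1
      refine setIntegral_congr_fun measurableSet_Ico fun σ hσ => ?_
      simp only [phaseJump, if_neg hσ.1.not_gt]
    · exact disjoint_left.2 fun x hx hx' => (not_le.2 hx) hx'.1
  rw [boundaryPairing, boundaryPairing, ← integral_sub (key _ _) (key _ _), ← integral_const_mul,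
    ← integral_indicator measurableSet_Ioi]
  refine integral_congr_ae ?_
  filter_upwards [compl_mem_ae_iff.2 (measure_singleton (0 : ℝ))] with ρ hρ0
  rcases lt_or_gt_of_ne (show ρ ≠ 0 from hρ0) with hρ | hρ
  · rw [indicator_of_notMem (by simpa using hρ.le), hneg _ hρ.le, hneg _ hρ.le, phaseJump,
      phaseJump, if_pos hρ, if_pos hρ, sub_self]
  · rw [indicator_of_mem (mem_Ioi.2 hρ), hpos _ hρ.le, hpos _ hρ.le, phaseJump, phaseJump,
      if_neg hρ.le.not_gt, if_neg hρ.le.not_gt]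
    -- This is the contribution of `0 ≤ σ < ρ`, where the equality of the products of phases enters.
    linear_combination (F ρ * ∫ σ in Ico 0 ρ, G σ) * hω

end Boundary

/-! ### Boundary limits of the pairing of two kernels -/

section KernelBoundary

theorem measurable_realKernel (b q s w : ℂ) : Measurable (realKernel b q s w) := by
  unfold realKernel
  refine Measurable.mul (Measurable.mul (by fun_prop) (Measurable.pow_const ?_ _))
    (Measurable.pow_const (by fun_prop) _)
  fun_prop

theorem norm_realKernel_le (b q s : ℂ) {w : ℂ} (hw : Real.sin (w.im / 2) ≠ 0) :
    ∃ C, 0 ≤ C ∧ ∀ ρ : ℝ, ρ ≠ 0 →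
      ‖realKernel b q s w ρ‖ ≤ C * singMaj b.re q.re s.re ρ := by
  obtain ⟨C, hC, h⟩ := norm_one_sub_exp_sub_cpow_le w s (abs_pos.2 hw)
  refine ⟨C, hC, fun ρ hρ => ?_⟩
  have h2 := h ρ 0 (by rw [zero_sub, neg_div, Real.sin_neg, abs_neg])
  simp only [Complex.ofReal_zero, zero_mul, add_zero] at h2
  have hpos : 0 < |1 - Real.exp ρ| := by
    rw [abs_pos, sub_ne_zero]
    exact fun h => hρ (Real.exp_eq_one_iff ρ |>.1 h.symm)
  rw [realKernel, norm_mul, norm_mul, singMaj, Complex.norm_exp,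
    Complex.norm_cpow_eq_rpow_re_of_pos hpos]
  have h3 : (b * ρ).re = b.re * ρ := by simp
  have h4 : 0 ≤ (1 + Real.exp ρ) ^ q.re := by positivity
  rw [h3]
  calc _ ≤ Real.exp (b.re * ρ) * (|1 - Real.exp ρ| ^ q.re + (1 + Real.exp ρ) ^ q.re)
        * (C * (1 + Real.exp ρ) ^ s.re) := by
        gcongr
        linarith
    _ = _ := by ring

/-- The conditions on the exponents under which the pairings converge up to the boundary. -/
structure KernelPair (b q s b' q' s' : ℂ) (lam : ℝ) : Prop where
  pos : 0 < lam
  hb : 0 < b.re + lam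
  hsum : b.re + lam + q.re + s.re < 0
  hb' : lam < b'.re
  hsum' : b'.re + q'.re + s'.re < lam
  hq : -1 < q.re
  hs : -1 < s.re
  hq' : -1 < q'.re
  hs' : -1 < s'.re

variable {b q s b' q' s' w w' : ℂ} {lam : ℝ}

theorem KernelPair.swap (H : KernelPair b q s b' q' s' lam) :
    KernelPair b s q b' s' q' lam :=
  ⟨H.pos, H.hb, by linarith [H.hsum], H.hb', by linarith [H.hsum'], H.hs, H.hq, H.hs', H.hq'⟩

theorem KernelPair.pairMaj (H : KernelPair b q s b' q' s' lam) :
    ∃ C, PairMaj (singMaj b.re q.re s.re) (singMaj b'.re q'.re s'.re) lam C := by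
  obtain ⟨h1, C, hC⟩ := integral_singMaj_le H.hq' H.pos H.hb' H.hsum'
  refine ⟨C, h1, hC, ?_⟩
  refine (integrable_singMaj (b := b.re + lam) (s := s.re) (by linarith [H.hb]) H.hq
    (by linarith [H.hsum])).congr (ae_of_all _ fun ρ => ?_)
  rw [← exp_mul_singMaj, mul_comm]

theorem continuous_stripKernel_line {θ : ℝ} (h1 : Real.sin (θ / 2) ≠ 0)
    (h2 : Real.sin ((θ - w.im) / 2) ≠ 0) :
    Continuous fun ρ : ℝ => stripKernel b q s w (ρ + θ * Complex.I) := by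
  rw [continuous_iff_continuousAt]
  intro ρ
  exact (differentiableAt_stripKernel (by simpa using h1) (by simpa using h2)).continuousAt.comp
    (f := fun ρ : ℝ => (ρ : ℂ) + θ * Complex.I) (by fun_prop)

theorem stripKernel_eventually (b q s : ℂ) (hw : Real.sin (w.im / 2) ≠ 0) :
    ∃ C, 0 ≤ C ∧ (∀ᶠ θ : ℝ in 𝓝 0, ∀ ρ : ℝ, ρ ≠ 0 →
      ‖stripKernel b q s w (ρ + θ * Complex.I)‖ ≤ C * singMaj b.re q.re s.re ρ) ∧
      ∀ᶠ θ : ℝ in 𝓝 0, θ ≠ 0 → Continuous fun ρ : ℝ => stripKernel b q s w (ρ + θ * Complex.I) := by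
  have hw' : 0 < |Real.sin ((0 - w.im) / 2)| := by
    rw [zero_sub, neg_div, Real.sin_neg, abs_neg]
    exact abs_pos.2 hw
  have hev : ∀ᶠ θ : ℝ in 𝓝 0, |Real.sin ((0 - w.im) / 2)| / 2 < |Real.sin ((θ - w.im) / 2)| := by
    have : Continuous fun θ : ℝ => |Real.sin ((θ - w.im) / 2)| := by fun_prop
    exact this.tendsto 0 |>.eventually (lt_mem_nhds (half_lt_self hw'))
  obtain ⟨C, hC, h⟩ := norm_stripKernel_le_singMaj b q s w (half_pos hw') 1
  refine ⟨C, hC, ?_, ?_⟩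
  · filter_upwards [hev, Icc_mem_nhds (a := (-1 : ℝ)) (b := 1) (by norm_num) (by norm_num)]
      with θ h1 h2 ρ hρ
    exact h ρ θ hρ (abs_le.2 h2) h1.le
  · filter_upwards [hev, Ioo_mem_nhds (a := (-1 : ℝ)) (b := 1) (by norm_num) (by norm_num)]
      with θ h1 h2 h3
    refine continuous_stripKernel_line ?_ (abs_pos.1 ((half_pos hw').trans h1))
    intro h4
    rw [Real.sin_eq_zero_iff_of_lt_of_lt (by linarith [h2.1, Real.pi_gt_three])
      (by linarith [h2.2, Real.pi_gt_three])] at h4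
    exact h3 (by linarith)

theorem KernelPair.tendsto_stripPairing (H : KernelPair b q s b' q' s' lam)
    (hw : Real.sin (w.im / 2) ≠ 0) (hw' : Real.sin (w'.im / 2) ≠ 0) {l : Filter ℝ}
    [l.IsCountablyGenerated] (hl : l ≤ 𝓝 0) (hl0 : ∀ᶠ θ in l, θ ≠ 0) {ω ω' : ℂ}
    (hf : ∀ ρ : ℝ, ρ ≠ 0 → Tendsto (fun θ : ℝ => stripKernel b q s w (ρ + θ * Complex.I)) l
      (𝓝 (phaseJump ω ρ * realKernel b q s w ρ)))
    (hg : ∀ ρ : ℝ, ρ ≠ 0 → Tendsto (fun θ : ℝ => stripKernel b' q' s' w' (ρ + (-θ : ℝ) * Complex.I))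
      l (𝓝 (phaseJump ω' ρ * realKernel b' q' s' w' ρ))) :
    Tendsto (stripPairing (stripKernel b q s w) (stripKernel b' q' s' w')) l
      (𝓝 (boundaryPairing ω ω' (realKernel b q s w) (realKernel b' q' s' w'))) := by
  obtain ⟨C, HC⟩ := H.pairMaj
  obtain ⟨c, -, hc, hc2⟩ := stripKernel_eventually b q s hw
  obtain ⟨d, hd0, hd, hd2⟩ := stripKernel_eventually b' q' s' hw'
  have hneg : Tendsto (fun θ : ℝ => -θ) l (𝓝 0) := by
    have : Tendsto (fun θ : ℝ => -θ) (𝓝 0) (𝓝 (-0)) := continuous_neg.tendsto 0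
    rw [neg_zero] at this
    exact this.mono_left hl
  have hae : ∀ᵐ ρ : ℝ, ρ ≠ 0 := compl_mem_ae_iff.2 (measure_singleton (0 : ℝ))
  have h1 : stripPairing (stripKernel b q s w) (stripKernel b' q' s' w') = fun θ : ℝ =>
      ∫ ρ : ℝ, stripKernel b q s w (ρ + θ * Complex.I)
        * ∫ σ in Iio ρ, stripKernel b' q' s' w' (σ + (-θ : ℝ) * Complex.I) := by
    funext θ
    simp only [stripPairing, Complex.ofReal_neg, neg_mul, sub_eq_add_neg]
  rw [h1, boundaryPairing]
  refine (HC.scale c d hd0).tendsto ?_ ?_ ?_ ?_ ?_ ?_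
  · filter_upwards [hl hc] with θ h
    filter_upwards [hae] with ρ hρ using h ρ hρ
  · filter_upwards [hneg hd] with θ h
    filter_upwards [hae] with ρ hρ using h ρ hρ
  · filter_upwards [hl hc2, hl0] with θ h h0 using (h h0).aestronglyMeasurable
  · filter_upwards [hneg hd2, hl0] with θ h h0 using (h (neg_ne_zero.2 h0)).aestronglyMeasurable
  · filter_upwards [hae] with ρ hρ using hf ρ hρ
  · filter_upwards [hae] with ρ hρ using hg ρ hρ

/-- The part of the real line integral inside the branch point. -/
def innerInt (b q s w : ℂ) : ℂ := ∫ ρ in Iio (0 : ℝ), realKernel b q s w ρ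

/-- The part of the real line integral outside the branch point. -/
def outerInt (b q s w : ℂ) : ℂ := ∫ ρ in Ioi (0 : ℝ), realKernel b q s w ρ

/-- When `f` approaches the line from above, `g` approaches it from below, so their phases are
`e^(∓πiq)` and `e^(±πiq')`. The products of phases on the two sides are `e^(πin)` and `e^(-πin)`,
equal because `n` is an integer; the difference of the phases of `f` is `2i sin(πq)`. -/
theorem KernelPair.exists_boundary_limits (H : KernelPair b q s b' q' s' lam)
    (hw : Real.sin (w.im / 2) ≠ 0) (hw' : Real.sin (w'.im / 2) ≠ 0) {n : ℤ} (hn : q' = q + n) :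
    ∃ P₁ P₂ : ℂ,
      Tendsto (stripPairing (stripKernel b q s w) (stripKernel b' q' s' w')) (𝓝[>] 0) (𝓝 P₁) ∧
      Tendsto (stripPairing (stripKernel b q s w) (stripKernel b' q' s' w')) (𝓝[<] 0) (𝓝 P₂) ∧
      P₂ - P₁ = 2 * Complex.I * Complex.sin (Real.pi * q) * innerInt b' q' s' w'
        * outerInt b q s w := by
  have hnl : Tendsto (fun θ : ℝ => -θ) (𝓝[>] 0) (𝓝[<] 0) := by
    refine tendsto_nhdsWithin_iff.2 ⟨?_, ?_⟩
    · have : Tendsto (fun θ : ℝ => -θ) (𝓝 0) (𝓝 (-0)) := continuous_neg.tendsto 0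
      rw [neg_zero] at this
      exact this.mono_left nhdsWithin_le_nhds
    · filter_upwards [self_mem_nhdsWithin] with θ hθ
      simpa using hθ
  have hnr : Tendsto (fun θ : ℝ => -θ) (𝓝[<] 0) (𝓝[>] 0) := by
    refine tendsto_nhdsWithin_iff.2 ⟨?_, ?_⟩
    · have : Tendsto (fun θ : ℝ => -θ) (𝓝 0) (𝓝 (-0)) := continuous_neg.tendsto 0
      rw [neg_zero] at this
      exact this.mono_left nhdsWithin_le_nhds
    · filter_upwards [self_mem_nhdsWithin] with θ hθ
      simpa using hθ
  refine ⟨_, _, H.tendsto_stripPairing hw hw' nhdsWithin_le_nhds ?_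
    (fun ρ hρ => tendsto_stripKernel_right hw hρ)
    (fun ρ hρ => (tendsto_stripKernel_left hw' hρ).comp hnl),
    H.tendsto_stripPairing hw hw' nhdsWithin_le_nhds ?_
    (fun ρ hρ => tendsto_stripKernel_left hw hρ)
    (fun ρ hρ => (tendsto_stripKernel_right hw' hρ).comp hnr), ?_⟩
  · filter_upwards [self_mem_nhdsWithin] with θ hθ using (ne_of_gt hθ)
  · filter_upwards [self_mem_nhdsWithin] with θ hθ using (ne_of_lt hθ)
  obtain ⟨C, HC⟩ := H.pairMaj
  obtain ⟨c, -, hc⟩ := norm_realKernel_le b q s hw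
  obtain ⟨d, hd0, hd⟩ := norm_realKernel_le b' q' s' hw'
  have hae : ∀ᵐ ρ : ℝ, ρ ≠ 0 := compl_mem_ae_iff.2 (measure_singleton (0 : ℝ))
  rw [(HC.scale c d hd0).boundaryPairing_sub (hae.mono hc) (hae.mono hd)
    (measurable_realKernel _ _ _ _).aestronglyMeasurable
    (measurable_realKernel _ _ _ _).aestronglyMeasurable, innerInt, outerInt]
  · have h2 : Complex.exp (Real.pi * Complex.I * q) - Complex.exp (-Real.pi * Complex.I * q)
        = 2 * Complex.I * Complex.sin (Real.pi * q) := by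
      rw [Complex.sin]
      have hI := Complex.I_mul_I
      rw [show -(Real.pi * q) * Complex.I = -Real.pi * Complex.I * q by ring,
        show Real.pi * q * Complex.I = Real.pi * Complex.I * q by ring]
      linear_combination (Complex.exp (Real.pi * Complex.I * q)
        - Complex.exp (-Real.pi * Complex.I * q)) * hI
    rw [h2]
  · rw [← Complex.exp_add, ← Complex.exp_add, Complex.exp_eq_exp_iff_exists_int, hn]
    exact ⟨-n, by push_cast; ring⟩

end KernelBoundary

/-! ### The angular integral as a sum of jumps at the singular lines -/

section Jump

variable {b q s b' q' s' w : ℂ} {lam : ℝ}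

theorem exists_pos_le_of_ne_zero {α β : ℝ} {f : ℝ → ℝ} (hf : Continuous f)
    (h : ∀ θ ∈ Icc α β, f θ ≠ 0) : ∃ c, 0 < c ∧ ∀ θ ∈ Icc α β, c ≤ |f θ| := by
  rcases (Icc α β).eq_empty_or_nonempty with h0 | h0
  · exact ⟨1, one_pos, fun θ hθ => absurd hθ (by simp [h0])⟩
  · obtain ⟨x, hx, hmin⟩ := isCompact_Icc.exists_isMinOn h0 hf.abs.continuousOn
    exact ⟨|f x|, abs_pos.2 (h x hx), fun θ hθ => hmin hθ⟩

/-- On a closed interval of angles free of singular lines both sines are bounded below. The weight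
`e^(lam ρ)` is moved from `g` to `f`: after this `f` is integrable along lines, while `g e^(-lam ρ)`
is only bounded, which is all that the correlation requires. -/
theorem KernelPair.exists_stripPair (H : KernelPair b q s b' q' s' lam) {α β : ℝ}
    (h1 : ∀ θ ∈ Icc α β, Real.sin (θ / 2) ≠ 0)
    (h2 : ∀ θ ∈ Icc α β, Real.sin ((θ - w.im) / 2) ≠ 0) :
    ∃ K m, StripPair (stripKernel b q s w) (stripKernel b' q' s' (conj w)) α β lam K m := by
  obtain ⟨c₁, hc₁, k1⟩ := exists_pos_le_of_ne_zero (by fun_prop) h1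
  obtain ⟨c₂, hc₂, k2⟩ := exists_pos_le_of_ne_zero (by fun_prop) h2
  have hc := lt_min hc₁ hc₂
  obtain ⟨C, hC, hf⟩ := norm_stripKernel_le_smoothMaj b q s w hc (max |α| |β|)
  obtain ⟨D, hD, hg⟩ := norm_stripKernel_le_smoothMaj b' q' s' (conj w) hc (max |α| |β|)
  have hneg1 (θ : ℝ) : Real.sin (-θ / 2) = -Real.sin (θ / 2) := by
    rw [neg_div, Real.sin_neg]
  have hneg2 (θ : ℝ) : Real.sin ((-θ - (conj w).im) / 2) = -Real.sin ((θ - w.im) / 2) := by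
    rw [← Real.sin_neg, Complex.conj_im]; ring_nf
  have hint : Integrable (smoothMaj (b.re + lam) (q.re + s.re)) :=
    integrable_smoothMaj H.hb (by linarith [H.hsum])
  have hlim := tendsto_smoothMaj H.hb (x := q.re + s.re) (by linarith [H.hsum])
  refine ⟨D * (1 + 2 ^ (q'.re + s'.re)), fun ρ => C * smoothMaj (b.re + lam) (q.re + s.re) ρ,
    ?_, ?_, H.pos, hint.const_mul C, by simpa using hlim.1.const_mul C,
    by simpa using hlim.2.const_mul C, ?_, ?_⟩
  · intro z hz1 hz2
    exact differentiableAt_stripKernel (h1 _ ⟨hz1.le, hz2.le⟩) (h2 _ ⟨hz1.le, hz2.le⟩)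
  · intro z hz1 hz2
    have hm : -z.im ∈ Icc α β := ⟨by linarith, by linarith⟩
    have e1 := h1 _ hm
    have e2 := h2 _ hm
    rw [hneg1, neg_ne_zero] at e1
    have e3 := hneg2 (-z.im)
    rw [neg_neg] at e3
    exact differentiableAt_stripKernel e1 (by rw [e3]; exact neg_ne_zero.2 e2)
  · intro ρ θ h3 h4
    have hm : θ ∈ Icc α β := ⟨h3.le, h4.le⟩
    refine (hf ρ θ (abs_le_max_abs_abs hm.1 hm.2) ((min_le_left _ _).trans (k1 θ hm))
      ((min_le_right _ _).trans (k2 θ hm))).trans_eq ?_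
    rw [← exp_mul_smoothMaj, mul_assoc, mul_assoc, ← Real.exp_add]
    simp
  · intro ρ θ h3 h4
    have hm : -θ ∈ Icc α β := ⟨by linarith, by linarith⟩
    have e1 := (min_le_left c₁ c₂).trans (k1 _ hm)
    have e2 := (min_le_right c₁ c₂).trans (k2 _ hm)
    have e3 := hneg2 (-θ)
    rw [neg_neg] at e3
    rw [hneg1, abs_neg] at e1
    rw [← abs_neg, ← e3] at e2
    refine (hg ρ θ (by rw [← abs_neg]; exact abs_le_max_abs_abs hm.1 hm.2) e1 e2).trans ?_
    have h5 : smoothMaj b'.re (q'.re + s'.re) ρ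
        = smoothMaj (b'.re - lam) (q'.re + s'.re) ρ * Real.exp (lam * ρ) := by
      rw [exp_mul_smoothMaj, sub_add_cancel]
    rw [h5, ← mul_assoc]
    gcongr
    exact smoothMaj_bounded (by linarith [H.hb']) (by linarith [H.hsum']) ρ

/-- Translation by `w` moves the second branch point to the origin of the logarithmic plane and
exchanges the exponents `q` and `s`. The line `Im u = Im w` can then be treated as the line `Im u =
0`. -/
theorem stripKernel_add (b q s w u : ℂ) :
    stripKernel b q s w (u + w) = Complex.exp (b * w) * stripKernel b s q (-w) u := by
  simp only [stripKernel, mul_add, Complex.exp_add, sub_neg_eq_add, add_sub_cancel_right]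
  ring

theorem stripKernel_add_two_pi (b q s w u : ℂ) :
    stripKernel b q s w (u + 2 * Real.pi * Complex.I)
      = Complex.exp (b * (2 * Real.pi * Complex.I)) * stripKernel b q s w u := by
  simp only [stripKernel]
  rw [Complex.exp_periodic u, show u + 2 * Real.pi * Complex.I - w
    = u - w + 2 * Real.pi * Complex.I by ring, Complex.exp_periodic (u - w), mul_add,
    Complex.exp_add]
  ring

theorem setIntegral_Iio_add (g : ℝ → ℂ) (x y : ℝ) :
    ∫ σ in Iio (y + x), g σ = ∫ σ in Iio y, g (σ + x) := by
  rw [← integral_indicator measurableSet_Iio, ← integral_indicator measurableSet_Iio,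
    ← integral_add_right_eq_self _ x]
  congr 1
  funext σ
  simp only [indicator, mem_Iio, add_lt_add_iff_right]

theorem stripPairing_shift {f g f' g' : ℂ → ℂ} {w κ κ' : ℂ} (hf : ∀ u, f (u + w) = κ * f' u)
    (hg : ∀ u, g (u + conj w) = κ' * g' u) (θ : ℝ) :
    stripPairing f g θ = κ * κ' * stripPairing f' g' (θ - w.im) := by
  rw [stripPairing, stripPairing, ← integral_add_right_eq_self _ w.re, ← integral_const_mul]
  congr 1
  funext ρ
  rw [setIntegral_Iio_add]
  have e1 : ((ρ + w.re : ℝ) : ℂ) + θ * Complex.I = ρ + (θ - w.im : ℝ) * Complex.I + w := by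
    apply Complex.ext <;> simp
  have e2 (σ : ℝ) : ((σ + w.re : ℝ) : ℂ) - θ * Complex.I
      = σ - (θ - w.im : ℝ) * Complex.I + conj w := by
    apply Complex.ext <;> simp
    ring
  simp_rw [e1, e2, hf, hg]
  rw [integral_const_mul]
  ring

/-- The integral of `J` is continuous up to the ends because `J` is integrable there, whereas `P`
need only have one-sided limits; comparing both from a midpoint gives the formula on the closed
interval. -/
theorem intervalIntegral_eq_of_limits {J P : ℝ → ℂ} {a b : ℝ} {κ L₁ L₂ : ℂ} (hab : a < b)
    (hJ : IntervalIntegrable J volume a b)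
    (h : ∀ θ₁ θ₂, a < θ₁ → θ₁ ≤ θ₂ → θ₂ < b → ∫ θ in θ₁..θ₂, J θ = κ * (P θ₂ - P θ₁))
    (h1 : Tendsto P (𝓝[>] a) (𝓝 L₁)) (h2 : Tendsto P (𝓝[<] b) (𝓝 L₂)) :
    ∫ θ in a..b, J θ = κ * (L₂ - L₁) := by
  set c := (a + b) / 2
  have hac : a < c := by simp only [c]; linarith
  have hcb : c < b := by simp only [c]; linarith
  have hc : c ∈ uIcc a b := by rw [uIcc_of_le hab.le]; exact ⟨hac.le, hcb.le⟩
  have hcont := intervalIntegral.continuousOn_primitive_interval' hJ hc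
  rw [uIcc_of_le hab.le] at hcont
  have e1 : ∫ θ in c..b, J θ = κ * (L₂ - P c) := by
    have h3 := (hcont b ⟨hab.le, le_rfl⟩).mono Ioo_subset_Icc_self
    rw [ContinuousWithinAt, nhdsWithin_Ioo_eq_nhdsLT hab] at h3
    refine tendsto_nhds_unique (h3.congr' ?_) ((h2.sub_const (P c)).const_mul κ)
    filter_upwards [Ioo_mem_nhdsLT hcb] with x hx using h c x hac hx.1.le hx.2
  have e2 : ∫ θ in c..a, J θ = κ * (L₁ - P c) := by
    have h3 := (hcont a ⟨le_rfl, hab.le⟩).mono Ioo_subset_Icc_self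
    rw [ContinuousWithinAt, nhdsWithin_Ioo_eq_nhdsGT hab] at h3
    refine tendsto_nhds_unique (h3.congr' ?_) ((h1.sub_const (P c)).const_mul κ)
    filter_upwards [Ioo_mem_nhdsGT hac] with x hx
    rw [intervalIntegral.integral_symm, h x c hx.1 hx.2.le hcb]
    ring
  rw [← intervalIntegral.integral_add_adjacent_intervals (b := c)
    (hJ.mono_set (uIcc_subset_uIcc left_mem_uIcc hc))
    (hJ.mono_set (uIcc_subset_uIcc hc right_mem_uIcc)), intervalIntegral.integral_symm, e1, e2]
  ring

theorem sin_half_ne_zero {x : ℝ} (h1 : -(2 * Real.pi) < x) (h2 : x < 2 * Real.pi) (h0 : x ≠ 0) :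
    Real.sin (x / 2) ≠ 0 := by
  rw [Ne, Real.sin_eq_zero_iff_of_lt_of_lt (by linarith) (by linarith)]
  intro h
  exact h0 (by linarith)

theorem tendsto_sub_nhdsLT (x : ℝ) : Tendsto (fun θ : ℝ => θ - x) (𝓝[<] x) (𝓝[<] 0) := by
  refine tendsto_nhdsWithin_iff.2 ⟨?_, ?_⟩
  · have : Tendsto (fun θ : ℝ => θ - x) (𝓝 x) (𝓝 (x - x)) :=
      Continuous.tendsto (by fun_prop) x
    rw [sub_self] at this
    exact this.mono_left nhdsWithin_le_nhds
  · filter_upwards [self_mem_nhdsWithin] with θ hθ using sub_neg.2 (mem_Iio.1 hθ)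

theorem tendsto_sub_nhdsGT (x : ℝ) : Tendsto (fun θ : ℝ => θ - x) (𝓝[>] x) (𝓝[>] 0) := by
  refine tendsto_nhdsWithin_iff.2 ⟨?_, ?_⟩
  · have : Tendsto (fun θ : ℝ => θ - x) (𝓝 x) (𝓝 (x - x)) :=
      Continuous.tendsto (by fun_prop) x
    rw [sub_self] at this
    exact this.mono_left nhdsWithin_le_nhds
  · filter_upwards [self_mem_nhdsWithin] with θ hθ using sub_pos.2 (mem_Ioi.1 hθ)

/-- The integral over the plane in logarithmic polar coordinates, as a sum of products of line
integrals over the two cuts. -/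
theorem KernelPair.integral_eq (H : KernelPair b q s b' q' s' lam) (hw0 : 0 < w.im)
    (hw1 : w.im < 2 * Real.pi) {k m n : ℤ} (hk : b' = b + k) (hm : q' = q + m) (hn : s' = s + n)
    (hint : IntervalIntegrable (fun θ : ℝ => ∫ ρ : ℝ, stripKernel b q s w (ρ + θ * Complex.I)
      * stripKernel b' q' s' (conj w) (ρ - θ * Complex.I)) volume 0 (2 * Real.pi)) :
    ∫ θ in (0 : ℝ)..(2 * Real.pi), (∫ ρ : ℝ, stripKernel b q s w (ρ + θ * Complex.I)
      * stripKernel b' q' s' (conj w) (ρ - θ * Complex.I))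
    = -(Complex.sin (Real.pi * q) * innerInt b' q' s' (conj w) * outerInt b q s w)
      - Complex.exp (b * w) * Complex.exp (b' * conj w) * Complex.sin (Real.pi * s)
        * innerInt b' s' q' (-conj w) * outerInt b s q (-w) := by
  have hpi := Real.pi_pos
  have hw : Real.sin (w.im / 2) ≠ 0 := sin_half_ne_zero (by linarith) hw1 hw0.ne'
  have hcw : Real.sin ((conj w).im / 2) ≠ 0 := by
    rw [Complex.conj_im, neg_div, Real.sin_neg, neg_ne_zero]; exact hw
  obtain ⟨P₁, P₂, hP₁, hP₂, hP⟩ := H.exists_boundary_limits hw hcw hm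
  obtain ⟨Q₁, Q₂, hQ₁, hQ₂, hQ⟩ := H.swap.exists_boundary_limits (w := -w) (w' := -conj w)
    (by rw [Complex.neg_im, neg_div, Real.sin_neg, neg_ne_zero]; exact hw)
    (by rw [Complex.neg_im, neg_div, Real.sin_neg, neg_ne_zero]; exact hcw) hn
  have hshift := stripPairing_shift (stripKernel_add b q s w) (stripKernel_add b' q' s' (conj w))
  -- A full turn multiplies `f` by `e^(2πib)` and, since `g` is evaluated at the conjugate point,
  -- `g` by `e^(-2πib')`. The product is `1` because `b' - b` is an integer.
  have hperiod (θ : ℝ) : stripPairing (stripKernel b q s w) (stripKernel b' q' s' (conj w)) θ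
      = stripPairing (stripKernel b q s w) (stripKernel b' q' s' (conj w)) (θ - 2 * Real.pi) := by
    rw [stripPairing_shift (w := 2 * Real.pi * Complex.I)
      (g' := stripKernel b' q' s' (conj w)) (κ' := Complex.exp (-b' * (2 * Real.pi * Complex.I))) (stripKernel_add_two_pi b q s w)
      (fun u => ?_) θ, ← Complex.exp_add]
    · have : b * (2 * Real.pi * Complex.I) + -(b + k) * (2 * Real.pi * Complex.I)
          = (-k : ℤ) * (2 * Real.pi * Complex.I) := by push_cast; ring
      rw [show -b' * (2 * Real.pi * Complex.I) = -(b + k) * (2 * Real.pi * Complex.I) by rw [hk],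
        this, Complex.exp_int_mul_two_pi_mul_I, one_mul]
      congr 1
      simp
    · have := stripKernel_add_two_pi b' q' s' (conj w) (u - 2 * Real.pi * Complex.I)
      rw [sub_add_cancel] at this
      rw [this, ← mul_assoc, ← Complex.exp_add]
      simp [sub_eq_add_neg, Complex.conj_ofNat]
  have hwmem : w.im ∈ uIcc 0 (2 * Real.pi) := by
    rw [uIcc_of_le (by linarith)]; exact ⟨hw0.le, hw1.le⟩
  have hi1 := hint.mono_set (uIcc_subset_uIcc left_mem_uIcc hwmem)
  have hi2 := hint.mono_set (uIcc_subset_uIcc hwmem right_mem_uIcc)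
  -- Split at `Im w`. The limits of `P` are `P₁` at `0+`, multiples of `Q₂` and `Q₁` at the left and
  -- right of `Im w`, and by periodicity `P₂` at `2π-`; the four terms regroup into the two jumps.
  rw [← intervalIntegral.integral_add_adjacent_intervals hi1 hi2,
    intervalIntegral_eq_of_limits (κ := Complex.I / 2) (L₁ := P₁)
      (L₂ := Complex.exp (b * w) * Complex.exp (b' * conj w) * Q₂)
      (P := stripPairing (stripKernel b q s w) (stripKernel b' q' s' (conj w))) hw0 hi1 ?_ hP₁ ?_,
    intervalIntegral_eq_of_limits (κ := Complex.I / 2) (L₂ := P₂)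
      (L₁ := Complex.exp (b * w) * Complex.exp (b' * conj w) * Q₁)
      (P := stripPairing (stripKernel b q s w) (stripKernel b' q' s' (conj w))) hw1 hi2 ?_ ?_ ?_]
  · have hI := Complex.I_mul_I
    linear_combination (Complex.I / 2) * hP
      + (Complex.I / 2) * Complex.exp (b * w) * Complex.exp (b' * conj w) * (-1) * hQ * (-1)
      + (Complex.sin (Real.pi * q) * innerInt b' q' s' (conj w) * outerInt b q s w) * hI
      + (Complex.exp (b * w) * Complex.exp (b' * conj w) * Complex.sin (Real.pi * s)
        * innerInt b' s' q' (-conj w) * outerInt b s q (-w)) * hI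
  · intro θ₁ θ₂ h1 h12 h2
    -- The closed interval of angles has to contain `[θ₁, θ₂]` in its interior and still avoid the
    -- singular lines; its ends are midpoints between `θ₁`, `θ₂` and these lines.
    obtain ⟨K, m, HS⟩ := H.exists_stripPair (w := w) (α := (w.im + θ₁) / 2)
      (β := (θ₂ + 2 * Real.pi) / 2)
      (fun θ hθ => sin_half_ne_zero (by linarith [hθ.1]) (by linarith [hθ.2])
        (by linarith [hθ.1] : 0 < θ).ne')
      (fun θ hθ => sin_half_ne_zero (by linarith [hθ.1]) (by linarith [hθ.2])
        (by linarith [hθ.1] : 0 < θ - w.im).ne')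
    exact HS.integral_eq (by linarith) h12 (by linarith)
  · refine ((hQ₁.comp (tendsto_sub_nhdsGT w.im)).const_mul
      (Complex.exp (b * w) * Complex.exp (b' * conj w))).congr fun θ => ?_
    rw [hshift]; rfl
  · exact (hP₂.comp (tendsto_sub_nhdsLT (2 * Real.pi))).congr fun θ => (hperiod θ).symm
  · intro θ₁ θ₂ h1 h12 h2
    obtain ⟨K, m, HS⟩ := H.exists_stripPair (w := w) (α := θ₁ / 2)
      (β := (θ₂ + w.im) / 2)
      (fun θ hθ => sin_half_ne_zero (by linarith [hθ.1]) (by linarith [hθ.2])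
        (by linarith [hθ.1] : 0 < θ).ne')
      (fun θ hθ => sin_half_ne_zero (by linarith [hθ.1]) (by linarith [hθ.2])
        (by linarith [hθ.2] : θ - w.im < 0).ne)
    exact HS.integral_eq (by linarith) h12 (by linarith)
  · refine ((hQ₂.comp (tendsto_sub_nhdsLT w.im)).const_mul
      (Complex.exp (b * w) * Complex.exp (b' * conj w))).congr fun θ => ?_
    rw [hshift]; rfl

end Jump

/-! ### Linear relations between the ray integrals -/

section LineRelations

variable {b q s w : ℂ}

theorem ae_ne_zero : ∀ᵐ ρ : ℝ, ρ ≠ 0 := compl_mem_ae_iff.2 (measure_singleton (0 : ℝ))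

theorem integrable_realKernel (hb : 0 < b.re) (hq : -1 < q.re) (hsum : b.re + q.re + s.re < 0)
    (hw : Real.sin (w.im / 2) ≠ 0) : Integrable (realKernel b q s w) := by
  obtain ⟨C, -, hC⟩ := norm_realKernel_le b q s hw
  exact ((integrable_singMaj hb hq hsum).const_mul C).mono'
    (measurable_realKernel b q s w).aestronglyMeasurable
    (ae_ne_zero.mono hC)

theorem integral_phaseJump_mul {F : ℝ → ℂ} (hF : Integrable F) (ω : ℂ) :
    ∫ ρ : ℝ, phaseJump ω ρ * F ρ = (∫ ρ in Iio 0, F ρ) + ω * ∫ ρ in Ioi 0, F ρ := by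
  have hi : Integrable fun ρ : ℝ => phaseJump ω ρ * F ρ :=
    hF.bdd_mul (c := 1 + ‖ω‖) (measurable_phaseJump ω).aestronglyMeasurable
      (ae_of_all _ (norm_phaseJump_le ω))
  rw [← integral_add_compl measurableSet_Iio hi (s := Iio 0), compl_Iio,
    integral_Ici_eq_integral_Ioi, ← integral_const_mul]
  congr 1
  · refine setIntegral_congr_fun measurableSet_Iio fun σ hσ => ?_
    simp only [phaseJump, if_pos (mem_Iio.1 hσ), one_mul]
  · refine setIntegral_congr_fun measurableSet_Ioi fun σ hσ => ?_
    simp only [phaseJump, if_neg (mem_Ioi.1 hσ).le.not_gt]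

theorem tendsto_integral_stripKernel_aux (hb : 0 < b.re) (hq : -1 < q.re)
    (hsum : b.re + q.re + s.re < 0) (hw : Real.sin (w.im / 2) ≠ 0) {l : Filter ℝ}
    [l.IsCountablyGenerated] (hl : l ≤ 𝓝 0) (hl0 : ∀ᶠ θ in l, θ ≠ 0) {ω : ℂ}
    (hf : ∀ ρ : ℝ, ρ ≠ 0 → Tendsto (fun θ : ℝ => stripKernel b q s w (ρ + θ * Complex.I)) l
      (𝓝 (phaseJump ω ρ * realKernel b q s w ρ))) :
    Tendsto (fun θ : ℝ => ∫ ρ : ℝ, stripKernel b q s w (ρ + θ * Complex.I)) l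
      (𝓝 (innerInt b q s w + ω * outerInt b q s w)) := by
  obtain ⟨C, -, h1, h2⟩ := stripKernel_eventually b q s hw
  have hae := ae_ne_zero
  rw [innerInt, outerInt, ← integral_phaseJump_mul (integrable_realKernel hb hq hsum hw)]
  refine tendsto_integral_filter_of_dominated_convergence
    (fun ρ => C * singMaj b.re q.re s.re ρ) ?_ ?_
    ((integrable_singMaj hb hq hsum).const_mul C) (hae.mono hf)
  · filter_upwards [hl h2, hl0] with θ h h0 using (h h0).aestronglyMeasurable
  · filter_upwards [hl h1] with θ h using hae.mono h

theorem tendsto_integral_stripKernel_right (hb : 0 < b.re) (hq : -1 < q.re)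
    (hsum : b.re + q.re + s.re < 0) (hw : Real.sin (w.im / 2) ≠ 0) :
    Tendsto (fun θ : ℝ => ∫ ρ : ℝ, stripKernel b q s w (ρ + θ * Complex.I)) (𝓝[>] 0)
      (𝓝 (innerInt b q s w + Complex.exp (-Real.pi * Complex.I * q) * outerInt b q s w)) := by
  refine tendsto_integral_stripKernel_aux hb hq hsum hw nhdsWithin_le_nhds ?_
    fun ρ hρ => tendsto_stripKernel_right hw hρ
  filter_upwards [self_mem_nhdsWithin] with θ hθ using (ne_of_gt hθ)

theorem tendsto_integral_stripKernel_left (hb : 0 < b.re) (hq : -1 < q.re)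
    (hsum : b.re + q.re + s.re < 0) (hw : Real.sin (w.im / 2) ≠ 0) :
    Tendsto (fun θ : ℝ => ∫ ρ : ℝ, stripKernel b q s w (ρ + θ * Complex.I)) (𝓝[<] 0)
      (𝓝 (innerInt b q s w + Complex.exp (Real.pi * Complex.I * q) * outerInt b q s w)) := by
  refine tendsto_integral_stripKernel_aux hb hq hsum hw nhdsWithin_le_nhds ?_
    fun ρ hρ => tendsto_stripKernel_left hw hρ
  filter_upwards [self_mem_nhdsWithin] with θ hθ using (ne_of_lt hθ)

theorem integral_stripKernel_eq (hb : 0 < b.re) (hsum : b.re + q.re + s.re < 0) {θ₁ θ₂ : ℝ}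
    (h12 : θ₁ ≤ θ₂) (h1 : ∀ θ ∈ Icc θ₁ θ₂, Real.sin (θ / 2) ≠ 0)
    (h2 : ∀ θ ∈ Icc θ₁ θ₂, Real.sin ((θ - w.im) / 2) ≠ 0) :
    ∫ ρ : ℝ, stripKernel b q s w (ρ + θ₁ * Complex.I)
      = ∫ ρ : ℝ, stripKernel b q s w (ρ + θ₂ * Complex.I) := by
  obtain ⟨c₁, hc₁, k1⟩ := exists_pos_le_of_ne_zero (by fun_prop) h1
  obtain ⟨c₂, hc₂, k2⟩ := exists_pos_le_of_ne_zero (by fun_prop) h2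
  have hc := lt_min hc₁ hc₂
  obtain ⟨C, hC, hf⟩ := norm_stripKernel_le_smoothMaj b q s w hc (max |θ₁| |θ₂|)
  have hlim := tendsto_smoothMaj hb (x := q.re + s.re) (by linarith)
  refine integral_horizontal_eq (m := fun ρ => C * smoothMaj b.re (q.re + s.re) ρ) h12
    (fun z hz1 hz2 => differentiableAt_stripKernel (h1 _ ⟨hz1, hz2⟩) (h2 _ ⟨hz1, hz2⟩))
    ((integrable_smoothMaj hb (x := q.re + s.re) (by linarith)).const_mul C)
    (by simpa using hlim.1.const_mul C) (by simpa using hlim.2.const_mul C) ?_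
  intro ρ θ h3 h4
  have hm : θ ∈ Icc θ₁ θ₂ := ⟨h3, h4⟩
  exact hf ρ θ (abs_le_max_abs_abs hm.1 hm.2) ((min_le_left _ _).trans (k1 θ hm))
      ((min_le_right _ _).trans (k2 θ hm))

theorem eq_of_limits {J : ℝ → ℂ} {a b : ℝ} {L₁ L₂ : ℂ} (hab : a < b)
    (h : ∀ θ₁ θ₂, a < θ₁ → θ₁ ≤ θ₂ → θ₂ < b → J θ₁ = J θ₂)
    (h1 : Tendsto J (𝓝[>] a) (𝓝 L₁)) (h2 : Tendsto J (𝓝[<] b) (𝓝 L₂)) : L₁ = L₂ := by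
  obtain ⟨c, hac, hcb⟩ := exists_between hab
  have e1 : L₁ = J c := tendsto_nhds_unique (h1.congr' (by
    filter_upwards [Ioo_mem_nhdsGT hac] with x hx using h x c hx.1 hx.2.le hcb)) tendsto_const_nhds
  have e2 : L₂ = J c := tendsto_nhds_unique (h2.congr' (by
    filter_upwards [Ioo_mem_nhdsLT hcb] with x hx using (h c x hac hx.1.le hx.2).symm))
    tendsto_const_nhds
  rw [e1, e2]

theorem integral_stripKernel_shift (b q s w : ℂ) (θ : ℝ) :
    ∫ ρ : ℝ, stripKernel b q s w (ρ + θ * Complex.I)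
      = Complex.exp (b * w) * ∫ ρ : ℝ, stripKernel b s q (-w) (ρ + (θ - w.im : ℝ) * Complex.I) := by
  rw [← integral_add_right_eq_self _ w.re, ← integral_const_mul]
  congr 1
  funext ρ
  rw [← stripKernel_add]
  congr 1
  apply Complex.ext <;> simp

theorem integral_stripKernel_period (b q s w : ℂ) (θ : ℝ) :
    ∫ ρ : ℝ, stripKernel b q s w (ρ + θ * Complex.I)
      = Complex.exp (b * (2 * Real.pi * Complex.I))
        * ∫ ρ : ℝ, stripKernel b q s w (ρ + (θ - 2 * Real.pi : ℝ) * Complex.I) := by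
  rw [← integral_const_mul]
  congr 1
  funext ρ
  rw [← stripKernel_add_two_pi]
  congr 1
  push_cast
  ring

/-- The two relations between the four integrals along the two rays. -/
theorem ray_relations (hb : 0 < b.re) (hq : -1 < q.re) (hs : -1 < s.re)
    (hsum : b.re + q.re + s.re < 0) (hw0 : 0 < w.im) (hw1 : w.im < 2 * Real.pi) :
    innerInt b q s w + Complex.exp (-Real.pi * Complex.I * q) * outerInt b q s w
      = Complex.exp (b * w) * (innerInt b s q (-w)
        + Complex.exp (Real.pi * Complex.I * s) * outerInt b s q (-w)) ∧
    Complex.exp (b * w) * (innerInt b s q (-w)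
        + Complex.exp (-Real.pi * Complex.I * s) * outerInt b s q (-w))
      = Complex.exp (b * (2 * Real.pi * Complex.I)) * (innerInt b q s w
        + Complex.exp (Real.pi * Complex.I * q) * outerInt b q s w) := by
  have hpi := Real.pi_pos
  have hw : Real.sin (w.im / 2) ≠ 0 := sin_half_ne_zero (by linarith) hw1 hw0.ne'
  have hnw : Real.sin ((-w).im / 2) ≠ 0 := by
    rw [Complex.neg_im, neg_div, Real.sin_neg, neg_ne_zero]; exact hw
  have hsum' : b.re + s.re + q.re < 0 := by linarith
  constructor
  -- For `0 < θ < Im w` the line integral does not depend on `θ`. Its limits at the two ends are the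
  -- two sides, the phase of the outer part being `e^(-πiq)` at `0+` and `e^(πis)` at `(Im w)-`.
  · refine eq_of_limits hw0 (fun θ₁ θ₂ h1 h12 h2 => integral_stripKernel_eq hb hsum h12 ?_ ?_)
      (tendsto_integral_stripKernel_right hb hq hsum hw)
      ((((tendsto_integral_stripKernel_left hb hs hsum' hnw).comp
        (tendsto_sub_nhdsLT w.im)).const_mul (Complex.exp (b * w))).congr fun θ =>
        (integral_stripKernel_shift b q s w θ).symm)
    · exact fun θ hθ => sin_half_ne_zero (by linarith [hθ.1]) (by linarith [hθ.2])
        (by linarith [hθ.1] : 0 < θ).ne'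
    · exact fun θ hθ => sin_half_ne_zero (by linarith [hθ.1]) (by linarith [hθ.2])
        (by linarith [hθ.2] : θ - w.im < 0).ne
  -- The same for `Im w < θ < 2π`. The upper end is carried back to `0-` by the monodromy factor
  -- `e^(2πib)`.
  · refine eq_of_limits hw1 (fun θ₁ θ₂ h1 h12 h2 => integral_stripKernel_eq hb hsum h12 ?_ ?_)
      ((((tendsto_integral_stripKernel_right hb hs hsum' hnw).comp
        (tendsto_sub_nhdsGT w.im)).const_mul (Complex.exp (b * w))).congr fun θ =>
        (integral_stripKernel_shift b q s w θ).symm)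
      ((((tendsto_integral_stripKernel_left hb hq hsum hw).comp
        (tendsto_sub_nhdsLT (2 * Real.pi))).const_mul _).congr fun θ =>
        (integral_stripKernel_period b q s w θ).symm)
    · exact fun θ hθ => sin_half_ne_zero (by linarith [hθ.1]) (by linarith [hθ.2])
        (by linarith [hθ.1] : 0 < θ).ne'
    · exact fun θ hθ => sin_half_ne_zero (by linarith [hθ.1]) (by linarith [hθ.2])
        (by linarith [hθ.1] : 0 < θ - w.im).ne'

end LineRelations

/-! ### Ray integrals as Euler integrals -/

section EulerForm

theorem exp_image_Iio : Real.exp '' Iio 0 = Ioo 0 1 := by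
  ext t
  constructor
  · rintro ⟨ρ, hρ, rfl⟩
    exact ⟨Real.exp_pos _, Real.exp_lt_one_iff.2 hρ⟩
  · rintro ⟨h0, h1⟩
    exact ⟨Real.log t, Real.log_neg h0 h1, Real.exp_log h0⟩

theorem integral_Ioo_eq_integral_exp (g : ℝ → ℂ) :
    ∫ t in Ioo (0 : ℝ) 1, g t = ∫ ρ in Iio (0 : ℝ), (Real.exp ρ : ℂ) * g (Real.exp ρ) := by
  rw [← exp_image_Iio, integral_image_eq_integral_abs_deriv_smul measurableSet_Iio
    (fun ρ _ => (Real.hasDerivAt_exp ρ).hasDerivWithinAt) Real.exp_injective.injOn]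
  refine setIntegral_congr_fun measurableSet_Iio fun ρ _ => ?_
  simp only [abs_of_pos (Real.exp_pos ρ), Complex.real_smul]

theorem ofReal_exp_cpow (ρ : ℝ) (b : ℂ) : ((Real.exp ρ : ℝ) : ℂ) ^ b = Complex.exp (b * ρ) := by
  rw [Complex.cpow_def_of_ne_zero (by exact_mod_cast (Real.exp_pos ρ).ne'), ← Complex.ofReal_log
    (Real.exp_pos ρ).le, Real.log_exp, mul_comm]

theorem innerInt_eq (b q s w : ℂ) :
    innerInt b q s w = eulerIntegral (-s) b (b + q + 1) (Complex.exp (-w)) := by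
  rw [innerInt, eulerIntegral, integral_Ioo_eq_integral_exp]
  refine setIntegral_congr_fun measurableSet_Iio fun ρ hρ => ?_
  have h1 : 0 < 1 - Real.exp ρ := sub_pos.2 (Real.exp_lt_one_iff.2 hρ)
  simp only [realKernel]
  rw [ofReal_exp_cpow, abs_of_pos h1, show b + q + 1 - b - 1 = q by ring, neg_neg,
    show (ρ - w : ℂ) = -w + ρ by ring, Complex.exp_add, sub_mul, Complex.exp_sub, one_mul]
  have h2 : Complex.exp ρ ≠ 0 := Complex.exp_ne_zero _
  push_cast
  field_simp

/-- This is `1 - e^(w-ρ) = -e^(w-ρ) (1 - e^(ρ-w))` on principal branches. The logarithm of `-1` must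
be `-πi`: with this choice the imaginary part is `Im w - π + arg(1 - e^(ρ-w))`, which lies in `(-π,
π]` since the argument is nonnegative for `Im w ≤ π` and negative beyond. -/
theorem one_sub_exp_cpow_inv {w : ℂ} (hw0 : 0 < w.im) (hw1 : w.im < 2 * Real.pi) (ρ : ℝ) (q : ℂ) :
    (1 - Complex.exp (w - ρ)) ^ q
      = Complex.exp (q * (w - Real.pi * Complex.I - ρ)) * (1 - Complex.exp (ρ - w)) ^ q := by
  have hpi := Real.pi_pos
  have hw : Real.sin (w.im / 2) ≠ 0 := sin_half_ne_zero (by linarith) hw1 hw0.ne'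
  have hn1 : 1 - Complex.exp (w - ρ) ≠ 0 :=
    Complex.slitPlane_ne_zero (one_sub_exp_mem_slitPlane (by simpa using hw))
  have hn2 : 1 - Complex.exp (ρ - w) ≠ 0 :=
    Complex.slitPlane_ne_zero (one_sub_exp_mem_slitPlane (by simpa [neg_div] using hw))
  have key : Complex.log (1 - Complex.exp (w - ρ))
      = w - Real.pi * Complex.I - ρ + Complex.log (1 - Complex.exp (ρ - w)) := by
    have him : (1 - Complex.exp (ρ - w)).im = Real.exp (ρ - w.re) * Real.sin w.im := by
      simp [Complex.exp_im]
    have hlim : (w - Real.pi * Complex.I - ρ + Complex.log (1 - Complex.exp (ρ - w))).im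
        = w.im - Real.pi + (1 - Complex.exp (ρ - w)).arg := by
      simp [Complex.log_im]
    have hE : Complex.exp (w - Real.pi * Complex.I - ρ + Complex.log (1 - Complex.exp (ρ - w)))
        = 1 - Complex.exp (w - ρ) := by
      rw [Complex.exp_add, Complex.exp_log hn2, mul_sub, ← Complex.exp_add,
        show w - Real.pi * Complex.I - ρ = (w - ρ) - Real.pi * Complex.I by ring,
        Complex.exp_sub, Complex.exp_pi_mul_I,
        show (w - ρ - Real.pi * Complex.I + (ρ - w)) = -(Real.pi * Complex.I) by ring,
        Complex.exp_neg, Complex.exp_pi_mul_I]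
      ring
    rw [← hE, Complex.log_exp]
    · rw [hlim]
      rcases le_or_gt w.im Real.pi with h | h
      · have : 0 ≤ (1 - Complex.exp (ρ - w)).arg := by
          rw [Complex.arg_nonneg_iff, him]
          exact mul_nonneg (Real.exp_pos _).le (Real.sin_nonneg_of_nonneg_of_le_pi hw0.le h)
        linarith
      · linarith [Complex.neg_pi_lt_arg (1 - Complex.exp (ρ - w))]
    · rw [hlim]
      rcases le_or_gt w.im Real.pi with h | h
      · linarith [Complex.arg_le_pi (1 - Complex.exp (ρ - w))]
      · have : (1 - Complex.exp (ρ - w)).arg < 0 := by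
          rw [Complex.arg_neg_iff, him]
          refine mul_neg_of_pos_of_neg (Real.exp_pos _) ?_
          have := Real.sin_pos_of_pos_of_lt_pi (x := w.im - Real.pi) (by linarith) (by linarith)
          rw [Real.sin_sub_pi] at this
          linarith
        linarith
  rw [Complex.cpow_def_of_ne_zero hn1, Complex.cpow_def_of_ne_zero hn2, key, ← Complex.exp_add]
  ring_nf

/-- The reflection `ρ ↦ -ρ`, an inversion in `z`, maps the outer ray to the inner one, exchanging
the behaviour at infinity with that at the origin; hence the new exponent `-b - s - q`. -/
theorem outerInt_neg_eq (b q s : ℂ) {w : ℂ} (hw0 : 0 < w.im) (hw1 : w.im < 2 * Real.pi) :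
    outerInt b s q (-w)
      = Complex.exp (q * (w - Real.pi * Complex.I)) * innerInt (-b - s - q) s q w := by
  rw [outerInt, innerInt, ← integral_const_mul, ← integral_Iic_eq_integral_Iio]
  have hneg := integral_comp_neg_Iic 0 (realKernel b s q (-w))
  rw [neg_zero] at hneg
  rw [← hneg, integral_Iic_eq_integral_Iio, integral_Iic_eq_integral_Iio]
  refine setIntegral_congr_fun measurableSet_Iio fun ρ hρ => ?_
  have h1 : 0 < 1 - Real.exp ρ := sub_pos.2 (Real.exp_lt_one_iff.2 hρ)
  have h2 : |1 - Real.exp (-ρ)| = Real.exp (-ρ) * (1 - Real.exp ρ) := by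
    rw [mul_sub, ← Real.exp_add, neg_add_cancel, Real.exp_zero, mul_one, abs_sub_comm,
      abs_of_nonneg]
    linarith [Real.one_lt_exp_iff.2 (neg_pos.2 hρ)]
  simp only [realKernel]
  rw [h2, abs_of_pos h1, Complex.ofReal_mul, Complex.mul_cpow_ofReal_nonneg (Real.exp_pos _).le
    h1.le, ofReal_exp_cpow, show ((-ρ : ℝ) : ℂ) - -w = w - ρ by push_cast; ring,
    one_sub_exp_cpow_inv hw0 hw1]
  have : Complex.exp (b * (-ρ : ℝ)) * Complex.exp (s * (-ρ : ℝ))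
      * Complex.exp (q * (w - Real.pi * Complex.I - ρ))
      = Complex.exp (q * (w - Real.pi * Complex.I)) * Complex.exp ((-b - s - q) * ρ) := by
    rw [← Complex.exp_add, ← Complex.exp_add, ← Complex.exp_add]
    congr 1
    push_cast
    ring
  linear_combination ((1 - Real.exp ρ : ℝ) : ℂ) ^ s * (1 - Complex.exp (ρ - w)) ^ q * this

theorem innerInt_eq_compH {a b c w : ℂ} (hac : c.re < a.re + 1) (ha : a.re < 1)
    (hw : Complex.exp (-w) ∈ cutPlane) :
    innerInt (1 + a - c) (-a) (c - b - 1) w = compH a b c (Complex.exp (-w)) := by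
  rw [innerInt_eq, compH, show 1 + a - c + -a + 1 = 2 - c by ring,
    show -(c - b - 1) = 1 + b - c by ring, eulerIntegral_eq (by simp; linarith) (by
      simp; linarith) hw, show 2 - c - (1 + a - c) = 1 - a by ring]

theorem exp_neg_mem_cutPlane {w : ℂ} (hw0 : 0 < w.im) (hw1 : w.im < 2 * Real.pi) :
    Complex.exp (-w) ∈ cutPlane := by
  refine one_sub_exp_mem_slitPlane ?_
  rw [Complex.neg_im, neg_div, Real.sin_neg, neg_ne_zero]
  exact sin_half_ne_zero (by linarith [Real.pi_pos]) hw1 hw0.ne'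

theorem exp_mem_cutPlane {w : ℂ} (hw0 : 0 < w.im) (hw1 : w.im < 2 * Real.pi) :
    Complex.exp w ∈ cutPlane :=
  one_sub_exp_mem_slitPlane (sin_half_ne_zero (by linarith [Real.pi_pos]) hw1 hw0.ne')

theorem sin_pi_mul (x : ℂ) : Complex.sin (Real.pi * x)
    = (Complex.exp (-(Real.pi * Complex.I * x)) - Complex.exp (Real.pi * Complex.I * x))
      * Complex.I / 2 := by
  rw [Complex.sin]; ring_nf

theorem exp_neg_mul_exp (x : ℂ) : Complex.exp x * Complex.exp (-x) = 1 := by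
  rw [← Complex.exp_add, add_neg_cancel, Complex.exp_zero]

theorem exp_pi_shift (b c : ℂ) : Complex.exp (Real.pi * Complex.I * c)
    = -(Complex.exp (Real.pi * Complex.I * b)
      * Complex.exp (Real.pi * Complex.I * (c - b - 1))) := by
  rw [← Complex.exp_add, ← mul_neg_one, ← Complex.exp_pi_mul_I, ← Complex.exp_add]; ring_nf

theorem exp_neg_pi_shift (b c : ℂ) : Complex.exp (-(Real.pi * Complex.I * c))
    = -(Complex.exp (-(Real.pi * Complex.I * b))
      * Complex.exp (-Real.pi * Complex.I * (c - b - 1))) := by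
  rw [show -(Real.pi * Complex.I * c) = -(Real.pi * Complex.I * b)
    + -Real.pi * Complex.I * (c - b - 1) - Real.pi * Complex.I by ring, Complex.exp_sub,
    Complex.exp_add, Complex.exp_pi_mul_I, div_neg, div_one]

/-- The outer integral along the real ray in terms of the hypergeometric function and its
companion. -/
theorem outerInt_eq {a b c w : ℂ} (hb : 0 < b.re) (hcb : b.re < c.re) (hac : c.re < a.re + 1)
    (ha : a.re < 1) (hw0 : 0 < w.im) (hw1 : w.im < 2 * Real.pi) :
    Complex.sin (Real.pi * c) * outerInt b (c - b - 1) (-a) w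
      = Complex.sin (Real.pi * b) * eulerIntegral a b c (Complex.exp (-w))
        - Complex.exp ((c - 1) * w - Real.pi * Complex.I * (c - 1)) * Complex.sin (Real.pi * a)
          * compH a b c (Complex.exp (-w)) := by
  obtain ⟨h1, h2⟩ := ray_relations (b := b) (q := c - b - 1) (s := -a) (w := w) hb
    (by simp; linarith) (by simp; linarith) (by simp; linarith) hw0 hw1
  rw [outerInt_neg_eq _ _ _ hw0 hw1, show -b - -a - (c - b - 1) = 1 + a - c by ring,
    innerInt_eq_compH hac ha (exp_neg_mem_cutPlane hw0 hw1),
    innerInt_eq b (c - b - 1) (-a), neg_neg, show b + (c - b - 1) + 1 = c by ring] at h1 h2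
  set A := eulerIntegral a b c (Complex.exp (-w))
  set D := outerInt b (c - b - 1) (-a) w
  set H := compH a b c (Complex.exp (-w))
  set E := innerInt b (-a) (c - b - 1) (-w)
  have e2 : Complex.exp (b * (2 * Real.pi * Complex.I))
      = Complex.exp (Real.pi * Complex.I * b) * Complex.exp (Real.pi * Complex.I * b) := by
    rw [← Complex.exp_add]; ring_nf
  have e3 : Complex.exp ((c - 1) * w - Real.pi * Complex.I * (c - 1))
      = Complex.exp (b * w) * Complex.exp ((c - b - 1) * (w - Real.pi * Complex.I))
        * Complex.exp (-(Real.pi * Complex.I * b)) := by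
    rw [← Complex.exp_add, ← Complex.exp_add]; ring_nf
  have e4 := exp_pi_shift b c
  have e5 := exp_neg_pi_shift b c
  have e6 : Real.pi * Complex.I * -a = -(Real.pi * Complex.I * a) := by ring
  have e7 : -Real.pi * Complex.I * -a = Real.pi * Complex.I * a := by ring
  rw [e2, e7] at h2
  rw [e6] at h1
  rw [sin_pi_mul, sin_pi_mul, sin_pi_mul, e3, e4, e5]
  have hx := exp_neg_mul_exp (Real.pi * Complex.I * b)
  set x := Complex.exp (Real.pi * Complex.I * b)
  set xi := Complex.exp (-(Real.pi * Complex.I * b))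
  set z := Complex.exp (Real.pi * Complex.I * (c - b - 1))
  -- The sum of the two relations eliminates the integral `E` over `(0, 1/y)`.
  linear_combination (-(Complex.I / 2) * xi) * (h1 + h2)
    + (Complex.I / 2) * (x * A + x * z * D) * (-1) * hx

/-- The same two relations, now with the outer integral over `(1, ∞)` eliminated in favour of the
one over `(0, 1/y)`. -/
theorem euler_inv_relation_aux {a b c w : ℂ} (hb : 0 < b.re) (hcb : b.re < c.re)
    (hac : c.re < a.re + 1) (ha : a.re < 1) (hw0 : 0 < w.im) (hw1 : w.im < 2 * Real.pi) :
    Complex.sin (Real.pi * c) * Complex.exp (b * w)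
        * eulerIntegral (1 + b - c) b (b - a + 1) (Complex.exp w)
      = Complex.exp (Real.pi * Complex.I * b) * Complex.sin (Real.pi * (c - b))
          * eulerIntegral a b c (Complex.exp (-w))
        - Complex.sin (Real.pi * (c - a))
          * Complex.exp ((c - 1) * w - Real.pi * Complex.I * (c - b - 1))
          * compH a b c (Complex.exp (-w)) := by
  obtain ⟨h1, h2⟩ := ray_relations (b := b) (q := c - b - 1) (s := -a) (w := w) hb
    (by simp; linarith) (by simp; linarith) (by simp; linarith) hw0 hw1
  rw [outerInt_neg_eq _ _ _ hw0 hw1, show -b - -a - (c - b - 1) = 1 + a - c by ring,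
    innerInt_eq_compH hac ha (exp_neg_mem_cutPlane hw0 hw1),
    innerInt_eq b (c - b - 1) (-a), innerInt_eq b (-a) (c - b - 1), neg_neg, neg_neg,
    show b + (c - b - 1) + 1 = c by ring, show -(c - b - 1) = 1 + b - c by ring,
    show b + -a + 1 = b - a + 1 by ring] at h1 h2
  set A := eulerIntegral a b c (Complex.exp (-w))
  set D := outerInt b (c - b - 1) (-a) w
  set H := compH a b c (Complex.exp (-w))
  set E := eulerIntegral (1 + b - c) b (b - a + 1) (Complex.exp w)
  have e2 : Complex.exp (b * (2 * Real.pi * Complex.I))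
      = Complex.exp (Real.pi * Complex.I * b) * Complex.exp (Real.pi * Complex.I * b) := by
    rw [← Complex.exp_add]; ring_nf
  have e3 : Complex.exp ((c - 1) * w - Real.pi * Complex.I * (c - b - 1))
      = Complex.exp (b * w) * Complex.exp ((c - b - 1) * (w - Real.pi * Complex.I)) := by
    rw [← Complex.exp_add]; ring_nf
  have e4 := exp_pi_shift b c
  have e5 := exp_neg_pi_shift b c
  have e6 : Real.pi * Complex.I * -a = -(Real.pi * Complex.I * a) := by ring
  have e7 : -Real.pi * Complex.I * -a = Real.pi * Complex.I * a := by ring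
  have e8 : Complex.exp (Real.pi * Complex.I * (c - b))
      = -Complex.exp (Real.pi * Complex.I * (c - b - 1)) := by
    rw [← mul_neg_one, ← Complex.exp_pi_mul_I, ← Complex.exp_add]; ring_nf
  have e9 : Complex.exp (-(Real.pi * Complex.I * (c - b)))
      = -Complex.exp (-Real.pi * Complex.I * (c - b - 1)) := by
    rw [show -(Real.pi * Complex.I * (c - b)) = -Real.pi * Complex.I * (c - b - 1)
      - Real.pi * Complex.I by ring, Complex.exp_sub, Complex.exp_pi_mul_I, div_neg, div_one]
  have e10 : Complex.exp (Real.pi * Complex.I * (c - a)) = Complex.exp (Real.pi * Complex.I * c)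
      * Complex.exp (-(Real.pi * Complex.I * a)) := by
    rw [← Complex.exp_add]; ring_nf
  have e11 : Complex.exp (-(Real.pi * Complex.I * (c - a)))
      = Complex.exp (-(Real.pi * Complex.I * c)) * Complex.exp (Real.pi * Complex.I * a) := by
    rw [← Complex.exp_add]; ring_nf
  rw [e2, e7] at h2
  rw [e6] at h1
  rw [sin_pi_mul, sin_pi_mul, sin_pi_mul, e3, e10, e11, e8, e9, e4, e5]
  have hx := exp_neg_mul_exp (Real.pi * Complex.I * b)
  have hz := exp_neg_mul_exp (Real.pi * Complex.I * (c - b - 1))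
  rw [show -(Real.pi * Complex.I * (c - b - 1)) = -Real.pi * Complex.I * (c - b - 1) by ring] at hz
  set x := Complex.exp (Real.pi * Complex.I * b)
  set xi := Complex.exp (-(Real.pi * Complex.I * b))
  set z := Complex.exp (Real.pi * Complex.I * (c - b - 1))
  set zi := Complex.exp (-Real.pi * Complex.I * (c - b - 1))
  set β := Complex.exp (b * w)
  set t := Complex.exp (Real.pi * Complex.I * a)
  set ti := Complex.exp (-(Real.pi * Complex.I * a))
  set K := Complex.exp ((c - b - 1) * (w - Real.pi * Complex.I))
  -- Weighting the first relation by `x² z²` makes the coefficients of `D` agree.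
  have h3 : x ^ 2 * (z ^ 2 - 1) * A = β * (x ^ 2 * z ^ 2 - 1) * E
      + β * (x ^ 2 * z ^ 2 * ti - t) * (K * H) := by
    linear_combination x ^ 2 * z ^ 2 * h1 + h2 - x ^ 2 * z * D * hz
  refine mul_left_cancel₀ (mul_ne_zero (Complex.exp_ne_zero (Real.pi * Complex.I * b))
    (Complex.exp_ne_zero (Real.pi * Complex.I * (c - b - 1)))) ?_
  change x * z * _ = x * z * _
  linear_combination (-(Complex.I / 2)) * h3
    + (-(Complex.I / 2) * β * z * zi * (E + t * K * H)) * hx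
    + (-(Complex.I / 2) * β * (E + t * K * H) + Complex.I / 2 * x ^ 2 * A) * hz

/-- The parameters for which both Euler integrals in the next relation converge. -/
def eulerCone : Set (ℂ × ℂ × ℂ) := {p | 0 < p.2.1.re ∧ p.2.1.re < p.2.2.re ∧ p.1.re < 1}

theorem isOpen_eulerCone : IsOpen eulerCone := by
  have h1 := isOpen_setOf_re_lt (f := fun _ : ℂ × ℂ × ℂ => (0 : ℂ)) (g := fun p => p.2.1)
    (by fun_prop) (by fun_prop)
  have h2 := isOpen_setOf_re_lt (f := fun p : ℂ × ℂ × ℂ => p.2.1) (g := fun p => p.2.2)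
    (by fun_prop) (by fun_prop)
  have h3 := isOpen_setOf_re_lt (f := fun p : ℂ × ℂ × ℂ => p.1) (g := fun _ => (1 : ℂ))
    (by fun_prop) (by fun_prop)
  simpa [eulerCone, ofPred_and] using h1.inter (h2.inter h3)

theorem convex_eulerCone : Convex ℝ eulerCone := by
  rintro p ⟨h1, h2, h3⟩ p' ⟨h1', h2', h3'⟩ s t hs ht hst
  refine ⟨?_, ?_, ?_⟩ <;> simp <;>
  rcases hs.eq_or_lt with rfl | hs'
  · simp at hst; subst hst; simpa using h1'
  · have := mul_pos hs' h1; have := mul_nonneg ht h1'.le; linarith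
  · simp at hst; subst hst; simpa using h2'
  · have := mul_lt_mul_of_pos_left h2 hs'; have := mul_le_mul_of_nonneg_left h2'.le ht; linarith
  · simp at hst; subst hst; simpa using h3'
  · have := mul_lt_mul_of_pos_left h3 hs'; have := mul_le_mul_of_nonneg_left h3'.le ht; linarith

/-- The integral from `0` to `1 / y` in terms of the hypergeometric function and its companion. -/
theorem euler_inv_relation {a b c w : ℂ} (hb : 0 < b.re) (hcb : b.re < c.re) (ha : a.re < 1)
    (h : (a, b, c) ∈ genericParams) (hw0 : 0 < w.im) (hw1 : w.im < 2 * Real.pi) :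
    Complex.sin (Real.pi * c) * Complex.exp (b * w)
        * eulerIntegral (1 + b - c) b (b - a + 1) (Complex.exp w)
      = Complex.exp (Real.pi * Complex.I * b) * Complex.sin (Real.pi * (c - b))
          * eulerIntegral a b c (Complex.exp (-w))
        - Complex.sin (Real.pi * (c - a))
          * Complex.exp ((c - 1) * w - Real.pi * Complex.I * (c - b - 1))
          * compH a b c (Complex.exp (-w)) := by
  have hO : IsOpen {p : ℂ × ℂ × ℂ | p.2.2.re < (p.1 + 1).re} :=
    isOpen_setOf_re_lt (by fun_prop) (by fun_prop)
  have hU : IsOpen (eulerCone ∩ {p : ℂ × ℂ × ℂ | p.2.2.re < (p.1 + 1).re}) :=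
    isOpen_eulerCone.inter hO
  obtain ⟨q, hqG, hqU⟩ := exists_generic_mem_of_isOpen hU
    ⟨(1 / 2, 1 / 2, 1), by simp [eulerCone]; norm_num⟩
  have hsub (p : ℂ × ℂ × ℂ) (hp : p ∈ eulerCone) {y : ℂ} (hy : y ∈ cutPlane) :
      DifferentiableAt ℂ (fun p : ℂ × ℂ × ℂ => eulerIntegral p.1 p.2.1 p.2.2 y) p := by
    have := differentiableAt_eulerIntegral (p₀ := (p.1, p.2.1, p.2.2, y))
      ⟨hp.1, by simpa using hp.2.1, hy⟩
    exact this.comp (f := fun p : ℂ × ℂ × ℂ => (p.1, p.2.1, p.2.2, y)) p (by fun_prop)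
  have hsub' (p : ℂ × ℂ × ℂ) (hp : p ∈ eulerCone) {y : ℂ} (hy : y ∈ cutPlane) :
      DifferentiableAt ℂ (fun p : ℂ × ℂ × ℂ =>
        eulerIntegral (1 + p.2.1 - p.2.2) p.2.1 (p.2.1 - p.1 + 1) y) p := by
    have := differentiableAt_eulerIntegral
      (p₀ := (1 + p.2.1 - p.2.2, p.2.1, p.2.1 - p.1 + 1, y))
      ⟨hp.1, by have := hp.2.2; simp; linarith, hy⟩
    exact this.comp (f := fun p : ℂ × ℂ × ℂ =>
      (1 + p.2.1 - p.2.2, p.2.1, p.2.1 - p.1 + 1, y)) p (by fun_prop)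
  -- Both sides are holomorphic on the convex cone minus the nongeneric parameters, so the condition
  -- `Re c < Re a + 1` can be dropped. This is needed because the shifted triple `(a+1, b+1, c+2)`
  -- violates it in the range where the plane integral of `G^s` is computed.
  have key := eqOn_of_eventuallyEq_of_lineGeneric isOpen_eulerCone convex_eulerCone
    isOpen_genericParams lineGeneric_genericParams (q := q) ⟨hqU.1, hqG⟩
    (f := fun p => Complex.sin (Real.pi * p.2.2) * Complex.exp (p.2.1 * w)
        * eulerIntegral (1 + p.2.1 - p.2.2) p.2.1 (p.2.1 - p.1 + 1) (Complex.exp w))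
    (g := fun p => Complex.exp (Real.pi * Complex.I * p.2.1) * Complex.sin (Real.pi * (p.2.2 - p.2.1))
          * eulerIntegral p.1 p.2.1 p.2.2 (Complex.exp (-w))
        - Complex.sin (Real.pi * (p.2.2 - p.1))
          * Complex.exp ((p.2.2 - 1) * w - Real.pi * Complex.I * (p.2.2 - p.2.1 - 1))
          * compH p.1 p.2.1 p.2.2 (Complex.exp (-w)))
    (fun p hp => (DifferentiableAt.mul (by fun_prop)
      (hsub' p hp.1 (exp_mem_cutPlane hw0 hw1))).differentiableWithinAt)
    (fun p hp => (DifferentiableAt.sub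
      (DifferentiableAt.mul (by fun_prop) (hsub p hp.1 (exp_neg_mem_cutPlane hw0 hw1)))
      (DifferentiableAt.mul (by fun_prop)
        (differentiableAt_compH hp.2 (exp_neg_mem_cutPlane hw0 hw1)))).differentiableWithinAt) ?_
  · exact key (x := (a, b, c)) ⟨⟨hb, hcb, ha⟩, h⟩
  · filter_upwards [hU.mem_nhds hqU] with p hp
    exact euler_inv_relation_aux hp.1.1 hp.1.2.1 (by simpa using hp.2) hp.1.2.2 hw0 hw1

end EulerForm

/-! ### The bilinear formulas in logarithmic coordinates -/

section PlaneFormula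

variable {a b c w : ℂ}

/-- The relation at the complex conjugate point. -/
theorem euler_inv_relation_conj (hb : 0 < b.re) (hcb : b.re < c.re) (ha : a.re < 1)
    (h : (a, b, c) ∈ genericParams) (hw0 : 0 < w.im) (hw1 : w.im < 2 * Real.pi) :
    Complex.sin (Real.pi * c) * Complex.exp (b * conj w)
        * eulerIntegral (1 + b - c) b (b - a + 1) (Complex.exp (conj w))
      = Complex.exp (-(Real.pi * Complex.I * b)) * Complex.sin (Real.pi * (c - b))
          * eulerIntegral a b c (Complex.exp (-conj w))
        - Complex.sin (Real.pi * (c - a))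
          * Complex.exp ((c - 1) * conj w + Real.pi * Complex.I * (c - b - 1))
          * compH a b c (Complex.exp (-conj w)) := by
  -- The imaginary part of `conj w` lies in `(-2π, 0)`; adding `2πi` brings it back to the
  -- admissible range and leaves the arguments `e^(±w)` unchanged, so only phases have to be
  -- tracked.
  have key := euler_inv_relation hb hcb ha h (w := conj w + 2 * Real.pi * Complex.I)
    (by simp; linarith) (by simp; linarith)
  have e1 : Complex.exp (conj w + 2 * Real.pi * Complex.I) = Complex.exp (conj w) :=
    Complex.exp_periodic _
  have e2 : Complex.exp (-(conj w + 2 * Real.pi * Complex.I)) = Complex.exp (-conj w) := by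
    rw [neg_add, ← sub_eq_add_neg, Complex.exp_periodic.sub_eq]
  have e3 : Complex.exp (b * (conj w + 2 * Real.pi * Complex.I))
      = Complex.exp (Real.pi * Complex.I * b) ^ 2 * Complex.exp (b * conj w) := by
    rw [sq, ← Complex.exp_add, ← Complex.exp_add]; ring_nf
  have e4 : Complex.exp ((c - 1) * (conj w + 2 * Real.pi * Complex.I)
        - Real.pi * Complex.I * (c - b - 1))
      = Complex.exp (Real.pi * Complex.I * b) ^ 2
        * Complex.exp ((c - 1) * conj w + Real.pi * Complex.I * (c - b - 1)) := by
    rw [sq, ← Complex.exp_add, ← Complex.exp_add]; ring_nf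
  have hx := exp_neg_mul_exp (Real.pi * Complex.I * b)
  rw [e1, e2, e3, e4] at key
  refine mul_left_cancel₀ (pow_ne_zero 2 (Complex.exp_ne_zero (Real.pi * Complex.I * b))) ?_
  linear_combination key - Complex.exp (Real.pi * Complex.I * b) * Complex.sin (Real.pi * (c - b))
          * eulerIntegral a b c (Complex.exp (-conj w)) * hx

/-- The integrand of the plane integral in logarithmic polar coordinates. -/
def logIntegrand (a b c a' b' c' w : ℂ) (θ ρ : ℝ) : ℂ :=
  stripKernel b (c - b - 1) (-a) w (ρ + θ * Complex.I)
    * stripKernel b' (c' - b' - 1) (-a') (conj w) (ρ - θ * Complex.I)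

/-- The outer integral of the first kernel is replaced by `F` and its companion. The integral of the
conjugate kernel over `(0, 1/ȳ)` is left as it is, so that genericity is not needed; this allows `a
= 0` for the beta function. -/
theorem plane_formula_aux {a' b' c' : ℂ} {lam : ℝ}
    (H : KernelPair b (c - b - 1) (-a) b' (c' - b' - 1) (-a') lam)
    (hb : 0 < b.re) (hcb : b.re < c.re) (hac : c.re < a.re + 1) (ha : a.re < 1)
    (hw0 : 0 < w.im) (hw1 : w.im < 2 * Real.pi) {k m n : ℤ} (hk : b' = b + k)
    (hm : c' - b' = c - b + m) (hn : a' = a + n)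
    (hint : IntervalIntegrable (fun θ : ℝ => ∫ ρ : ℝ, logIntegrand a b c a' b' c' w θ ρ)
      volume 0 (2 * Real.pi)) :
    Complex.sin (Real.pi * c) * ∫ θ in (0 : ℝ)..(2 * Real.pi),
        (∫ ρ : ℝ, logIntegrand a b c a' b' c' w θ ρ)
      = Complex.sin (Real.pi * (c - b)) * eulerIntegral a' b' c' (Complex.exp (-conj w))
          * (Complex.sin (Real.pi * b) * eulerIntegral a b c (Complex.exp (-w))
            - Complex.exp ((c - 1) * w - Real.pi * Complex.I * (c - 1)) * Complex.sin (Real.pi * a)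
              * compH a b c (Complex.exp (-w)))
        + Complex.sin (Real.pi * a) * Complex.exp ((c - 1) * w - Real.pi * Complex.I * (c - b - 1))
          * compH a b c (Complex.exp (-w)) * (Complex.sin (Real.pi * c)
            * Complex.exp (b' * conj w)
            * eulerIntegral (1 + b' - c') b' (b' - a' + 1) (Complex.exp (conj w))) := by
  have h1 := H.integral_eq hw0 hw1 (k := k) (m := m) (n := -n) hk
    (by linear_combination hm) (by push_cast; linear_combination -hn) hint
  have hD := outerInt_eq hb hcb hac ha hw0 hw1
  rw [outerInt_neg_eq _ _ _ hw0 hw1, show -b - -a - (c - b - 1) = 1 + a - c by ring,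
    innerInt_eq_compH hac ha (exp_neg_mem_cutPlane hw0 hw1),
    innerInt_eq b' (c' - b' - 1) (-a'), innerInt_eq b' (-a') (c' - b' - 1), neg_neg, neg_neg,
    show b' + (c' - b' - 1) + 1 = c' by ring, show -(c' - b' - 1) = 1 + b' - c' by ring,
    show b' + -a' + 1 = b' - a' + 1 by ring] at h1
  have e1 : Complex.sin (Real.pi * (c - b - 1)) = -Complex.sin (Real.pi * (c - b)) := by
    rw [mul_sub, mul_one, Complex.sin_sub_pi]
  have e2 : Complex.sin (Real.pi * -a) = -Complex.sin (Real.pi * a) := by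
    rw [mul_neg, Complex.sin_neg]
  have e3 : Complex.exp ((c - 1) * w - Real.pi * Complex.I * (c - b - 1))
      = Complex.exp (b * w) * Complex.exp ((c - b - 1) * (w - Real.pi * Complex.I)) := by
    rw [← Complex.exp_add]; ring_nf
  rw [e1, e2] at h1
  rw [← hD, e3]
  simp only [logIntegrand]
  rw [h1]
  ring

/-- The plane integral with equal exponents. -/
theorem plane_formula_F (h : (a, b, c) ∈ genericParams)
    (hb : 0 < b.re) (hcb : b.re < c.re) (hac : c.re < a.re + 1) (ha : a.re < 1)
    (hw0 : 0 < w.im) (hw1 : w.im < 2 * Real.pi)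
    (hint : IntervalIntegrable (fun θ : ℝ => ∫ ρ : ℝ, logIntegrand a b c a b c w θ ρ)
      volume 0 (2 * Real.pi)) :
    Complex.sin (Real.pi * c) * ∫ θ in (0 : ℝ)..(2 * Real.pi),
        (∫ ρ : ℝ, logIntegrand a b c a b c w θ ρ)
      = Complex.sin (Real.pi * b) * Complex.sin (Real.pi * (c - b))
          * eulerIntegral a b c (Complex.exp (-w)) * eulerIntegral a b c (Complex.exp (-conj w))
        - Complex.sin (Real.pi * a) * Complex.sin (Real.pi * (c - a))
          * Complex.exp ((c - 1) * (w + conj w)) * compH a b c (Complex.exp (-w))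
          * compH a b c (Complex.exp (-conj w)) := by
  have hmin1 := min_le_left b.re (1 + a.re - c.re)
  have hmin2 := min_le_right b.re (1 + a.re - c.re)
  have hmin : 0 < min b.re (1 + a.re - c.re) := lt_min hb (by linarith)
  -- The growth rate must satisfy `0 < lam < Re b` and `lam < 1 + Re a - Re c`; half of the minimum
  -- does.
  rw [plane_formula_aux (k := 0) (m := 0) (n := 0) (lam := min b.re (1 + a.re - c.re) / 2)
    ?_ hb hcb hac ha hw0 hw1 (by simp) (by simp) (by simp) hint,
    euler_inv_relation_conj hb hcb ha h hw0 hw1]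
  · have e1 : Complex.exp ((c - 1) * w - Real.pi * Complex.I * (c - b - 1))
        * Complex.exp (-(Real.pi * Complex.I * b))
        = Complex.exp ((c - 1) * w - Real.pi * Complex.I * (c - 1)) := by
      rw [← Complex.exp_add]; ring_nf
    have e2 : Complex.exp ((c - 1) * w - Real.pi * Complex.I * (c - b - 1))
        * Complex.exp ((c - 1) * conj w + Real.pi * Complex.I * (c - b - 1))
        = Complex.exp ((c - 1) * (w + conj w)) := by
      rw [← Complex.exp_add]; ring_nf
    rw [← e1, ← e2]
    ring
  · constructor <;> (try simp only [Complex.sub_re, Complex.one_re, Complex.neg_re]) <;> linarith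

/-- The plane integral with the shifted exponents of the companion function. -/
theorem plane_formula_G (h : (a, b, c) ∈ genericParams)
    (hb : 0 < b.re) (hcb : b.re < c.re) (hac : c.re < a.re + 1 / 2) (ha : a.re < 0)
    (hw0 : 0 < w.im) (hw1 : w.im < 2 * Real.pi)
    (hint : IntervalIntegrable (fun θ : ℝ =>
      ∫ ρ : ℝ, logIntegrand a b c (a + 1) (b + 1) (c + 2) w θ ρ) volume 0 (2 * Real.pi)) :
    Complex.sin (Real.pi * c) * ∫ θ in (0 : ℝ)..(2 * Real.pi),
        (∫ ρ : ℝ, logIntegrand a b c (a + 1) (b + 1) (c + 2) w θ ρ)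
      = Complex.sin (Real.pi * b) * Complex.sin (Real.pi * (c - b))
          * eulerIntegral a b c (Complex.exp (-w))
          * eulerIntegral (a + 1) (b + 1) (c + 2) (Complex.exp (-conj w))
        - Complex.sin (Real.pi * a) * Complex.sin (Real.pi * (c - a))
          * Complex.exp ((c - 1) * w + (c + 1) * conj w) * compH a b c (Complex.exp (-w))
          * compH (a + 1) (b + 1) (c + 2) (Complex.exp (-conj w)) := by
  have h' : (a + 1, b + 1, c + 2) ∈ genericParams := by
    have := mem_genericParams_shift h 1 1 2
    simpa [add_comm] using this
  have hr := euler_inv_relation_conj (a := a + 1) (b := b + 1) (c := c + 2) (by simp; linarith)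
    (by simp; linarith) (by simp; linarith) h' hw0 hw1
  have s1 : Complex.sin (Real.pi * (c + 2)) = Complex.sin (Real.pi * c) := by
    rw [show (Real.pi * (c + 2) : ℂ) = Real.pi * c + 2 * Real.pi by ring, Complex.sin_add_two_pi]
  have s2 : Complex.sin (Real.pi * (c + 2 - (b + 1))) = -Complex.sin (Real.pi * (c - b)) := by
    rw [show (Real.pi * (c + 2 - (b + 1)) : ℂ) = Real.pi * (c - b) + Real.pi by ring,
      Complex.sin_add_pi]
  have s3 : Complex.sin (Real.pi * (c + 2 - (a + 1))) = -Complex.sin (Real.pi * (c - a)) := by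
    rw [show (Real.pi * (c + 2 - (a + 1)) : ℂ) = Real.pi * (c - a) + Real.pi by ring,
      Complex.sin_add_pi]
  rw [s1, s2, s3] at hr
  -- With `lam = 1/2` both decay conditions become exactly `Re c < Re a + 1/2`, and `Re a < 0` is
  -- what makes the shifted exponent `-a - 1` locally integrable on rays.
  rw [plane_formula_aux (k := 1) (m := 1) (n := 1) (lam := 1 / 2)
    ?_ hb hcb (by linarith) (by linarith) hw0 hw1 (by simp) (by push_cast; ring) (by simp) hint, hr]
  · have e1 : Complex.exp ((c - 1) * w - Real.pi * Complex.I * (c - b - 1))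
        * Complex.exp (-(Real.pi * Complex.I * (b + 1)))
        = -Complex.exp ((c - 1) * w - Real.pi * Complex.I * (c - 1)) := by
      have e : Complex.exp ((c - 1) * w - Real.pi * Complex.I * (c - b - 1))
          * Complex.exp (-(Real.pi * Complex.I * b))
          = Complex.exp ((c - 1) * w - Real.pi * Complex.I * (c - 1)) := by
        rw [← Complex.exp_add]; ring_nf
      rw [show -(Real.pi * Complex.I * (b + 1)) = -(Real.pi * Complex.I * b) - Real.pi * Complex.I
        by ring, Complex.exp_sub (-(Real.pi * Complex.I * b)), Complex.exp_pi_mul_I]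
      linear_combination -e
    have e2 : Complex.exp ((c - 1) * w - Real.pi * Complex.I * (c - b - 1))
        * Complex.exp ((c + 2 - 1) * conj w + Real.pi * Complex.I * (c + 2 - (b + 1) - 1))
        = -Complex.exp ((c - 1) * w + (c + 1) * conj w) := by
      rw [← mul_neg_one, ← Complex.exp_pi_mul_I, ← Complex.exp_add, ← Complex.exp_add]
      ring_nf
    linear_combination (-(Complex.sin (Real.pi * a) * Complex.sin (Real.pi * (c - b))
      * compH a b c (Complex.exp (-w))
      * eulerIntegral (a + 1) (b + 1) (c + 2) (Complex.exp (-conj w)))) * e1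
      + (Complex.sin (Real.pi * a) * Complex.sin (Real.pi * (c - a))
      * compH a b c (Complex.exp (-w))
      * compH (a + 1) (b + 1) (c + 2) (Complex.exp (-conj w))) * e2
  · constructor <;> (try simp) <;> linarith

end PlaneFormula

/-! ### Integrability of products of powers of distances -/

section PlaneMajorants

/-- A function on the plane comparable to `1 + ‖z‖` off the bounded set `{d < δ}`, on which its
powers with exponent `> e₀` are integrable. -/
structure SingDist (d : ℂ → ℝ) (δ e₀ : ℝ) : Prop where
  meas : Measurable d
  nonneg : ∀ z, 0 ≤ d z
  upper : ∃ C, ∀ z, d z ≤ C * (1 + ‖z‖)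
  lower : ∃ c, 0 < c ∧ ∀ z, δ ≤ d z → c * (1 + ‖z‖) ≤ d z
  near : ∃ R, ∀ z, d z < δ → ‖z‖ ≤ R
  integrable : ∀ e, e₀ < e → Integrable ({z | d z < δ}.indicator fun z => d z ^ e)

theorem SingDist.rpow_le {d : ℂ → ℝ} {δ e₀ : ℝ} (H : SingDist d δ e₀) (e : ℝ) :
    ∃ K, 0 ≤ K ∧ ∀ z, δ ≤ d z → d z ^ e ≤ K * (1 + ‖z‖) ^ e := by
  obtain ⟨C, hC⟩ := H.upper
  obtain ⟨c, hc, hl⟩ := H.lower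
  refine ⟨c ^ e + (max C 0) ^ e, by positivity, fun z hz => ?_⟩
  have hpos : 0 < 1 + ‖z‖ := by positivity
  exact rpow_le_of_mem hc hpos (hl z hz)
    ((hC z).trans (mul_le_mul_of_nonneg_right (le_max_left _ _) hpos.le)) e

/-- At any point at most one distance is small. Near its zeros the other factors are bounded and the
local exponent decides; away from all zeros the product is comparable to `(1 + ‖z‖)` raised to the
sum of the exponents, integrable when that sum is below `-2`. -/
theorem integrable_prod_rpow {ι : Type*} [Fintype ι] {d : ι → ℂ → ℝ} {δ e₀ e : ι → ℝ}
    (H : ∀ i, SingDist (d i) (δ i) (e₀ i))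
    (hdisj : ∀ i j z, d i z < δ i → d j z < δ j → i = j) (he : ∀ i, e₀ i < e i)
    (hsum : ∑ i, e i < -2) : Integrable fun z => ∏ i, d i z ^ e i := by
  classical
  choose K hK0 hK using fun i => (H i).rpow_le (e i)
  choose R hR using fun i => (H i).near
  -- `B i` bounds the product of the other factors on the bounded region where `d i` is small; the
  -- two summands inside cover negative and positive exponents.
  set B : ι → ℝ := fun i => ∏ j ∈ Finset.univ.erase i, K j * (1 + (1 + max (R i) 0) ^ e j)
  have hB (i : ι) : 0 ≤ B i := Finset.prod_nonneg fun j _ => mul_nonneg (hK0 j) (by positivity)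
  have hmeas : Measurable fun z => ∏ i, d i z ^ e i :=
    Finset.measurable_fun_prod _ fun i _ => (H i).meas.pow_const _
  have hnn (z : ℂ) : 0 ≤ ∏ i, d i z ^ e i :=
    Finset.prod_nonneg fun i _ => Real.rpow_nonneg ((H i).nonneg z) _
  have hfar : Integrable fun z : ℂ => (∏ i, K i) * (1 + ‖z‖) ^ (∑ i, e i) := by
    have := integrable_one_add_norm (μ := (volume : Measure ℂ)) (r := -∑ i, e i)
      (by rw [Complex.finrank_real_complex]; push_cast; linarith)
    rw [neg_neg] at this
    exact this.const_mul _
  refine (hfar.add (integrable_finsetSum Finset.univ fun i _ =>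
    (((H i).integrable (e i) (he i)).const_mul (B i)))).mono' hmeas.aestronglyMeasurable
    (ae_of_all _ fun z => ?_)
  rw [Real.norm_of_nonneg (hnn z)]
  have hterm (i : ι) : 0 ≤ B i * {z | d i z < δ i}.indicator (fun z => d i z ^ e i) z :=
    mul_nonneg (hB i) (indicator_nonneg (fun z _ => Real.rpow_nonneg ((H i).nonneg z) _) z)
  by_cases h : ∃ i, d i z < δ i
  · obtain ⟨i, hi⟩ := h
    have h1 : ∏ j, d j z ^ e j ≤ B i * {z | d i z < δ i}.indicator (fun z => d i z ^ e i) z := by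
      rw [indicator_of_mem (by exact hi), ← Finset.mul_prod_erase _ _ (Finset.mem_univ i), mul_comm]
      refine mul_le_mul_of_nonneg_right (Finset.prod_le_prod
        (fun j _ => Real.rpow_nonneg ((H j).nonneg z) _) fun j hj => ?_)
        (Real.rpow_nonneg ((H i).nonneg z) _)
      have hj' : δ j ≤ d j z := by
        by_contra hlt
        exact (Finset.mem_erase.1 hj).1 (hdisj j i z (not_le.1 hlt) hi)
      refine (hK j z hj').trans (mul_le_mul_of_nonneg_left ?_ (hK0 j))
      have hz : ‖z‖ ≤ max (R i) 0 := (hR i z hi).trans (le_max_left _ _)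
      rcases le_total 0 (e j) with h0 | h0
      · have := Real.rpow_le_rpow (by positivity) (by linarith : 1 + ‖z‖ ≤ 1 + max (R i) 0) h0
        linarith
      · have := Real.rpow_le_one_of_one_le_of_nonpos (by linarith [norm_nonneg z] : 1 ≤ 1 + ‖z‖) h0
        have : 0 ≤ (1 + max (R i) 0) ^ e j := by positivity
        linarith
    have h2 := Finset.single_le_sum (fun i _ => hterm i) (Finset.mem_univ i)
    have h3 : 0 ≤ (∏ i, K i) * (1 + ‖z‖) ^ (∑ i, e i) :=
      mul_nonneg (Finset.prod_nonneg fun i _ => hK0 i) (by positivity)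
    simp only [Pi.add_apply]
    linarith
  · push Not at h
    have h1 : ∏ i, d i z ^ e i ≤ (∏ i, K i) * (1 + ‖z‖) ^ (∑ i, e i) := by
      rw [Real.rpow_sum_of_pos (by positivity), ← Finset.prod_mul_distrib]
      exact Finset.prod_le_prod (fun j _ => Real.rpow_nonneg ((H j).nonneg z) _)
        fun j _ => hK j z (h j)
    have h2 := Finset.sum_nonneg fun i (_ : i ∈ Finset.univ) => hterm i
    simp only [Pi.add_apply]
    linarith

theorem SingDist.const_mul {d : ℂ → ℝ} {δ e₀ κ : ℝ} (H : SingDist d δ e₀) (hκ : 0 < κ) :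
    SingDist (fun z => κ * d z) (κ * δ) e₀ where
  meas := H.meas.const_mul κ
  nonneg z := mul_nonneg hκ.le (H.nonneg z)
  upper := by
    obtain ⟨C, hC⟩ := H.upper
    exact ⟨κ * C, fun z => by rw [mul_assoc]; exact mul_le_mul_of_nonneg_left (hC z) hκ.le⟩
  lower := by
    obtain ⟨c, hc, h⟩ := H.lower
    exact ⟨κ * c, mul_pos hκ hc, fun z hz => by
      rw [mul_assoc]
      exact mul_le_mul_of_nonneg_left (h z ((mul_le_mul_iff_right₀ hκ).1 hz)) hκ.le⟩
  near := by
    obtain ⟨R, h⟩ := H.near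
    exact ⟨R, fun z hz => h z ((mul_lt_mul_iff_right₀ hκ).1 hz)⟩
  integrable e he := by
    refine ((H.integrable e he).const_mul (κ ^ e)).congr (ae_of_all _ fun z => ?_)
    by_cases h : d z < δ
    · have h' : κ * d z < κ * δ := (mul_lt_mul_iff_right₀ hκ).2 h
      simp only
      rw [indicator_of_mem (by exact h), indicator_of_mem (by exact h'),
        Real.mul_rpow hκ.le (H.nonneg z)]
    · have h' : ¬ κ * d z < κ * δ := fun h' => h ((mul_lt_mul_iff_right₀ hκ).1 h')
      simp only
      rw [indicator_of_notMem (by exact h), indicator_of_notMem (by exact h'), mul_zero]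

theorem singDist_of_abs_sub_le {d : ℂ → ℝ} {δ e₀ x : ℝ} (hx : 0 ≤ x) (hδ : 0 < δ)
    (hm : Measurable d) (hn : ∀ z, 0 ≤ d z) (h1 : ∀ z, d z ≤ ‖z‖ + x) (h2 : ∀ z, ‖z‖ ≤ d z + x)
    (hi : ∀ e, e₀ < e → Integrable ({z | d z < δ}.indicator fun z => d z ^ e)) :
    SingDist d δ e₀ where
  meas := hm
  nonneg := hn
  upper := ⟨1 + x, fun z => (h1 z).trans (by nlinarith [norm_nonneg z])⟩
  lower := by
    refine ⟨δ / (1 + x + δ), by positivity, fun z hz => ?_⟩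
    rw [div_mul_eq_mul_div, div_le_iff₀ (by positivity)]
    nlinarith [h2 z, hn z]
  near := ⟨δ + x, fun z hz => (h2 z).trans (by linarith)⟩
  integrable := hi

theorem singDist_norm_sub (p : ℂ) {δ : ℝ} (hδ : 0 < δ) : SingDist (fun z => ‖z - p‖) δ (-2) := by
  refine singDist_of_abs_sub_le (norm_nonneg p) hδ (by fun_prop) (fun z => norm_nonneg _)
    (fun z => norm_sub_le _ _) (fun z => by simpa using norm_add_le (z - p) p) fun e he => ?_
  have h1 : IntegrableOn (fun z : ℂ => ‖z‖ ^ e) (Metric.ball 0 δ) := by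
    rw [integrableOn_fun_norm_addHaar volume (f := fun x : ℝ => x ^ e), Complex.finrank_real_complex]
    have := (intervalIntegral.intervalIntegrable_rpow' (a := 0) (b := δ)
      (by linarith : -1 < e + 1)).1
    refine (this.mono_set Ioo_subset_Ioc_self).congr_fun (fun x hx => ?_) measurableSet_Ioo
    simp only [Nat.add_one_sub_one, pow_one, smul_eq_mul]
    rw [Real.rpow_add_one hx.1.ne', mul_comm]
  have h2 := ((integrable_indicator_iff measurableSet_ball).2 h1).comp_sub_right p
  refine h2.congr (ae_of_all _ fun z => ?_)
  simp [indicator]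

/-- The zero set is now a circle (or a point if `r = 0`), so the condition is one-dimensional,
exponent above `-1`, instead of the `-2` for a point. It serves for bounds depending on the modulus
of `z` alone. -/
theorem singDist_abs_norm_sub {r δ : ℝ} (hr : 0 ≤ r) (hδ : 0 < δ) (hδ1 : δ ≤ 1) :
    SingDist (fun z => |‖z‖ - r|) δ (-1) := by
  refine singDist_of_abs_sub_le hr hδ (by fun_prop) (fun z => abs_nonneg _)
    (fun z => abs_le.2 ⟨by linarith [norm_nonneg z], by linarith⟩)
    (fun z => by linarith [le_abs_self (‖z‖ - r)]) fun e he => ?_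
  have h1 : Integrable (fun z : ℂ => {x : ℝ | |x - r| < δ}.indicator (fun x => |x - r| ^ e) ‖z‖) := by
    rw [integrable_fun_norm_addHaar volume
      (f := {x : ℝ | |x - r| < δ}.indicator fun x => |x - r| ^ e), Complex.finrank_real_complex]
    have h2 := (((integrable_indicator_iff measurableSet_Icc).2
      (integrableOn_abs_rpow he)).comp_sub_right r).const_mul (r + δ)
    have hms : MeasurableSet {x : ℝ | |x - r| < δ} :=
      measurableSet_lt (by fun_prop) measurable_const
    refine h2.integrableOn.mono' ?_ ?_
    · refine Measurable.aestronglyMeasurable ?_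
      have hme : Measurable fun x : ℝ => |x - r| ^ e := by fun_prop
      have hmx : Measurable fun x : ℝ => x ^ (2 - 1) := by fun_prop
      exact hmx.smul (hme.indicator hms)
    · refine (ae_restrict_mem measurableSet_Ioi).mono fun x hx => ?_
      by_cases h : |x - r| < δ
      · have hx' : |x| ≤ r + δ := by
          rw [abs_of_pos hx]; linarith [le_abs_self (x - r)]
        rw [indicator_of_mem (by exact h), indicator_of_mem
          (by exact abs_le.1 (h.le.trans hδ1))]
        simp only [Nat.add_one_sub_one, pow_one, smul_eq_mul, norm_mul, Real.norm_eq_abs]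
        rw [abs_of_nonneg (Real.rpow_nonneg (abs_nonneg (x - r)) e)]
        gcongr
      · rw [indicator_of_notMem (by exact h), smul_zero, norm_zero]
        exact mul_nonneg (by positivity) (indicator_nonneg (fun _ _ => by positivity) _)
  exact h1

end PlaneMajorants

/-! ### Logarithmic polar coordinates -/

section Polar

theorem integral_Ioi_eq_integral_exp (g : ℝ → ℂ) :
    ∫ r in Ioi (0 : ℝ), g r = ∫ ρ : ℝ, (Real.exp ρ : ℂ) * g (Real.exp ρ) := by
  rw [← Real.range_exp, ← image_univ, integral_image_eq_integral_abs_deriv_smul MeasurableSet.univ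
    (fun ρ _ => (Real.hasDerivAt_exp ρ).hasDerivWithinAt) Real.exp_injective.injOn,
    setIntegral_univ]
  simp only [abs_of_pos (Real.exp_pos _), Complex.real_smul]

/-- Integration over the plane in logarithmic polar coordinates. -/
theorem integral_eq_log_polar {f : ℂ → ℂ} (hm : Measurable f) (hf : Integrable f) :
    IntervalIntegrable (fun θ : ℝ => ∫ ρ : ℝ, Complex.exp (2 * ρ)
      * f (Complex.exp (ρ + θ * Complex.I))) volume 0 (2 * Real.pi) ∧
    ∫ z, f z = ∫ θ in (0 : ℝ)..(2 * Real.pi), ∫ ρ : ℝ, Complex.exp (2 * ρ)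
      * f (Complex.exp (ρ + θ * Complex.I)) := by
  set K : ℝ → ℂ := fun θ => ∫ ρ : ℝ, Complex.exp (2 * ρ) * f (Complex.exp (ρ + θ * Complex.I))
  have hpi := Real.pi_pos
  -- Polar coordinates use angles in `(-π, π)`; replacing `z` by `-z` adds `π` and produces the
  -- range `(0, 2π)`, whose ends lie on the singular ray through `1`.
  have hg : Integrable fun z => f (-z) := hf.comp_neg
  have htarget : polarCoord.target = Ioi (0 : ℝ) ×ˢ Ioo (-Real.pi) Real.pi := rfl
  have hmeas : Measurable fun p : ℝ × ℝ => p.1 • f (-Complex.polarCoord.symm p) := by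
    simp only [Complex.polarCoord_symm_apply]
    have h1 : Measurable fun p : ℝ × ℝ =>
        -((p.1 : ℂ) * (Real.cos p.2 + Real.sin p.2 * Complex.I)) :=
      Continuous.measurable (by fun_prop)
    exact measurable_fst.smul (hm.comp h1)
  have hint : IntegrableOn (fun p : ℝ × ℝ => p.1 • f (-Complex.polarCoord.symm p))
      polarCoord.target := by
    refine ⟨hmeas.aestronglyMeasurable, ?_⟩
    rw [HasFiniteIntegral]
    have h1 := Complex.lintegral_comp_polarCoord_symm fun z => ‖f (-z)‖ₑ
    have h2 : ∫⁻ p in polarCoord.target, ‖p.1 • f (-Complex.polarCoord.symm p)‖ₑ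
        = ∫⁻ p in polarCoord.target, ENNReal.ofReal p.1 • ‖f (-Complex.polarCoord.symm p)‖ₑ := by
      refine setLIntegral_congr_fun polarCoord.open_target.measurableSet fun p hp => ?_
      simp only [enorm_smul, smul_eq_mul]
      rw [Real.enorm_of_nonneg (le_of_lt hp.1)]
    rw [h2, h1]
    exact hg.2
  have hinner (φ : ℝ) : ∫ r in Ioi (0 : ℝ), r • f (-Complex.polarCoord.symm (r, φ))
      = K (φ + Real.pi) := by
    rw [integral_Ioi_eq_integral_exp]
    refine integral_congr_ae (ae_of_all _ fun ρ => ?_)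
    have e1 : -Complex.polarCoord.symm (Real.exp ρ, φ)
        = Complex.exp (ρ + (φ + Real.pi : ℝ) * Complex.I) := by
      rw [Complex.polarCoord_symm_apply, Complex.exp_add]
      push_cast
      rw [add_mul, Complex.exp_add, Complex.exp_pi_mul_I, Complex.exp_mul_I]
      ring
    have e2 : Complex.exp (2 * ρ) = Complex.exp ρ * Complex.exp ρ := by
      rw [← Complex.exp_add]; ring_nf
    simp only
    rw [e1, e2, Complex.real_smul]
    push_cast
    ring
  rw [IntegrableOn, htarget, Measure.volume_eq_prod, ← Measure.prod_restrict] at hint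
  have h1 : IntegrableOn (fun φ : ℝ => K (φ + Real.pi)) (Ioo (-Real.pi) Real.pi) :=
    hint.integral_prod_right.congr (ae_of_all _ hinner)
  have h2 : IntervalIntegrable (fun φ : ℝ => K (φ + Real.pi)) volume (-Real.pi) Real.pi :=
    (intervalIntegrable_iff_integrableOn_Ioo_of_le (by linarith)).2 h1
  have h3 := h2.comp_sub_right Real.pi
  simp only [sub_add_cancel, neg_add_cancel] at h3
  refine ⟨by convert h3 using 1; ring, ?_⟩
  have h4 : ∫ z, f z = ∫ z, f (-z) := (integral_neg_eq_self f volume).symm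
  rw [h4, ← Complex.integral_comp_polarCoord_symm, htarget, Measure.volume_eq_prod,
    ← Measure.prod_restrict, integral_prod_symm _ hint]
  simp_rw [hinner]
  rw [← integral_Ioc_eq_integral_Ioo, ← intervalIntegral.integral_of_le (by linarith),
    intervalIntegral.integral_comp_add_right]
  congr 1 <;> ring

end Polar

/-! ### Plane integrals as functions of their exponents -/

section PlanePowers

/-- The distances to the three branch points `0`, `1`, `1 / y`. -/
def branchDist (y : ℂ) : Fin 3 → ℂ → ℝ
  | 0 => fun z => ‖z‖
  | 1 => fun z => ‖1 - z‖
  | 2 => fun z => ‖1 - z * y‖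

/-- A product of powers of the distances to the branch points. -/
def planePow (y : ℂ) (s : Fin 3 → ℂ) (z : ℂ) : ℂ := ∏ i, (branchDist y i z : ℂ) ^ s i

/-- The exponents for which the integral of `planePow` converges. -/
def planeDomain : Set (Fin 3 → ℂ) := {s | (∀ i, -2 < (s i).re) ∧ ∑ i, (s i).re < -2}

variable {y : ℂ}

theorem branchDist_nonneg (y : ℂ) (i : Fin 3) (z : ℂ) : 0 ≤ branchDist y i z := by
  fin_cases i <;> exact norm_nonneg _

theorem continuous_branchDist (y : ℂ) (i : Fin 3) : Continuous (branchDist y i) := by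
  fin_cases i <;> simp only [branchDist] <;> fun_prop

theorem measurable_planePow (y : ℂ) (s : Fin 3 → ℂ) : Measurable (planePow y s) :=
  Finset.measurable_fun_prod _ fun i _ =>
    (Complex.measurable_ofReal.comp (continuous_branchDist y i).measurable).pow_const _

theorem ae_branchDist_pos (y : ℂ) : ∀ᵐ z, ∀ i, 0 < branchDist y i z := by
  have h (p : ℂ) : ∀ᵐ z : ℂ, z ≠ p := compl_mem_ae_iff.2 (measure_singleton p)
  filter_upwards [h 0, h 1, h y⁻¹] with z h0 h1 h2 i
  fin_cases i
  · exact norm_pos_iff.2 h0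
  · exact norm_pos_iff.2 (sub_ne_zero.2 h1.symm)
  · refine norm_pos_iff.2 (sub_ne_zero.2 fun h => h2 ?_)
    exact eq_inv_of_mul_eq_one_left h.symm

theorem exists_singDist_branchDist (hy0 : y ≠ 0) (hy1 : y ≠ 1) :
    ∃ δ : Fin 3 → ℝ, (∀ i, SingDist (branchDist y i) (δ i) (-2)) ∧
      ∀ i j z, branchDist y i z < δ i → branchDist y j z < δ j → i = j := by
  have hyn := norm_pos_iff.2 hy0
  have h2 : 0 < ‖1 - y⁻¹‖ := norm_pos_iff.2 (sub_ne_zero.2 fun h => hy1 (by simpa using h.symm))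
  set δ := min 1 (min ‖y⁻¹‖ ‖1 - y⁻¹‖) / 2
  have hδ : 0 < δ := half_pos (lt_min one_pos (lt_min (norm_pos_iff.2 (inv_ne_zero hy0)) h2))
  have hδ1 : 2 * δ ≤ 1 := by
    have := min_le_left 1 (min ‖y⁻¹‖ ‖1 - y⁻¹‖)
    simp only [δ]; linarith
  have hδ2 : 2 * δ ≤ ‖y⁻¹‖ := by
    have := (min_le_right 1 (min ‖y⁻¹‖ ‖1 - y⁻¹‖)).trans (min_le_left _ _)
    simp only [δ]; linarith
  have hδ3 : 2 * δ ≤ ‖1 - y⁻¹‖ := by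
    have := (min_le_right 1 (min ‖y⁻¹‖ ‖1 - y⁻¹‖)).trans (min_le_right _ _)
    simp only [δ]; linarith
  have hd (z : ℂ) : ‖1 - z * y‖ = ‖y‖ * ‖z - y⁻¹‖ := by
    rw [← norm_mul, mul_sub, mul_inv_cancel₀ hy0, norm_sub_rev, mul_comm]
  refine ⟨![δ, δ, ‖y‖ * δ], fun i => ?_, ?_⟩
  · fin_cases i
    · simpa [branchDist] using singDist_norm_sub 0 hδ
    · have := singDist_norm_sub 1 hδ
      simp_rw [norm_sub_rev _ (1 : ℂ)] at this
      exact this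
    · have := (singDist_norm_sub y⁻¹ hδ).const_mul hyn
      simp_rw [← hd] at this
      exact this
  · have key (z : ℂ) : ¬ (‖z‖ < δ ∧ ‖1 - z‖ < δ) := by
      rintro ⟨h, h'⟩
      have := norm_add_le z (1 - z)
      rw [add_sub_cancel, norm_one] at this
      linarith
    have key2 (z : ℂ) : ¬ (‖z‖ < δ ∧ ‖1 - z * y‖ < ‖y‖ * δ) := by
      rintro ⟨h, h'⟩
      rw [hd] at h'
      have h' := (mul_lt_mul_iff_right₀ hyn).1 h'
      have := norm_sub_le z (z - y⁻¹)
      rw [sub_sub_cancel] at this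
      linarith
    have key3 (z : ℂ) : ¬ (‖1 - z‖ < δ ∧ ‖1 - z * y‖ < ‖y‖ * δ) := by
      rintro ⟨h, h'⟩
      rw [hd] at h'
      have h' := (mul_lt_mul_iff_right₀ hyn).1 h'
      have := norm_add_le (1 - z) (z - y⁻¹)
      rw [sub_add_sub_cancel] at this
      linarith
    intro i j z h h'
    fin_cases i <;> fin_cases j <;> first | rfl | exfalso
    · exact key z ⟨h, h'⟩
    · exact key2 z ⟨h, h'⟩
    · exact key z ⟨h', h⟩
    · exact key3 z ⟨h, h'⟩
    · exact key2 z ⟨h', h⟩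
    · exact key3 z ⟨h', h⟩

theorem norm_ofReal_cpow_le {x : ℝ} (hx : 0 ≤ x) (s : ℂ) : ‖(x : ℂ) ^ s‖ ≤ x ^ s.re := by
  have := Complex.norm_cpow_le (x : ℂ) s
  rwa [Complex.arg_ofReal_of_nonneg hx, zero_mul, Real.exp_zero, div_one, Complex.norm_real,
    Real.norm_of_nonneg hx] at this

theorem norm_planePow_le (y : ℂ) (s : Fin 3 → ℂ) (z : ℂ) :
    ‖planePow y s z‖ ≤ ∏ i, branchDist y i z ^ (s i).re := by
  rw [planePow, norm_prod]
  exact Finset.prod_le_prod (fun i _ => norm_nonneg _) fun i _ =>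
    norm_ofReal_cpow_le (branchDist_nonneg y i z) _

theorem integrable_planePow (hy0 : y ≠ 0) (hy1 : y ≠ 1) {s : Fin 3 → ℂ} (hs : s ∈ planeDomain)
    {u : ℂ → ℂ} {k : ℝ} (hu : Measurable u) (hu1 : ∀ z, ‖u z‖ ≤ k) :
    Integrable fun z => planePow y s z * u z := by
  obtain ⟨δ, h1, h2⟩ := exists_singDist_branchDist hy0 hy1
  have h3 := integrable_prod_rpow h1 h2 (e := fun i => (s i).re) hs.1 hs.2
  refine (h3.mul_const k).mono' ((measurable_planePow y s).mul hu).aestronglyMeasurable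
    (ae_of_all _ fun z => ?_)
  rw [norm_mul]
  exact mul_le_mul (norm_planePow_le y s z) (hu1 z) (norm_nonneg _)
    (Finset.prod_nonneg fun i _ => Real.rpow_nonneg (branchDist_nonneg y i z) _)

theorem rpow_le_add_rpow {x σ r τ : ℝ} (hx : 0 < x) (h : |τ - σ| ≤ r) :
    x ^ τ ≤ x ^ (σ - r) + x ^ (σ + r) := by
  obtain ⟨h1, h2⟩ := abs_le.1 h
  rcases le_total x 1 with h3 | h3
  · have := Real.rpow_le_rpow_of_exponent_ge hx h3 (by linarith : σ - r ≤ τ)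
    have : 0 ≤ x ^ (σ + r) := by positivity
    linarith
  · have := Real.rpow_le_rpow_of_exponent_le h3 (by linarith : τ ≤ σ + r)
    have : 0 ≤ x ^ (σ - r) := by positivity
    linarith

/-- The plane integral depends holomorphically on the exponents. -/
theorem differentiableAt_integral_planePow (hy0 : y ≠ 0) (hy1 : y ≠ 1) {s₀ : Fin 3 → ℂ}
    (hs : s₀ ∈ planeDomain) {u : ℂ → ℂ} {k : ℝ} (hu : Measurable u) (hu1 : ∀ z, ‖u z‖ ≤ k) :
    DifferentiableAt ℂ (fun s => ∫ z, planePow y s z * u z) s₀ := by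
  obtain ⟨δ, h1, h2⟩ := exists_singDist_branchDist hy0 hy1
  have hcont : Continuous fun r : ℝ => ∑ i, ((s₀ i).re + r) := by fun_prop
  -- The slack `r` is such that lowering any exponent by `r` keeps local integrability and raising
  -- all of them by `r` keeps integrability at infinity.
  have hev : ∀ᶠ r : ℝ in 𝓝[>] 0, (∀ i, -2 < (s₀ i).re - r) ∧ ∑ i, ((s₀ i).re + r) < -2 := by
    refine Eventually.filter_mono nhdsWithin_le_nhds (Filter.Eventually.and ?_ ?_)
    · rw [eventually_all]
      intro i
      have : Continuous fun r : ℝ => (s₀ i).re - r := by fun_prop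
      exact this.tendsto 0 |>.eventually (lt_mem_nhds (by simpa using hs.1 i))
    · exact hcont.tendsto 0 |>.eventually (gt_mem_nhds (by simpa using hs.2))
  obtain ⟨r, ⟨hr1, hr2⟩, hr⟩ := (hev.and self_mem_nhdsWithin).exists
  have hr0 : 0 < r := hr
  have hint : Integrable fun z => (∏ i, (branchDist y i z ^ ((s₀ i).re - r)
      + branchDist y i z ^ ((s₀ i).re + r))) * k := by
    refine Integrable.mul_const ?_ k
    -- Each factor is dominated by the sum of its two extreme powers. Expanding the product gives
    -- finitely many products of powers, every one of them admissible.
    simp_rw [Finset.prod_add]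
    refine integrable_finsetSum _ fun t _ => ?_
    have e (z : ℂ) : (∏ i ∈ t, branchDist y i z ^ ((s₀ i).re - r))
        * ∏ i ∈ Finset.univ \ t, branchDist y i z ^ ((s₀ i).re + r)
        = ∏ i, branchDist y i z ^ (if i ∈ t then (s₀ i).re - r else (s₀ i).re + r) := by
      rw [← Finset.prod_sdiff (Finset.subset_univ t), mul_comm]
      congr 1
      · refine Finset.prod_congr rfl fun i hi => ?_
        rw [if_neg (Finset.mem_sdiff.1 hi).2]
      · refine Finset.prod_congr rfl fun i hi => ?_
        rw [if_pos hi]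
    simp_rw [e]
    refine integrable_prod_rpow h1 h2 (fun i => ?_) (lt_of_le_of_lt (Finset.sum_le_sum
      fun i _ => ?_) hr2)
    · split_ifs
      · exact hr1 i
      · linarith [hr1 i]
    · split_ifs
      · linarith
      · exact le_rfl
  refine differentiableAt_integral_of_dominated hr0 (fun s _ =>
    ((measurable_planePow y s).mul hu).aestronglyMeasurable) ?_ ?_ hint
  · filter_upwards [ae_branchDist_pos y] with z hz
    refine DifferentiableOn.mul_const (fun s _ => DifferentiableAt.differentiableWithinAt ?_) _
    have h (i : Fin 3) : DifferentiableAt ℂ (fun s : Fin 3 → ℂ => (branchDist y i z : ℂ) ^ s i) s :=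
      DifferentiableAt.const_cpow (by fun_prop) (Or.inl (by exact_mod_cast (hz i).ne'))
    simp only [planePow, Fin.prod_univ_three]
    exact ((h 0).mul (h 1)).mul (h 2)
  · filter_upwards [ae_branchDist_pos y] with z hz s hs
    rw [norm_mul]
    refine mul_le_mul ((norm_planePow_le y s z).trans (Finset.prod_le_prod
      (fun i _ => Real.rpow_nonneg (branchDist_nonneg y i z) _) fun i _ =>
      rpow_le_add_rpow (hz i) ?_)) (hu1 z) (norm_nonneg _) (Finset.prod_nonneg fun i _ => ?_)
    · rw [← Complex.sub_re]
      refine (Complex.abs_re_le_norm _).trans ((norm_le_pi_norm (s - s₀) i).trans ?_)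
      rw [← dist_eq_norm]
      exact (Metric.mem_ball.1 hs).le
    · have := branchDist_nonneg y i z
      positivity

end PlanePowers

/-! ### Transfer of the single-valued integrals to the strip -/

section PlaneIntegrals

/-- The exponents of the plane integral of `svCalF`. -/
def expF (a b c : ℂ) : Fin 3 → ℂ := ![2 * b - 2, 2 * (c - b) - 2, -2 * a]

/-- The exponents of the plane integral of `svCalG`. -/
def expG (a b c : ℂ) : Fin 3 → ℂ := ![2 * b - 1, 2 * (c - b) - 1, -2 * a - 1]

/-- The unimodular factor of the integrand of `svCalG`. -/
def phaseG (y z : ℂ) : ℂ :=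
  ‖z‖ / z * (‖1 - z‖ / (1 - z)) * (‖1 - z * y‖ / (1 - conj y * conj z))

theorem measurable_phaseG (y : ℂ) : Measurable (phaseG y) := by
  unfold phaseG
  fun_prop

theorem norm_phaseG_le (y z : ℂ) : ‖phaseG y z‖ ≤ 1 := by
  have h (x : ℂ) : ‖(‖x‖ : ℂ) / x‖ ≤ 1 := by
    rw [norm_div, Complex.norm_real, norm_norm]; exact div_self_le_one _
  have h3 : ‖(‖1 - z * y‖ : ℂ) / (1 - conj y * conj z)‖ ≤ 1 := by
    have e : 1 - conj y * conj z = conj (1 - z * y) := by simp [mul_comm]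
    rw [e, ← Complex.norm_conj (1 - z * y)]
    exact h _
  rw [phaseG, norm_mul, norm_mul]
  exact mul_le_one₀ (mul_le_one₀ (h z) (norm_nonneg _) (h (1 - z))) (norm_nonneg _) h3

theorem svIntegral_eq (f : ℂ → ℂ) : svIntegral f = (Real.pi : ℂ)⁻¹ * ∫ z, f z := by
  rw [svIntegral, integral_mul_const]
  have h1 : (Real.pi : ℂ) ≠ 0 := by exact_mod_cast Real.pi_ne_zero
  have h2 := Complex.I_ne_zero
  field_simp

theorem svIntegral_F (a b c y : ℂ) :
    svIntegral (fun z => svWeight a b c y z / ((‖z‖ : ℂ) ^ 2 * (‖1 - z‖ : ℂ) ^ 2))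
      = (Real.pi : ℂ)⁻¹ * ∫ z, planePow y (expF a b c) z * 1 := by
  rw [svIntegral_eq]
  congr 1
  refine integral_congr_ae ?_
  filter_upwards [ae_branchDist_pos y] with z hz
  have h0 : (‖z‖ : ℂ) ≠ 0 := by exact_mod_cast (hz 0).ne'
  have h1 : (‖1 - z‖ : ℂ) ≠ 0 := by exact_mod_cast (hz 1).ne'
  simp only [planePow, Fin.prod_univ_three, expF, branchDist, svWeight, Matrix.cons_val_zero,
    Matrix.cons_val_one, Matrix.cons_val]
  rw [Complex.cpow_sub _ _ h0, Complex.cpow_sub _ _ h1, Complex.cpow_ofNat, Complex.cpow_ofNat]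
  field_simp

theorem svIntegral_G (a b c y : ℂ) :
    svIntegral (fun z => svWeight a b c y z * conj y / ((1 - conj y * conj z) * z * (1 - z)))
      = (Real.pi : ℂ)⁻¹ * conj y * ∫ z, planePow y (expG a b c) z * phaseG y z := by
  rw [svIntegral_eq, mul_assoc, ← integral_const_mul (conj y)]
  congr 1
  refine integral_congr_ae ?_
  filter_upwards [ae_branchDist_pos y] with z hz
  have h0 : (‖z‖ : ℂ) ≠ 0 := by exact_mod_cast (hz 0).ne'
  have h1 : (‖1 - z‖ : ℂ) ≠ 0 := by exact_mod_cast (hz 1).ne'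
  have h2 : (‖1 - z * y‖ : ℂ) ≠ 0 := by exact_mod_cast (hz 2).ne'
  simp only [planePow, Fin.prod_univ_three, expG, branchDist, svWeight, Matrix.cons_val_zero,
    Matrix.cons_val_one, Matrix.cons_val, phaseG]
  rw [Complex.cpow_sub _ _ h0, Complex.cpow_sub _ _ h1, Complex.cpow_sub _ _ h2, Complex.cpow_one,
    Complex.cpow_one, Complex.cpow_one]
  field_simp

/-- Off the negative axis the principal logarithm commutes with conjugation, so the two logarithms
add up to `2 log |x|`. This splits the modulus powers into a holomorphic and an antiholomorphic
factor. -/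
theorem cpow_mul_conj_cpow {x : ℂ} (hx : x ∈ Complex.slitPlane) (q : ℂ) :
    x ^ q * conj x ^ q = (‖x‖ : ℂ) ^ (2 * q) := by
  have h0 := Complex.slitPlane_ne_zero hx
  have h1 : conj x ≠ 0 := by simpa using h0
  have h2 : (‖x‖ : ℂ) ≠ 0 := by simpa using h0
  rw [Complex.cpow_def_of_ne_zero h0, Complex.cpow_def_of_ne_zero h1,
    Complex.cpow_def_of_ne_zero h2, ← Complex.exp_add,
    Complex.log_conj x (Complex.mem_slitPlane_iff_arg.1 hx).1, ← add_mul, Complex.add_conj,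
    Complex.log_re, ← Complex.ofReal_log (norm_nonneg _)]
  congr 1
  push_cast
  ring

variable {w : ℂ}

/-- The identification of the integrand fails only at the angle of the second branch line and at the
ends, a null set of angles. -/
theorem log_polar_transfer {f : ℂ → ℂ} (hm : Measurable f) (hf : Integrable f)
    {L : ℝ → ℝ → ℂ} (h : ∀ θ ∈ Ioo 0 (2 * Real.pi), θ ≠ w.im → ∀ ρ : ℝ, Complex.exp (2 * ρ)
      * f (Complex.exp (ρ + θ * Complex.I)) = L θ ρ) :
    IntervalIntegrable (fun θ : ℝ => ∫ ρ : ℝ, L θ ρ) volume 0 (2 * Real.pi) ∧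
    ∫ z, f z = ∫ θ in (0 : ℝ)..(2 * Real.pi), ∫ ρ : ℝ, L θ ρ := by
  obtain ⟨h1, h2⟩ := integral_eq_log_polar hm hf
  have hpi := Real.pi_pos
  have hn (x : ℝ) : ∀ᵐ θ : ℝ, θ ≠ x := compl_mem_ae_iff.2 (measure_singleton x)
  have hae : ∀ᵐ θ : ℝ, θ ∈ uIoc 0 (2 * Real.pi) → (∫ ρ : ℝ, Complex.exp (2 * ρ)
      * f (Complex.exp (ρ + θ * Complex.I))) = ∫ ρ : ℝ, L θ ρ := by
    filter_upwards [hn w.im, hn (2 * Real.pi)] with θ h3 h4 h5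
    rw [uIoc_of_le (by linarith)] at h5
    exact integral_congr_ae (ae_of_all _ (h θ ⟨h5.1, lt_of_le_of_ne h5.2 h4⟩ h3))
  refine ⟨h1.congr_ae ?_, ?_⟩
  · exact (ae_restrict_iff' measurableSet_uIoc).2 hae
  · rw [h2]
    exact intervalIntegral.integral_congr_ae hae

theorem logIntegrand_aux {θ : ℝ} (h0 : θ ∈ Ioo 0 (2 * Real.pi)) (h1 : θ ≠ w.im) (hw0 : 0 < w.im)
    (hw1 : w.im < 2 * Real.pi) (ρ : ℝ) :
    1 - Complex.exp (ρ + θ * Complex.I) ∈ Complex.slitPlane ∧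
    1 - Complex.exp (ρ + θ * Complex.I) * Complex.exp (-w) ∈ Complex.slitPlane ∧
    Complex.exp (ρ - θ * Complex.I) = conj (Complex.exp (ρ + θ * Complex.I)) ∧
    Complex.exp (ρ - θ * Complex.I - conj w)
      = conj (Complex.exp (ρ + θ * Complex.I) * Complex.exp (-w)) ∧
    ‖Complex.exp (ρ + θ * Complex.I)‖ = Real.exp ρ := by
  have hpi := Real.pi_pos
  have e1 : Complex.exp (ρ - θ * Complex.I) = conj (Complex.exp (ρ + θ * Complex.I)) := by
    rw [← Complex.exp_conj]; simp [sub_eq_add_neg]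
  refine ⟨one_sub_exp_mem_slitPlane ?_, ?_, e1, ?_, ?_⟩
  · simpa using sin_half_ne_zero (by linarith [h0.1]) h0.2 h0.1.ne'
  · rw [← Complex.exp_add]
    refine one_sub_exp_mem_slitPlane ?_
    have := sin_half_ne_zero (x := θ - w.im) (by linarith [h0.1]) (by linarith [h0.2])
      (sub_ne_zero.2 h1)
    simpa [sub_eq_add_neg] using this
  · rw [← Complex.exp_add, ← Complex.exp_conj]; simp [sub_eq_add_neg]
  · rw [Complex.norm_exp]; simp

theorem planePow_expF_log (a b c : ℂ) {θ : ℝ} (h0 : θ ∈ Ioo 0 (2 * Real.pi)) (h1 : θ ≠ w.im)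
    (hw0 : 0 < w.im) (hw1 : w.im < 2 * Real.pi) (ρ : ℝ) :
    Complex.exp (2 * ρ) * (planePow (Complex.exp (-w)) (expF a b c)
      (Complex.exp (ρ + θ * Complex.I)) * 1) = logIntegrand a b c a b c w θ ρ := by
  obtain ⟨hs1, hs2, e1, e2, e3⟩ := logIntegrand_aux h0 h1 hw0 hw1 ρ
  simp only [planePow, Fin.prod_univ_three, expF, branchDist, Matrix.cons_val_zero,
    Matrix.cons_val_one, Matrix.cons_val, logIntegrand, stripKernel, mul_one]
  rw [e1, e2, e3, ofReal_exp_cpow, show 2 * (c - b) - 2 = 2 * (c - b - 1) by ring,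
    show -2 * a = 2 * (-a) by ring, ← cpow_mul_conj_cpow hs1, ← cpow_mul_conj_cpow hs2,
    show (ρ + θ * Complex.I - w : ℂ) = ρ + θ * Complex.I + -w by ring, Complex.exp_add _ (-w)]
  have e4 : Complex.exp (2 * ρ) * Complex.exp ((2 * b - 2) * ρ)
      = Complex.exp (b * (ρ + θ * Complex.I)) * Complex.exp (b * (ρ - θ * Complex.I)) := by
    rw [← Complex.exp_add, ← Complex.exp_add]; ring_nf
  simp only [map_sub, map_one]
  linear_combination (1 - Complex.exp (ρ + θ * Complex.I)) ^ (c - b - 1)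
    * (1 - conj (Complex.exp (ρ + θ * Complex.I))) ^ (c - b - 1)
    * (1 - Complex.exp (ρ + θ * Complex.I) * Complex.exp (-w)) ^ (-a)
    * (1 - conj (Complex.exp (ρ + θ * Complex.I) * Complex.exp (-w))) ^ (-a) * e4

/-- Each unimodular factor turns a half-integer shift of the modulus exponent into an integer shift
on one side: the antiholomorphic exponents become `b + 1`, `c - b` and `-a - 1`, which are those of
the triple `(a+1, b+1, c+2)`. -/
theorem planePow_expG_log (a b c : ℂ) {θ : ℝ} (h0 : θ ∈ Ioo 0 (2 * Real.pi)) (h1 : θ ≠ w.im)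
    (hw0 : 0 < w.im) (hw1 : w.im < 2 * Real.pi) (ρ : ℝ) :
    Complex.exp (2 * ρ) * (planePow (Complex.exp (-w)) (expG a b c)
      (Complex.exp (ρ + θ * Complex.I)) * phaseG (Complex.exp (-w))
      (Complex.exp (ρ + θ * Complex.I))) = logIntegrand a b c (a + 1) (b + 1) (c + 2) w θ ρ := by
  obtain ⟨hs1, hs2, e1, e2, e3⟩ := logIntegrand_aux h0 h1 hw0 hw1 ρ
  set z := Complex.exp (ρ + θ * Complex.I)
  have hz : z ≠ 0 := Complex.exp_ne_zero _
  have hx1 := Complex.slitPlane_ne_zero hs1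
  have hx2 := Complex.slitPlane_ne_zero hs2
  have hn1 : (‖1 - z‖ : ℂ) ≠ 0 := by simpa using hx1
  have hn2 : (‖1 - z * Complex.exp (-w)‖ : ℂ) ≠ 0 := by simpa using hx2
  have hc1 : 1 - conj z ≠ 0 := by simpa using (map_ne_zero (starRingEnd ℂ)).2 hx1
  have hc2 : 1 - conj (z * Complex.exp (-w)) ≠ 0 := by
    simpa using (map_ne_zero (starRingEnd ℂ)).2 hx2
  have e4 : Complex.exp (2 * ρ) = z * conj z := by
    rw [← e1, ← Complex.exp_add]; ring_nf
  have e5 : Complex.exp ((2 * b - 1) * ρ) * Complex.exp ρ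
      = Complex.exp (b * (ρ + θ * Complex.I)) * Complex.exp (b * (ρ - θ * Complex.I)) := by
    rw [← Complex.exp_add, ← Complex.exp_add]; ring_nf
  have e6 : Complex.exp ((b + 1) * (ρ - θ * Complex.I))
      = Complex.exp (b * (ρ - θ * Complex.I)) * conj z := by
    rw [← e1, ← Complex.exp_add]; ring_nf
  have p1 : (‖1 - z‖ : ℂ) ^ (2 * (c - b) - 1) * ‖1 - z‖
      = (1 - z) ^ (c - b - 1) * (1 - conj z) ^ (c - b - 1) * ((1 - z) * (1 - conj z)) := by
    have := Complex.mul_conj' (1 - z)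
    simp only [map_sub, map_one] at this
    rw [this, show (2 * (c - b) - 1) = 2 * (c - b - 1) + 1 by ring, Complex.cpow_add _ _ hn1,
      ← cpow_mul_conj_cpow hs1, Complex.cpow_one]
    simp only [map_sub, map_one]
    ring
  have p2 : (‖1 - z * Complex.exp (-w)‖ : ℂ) ^ (-2 * a - 1) * ‖1 - z * Complex.exp (-w)‖
      = (1 - z * Complex.exp (-w)) ^ (-a) * (1 - conj (z * Complex.exp (-w))) ^ (-a) := by
    rw [show -2 * a - 1 = 2 * (-a) - 1 by ring, Complex.cpow_sub _ _ hn2,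
      ← cpow_mul_conj_cpow hs2, Complex.cpow_one, div_mul_cancel₀ _ hn2]
    simp only [map_sub, map_one]
  have e7 : (1 : ℂ) - conj (Complex.exp (-w)) * conj z = 1 - conj (z * Complex.exp (-w)) := by
    rw [map_mul, mul_comm]
  simp only [planePow, Fin.prod_univ_three, expG, branchDist, Matrix.cons_val_zero,
    Matrix.cons_val_one, Matrix.cons_val, logIntegrand, stripKernel, phaseG]
  rw [e1, e2, e3, e4, e6, e7, ofReal_exp_cpow, show c + 2 - (b + 1) - 1 = c - b - 1 + 1 by ring,
    show -(a + 1) = -a - 1 by ring, Complex.cpow_add _ _ hc1, Complex.cpow_sub _ _ hc2,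
    Complex.cpow_one, Complex.cpow_one,
    show (ρ + θ * Complex.I - w : ℂ) = ρ + θ * Complex.I + -w by ring, Complex.exp_add _ (-w)]
  push_cast
  change z * conj z * _ = _ * (1 - z) ^ (c - b - 1) * (1 - z * Complex.exp (-w)) ^ (-a) * _
  calc _ = z * conj z * ((Complex.exp ((2 * b - 1) * ρ) * Complex.exp ρ)
        * ((‖1 - z‖ : ℂ) ^ (2 * (c - b) - 1) * ‖1 - z‖)
        * ((‖1 - z * Complex.exp (-w)‖ : ℂ) ^ (-2 * a - 1) * ‖1 - z * Complex.exp (-w)‖))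
        / (z * (1 - z) * (1 - conj (z * Complex.exp (-w)))) := by
        field_simp
    _ = _ := by
        rw [e5, p1, p2]
        field_simp

end PlaneIntegrals

/-! ### The plane integrals for `y` off the positive axis -/

section PlaneValues

/-- The bilinear combination of hypergeometric functions in the formula for `svCalF`. -/
def bilinF (a b c y : ℂ) : ℂ :=
  Complex.sin (Real.pi * b) * Complex.sin (Real.pi * (c - b)) * (eulerBeta b (c - b)) ^ 2
      * hypF a b c y * hypF a b c (conj y)
    - Complex.sin (Real.pi * a) * Complex.sin (Real.pi * (c - a)) * (‖y‖ : ℂ) ^ (2 * (1 - c))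
      * compH a b c y * compH a b c (conj y)

/-- The bilinear combination of hypergeometric functions in the formula for `svCalG`. -/
def bilinG (a b c y : ℂ) : ℂ :=
  Complex.sin (Real.pi * b) * Complex.sin (Real.pi * (c - b)) * eulerBeta b (c - b)
      * eulerBeta (b + 1) (c + 2 - (b + 1))
      * hypF a b c y * hypF (a + 1) (b + 1) (c + 2) (conj y)
    - Complex.sin (Real.pi * a) * Complex.sin (Real.pi * (c - a)) * (‖y‖ : ℂ) ^ (2 * (1 - c))
      * (conj y ^ 2)⁻¹ * compH a b c y * compH (a + 1) (b + 1) (c + 2) (conj y)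

variable {a b c y : ℂ}

theorem exists_log_of_neg_mem_slitPlane (hy : -y ∈ Complex.slitPlane) :
    ∃ w : ℂ, Complex.exp (-w) = y ∧ 0 < w.im ∧ w.im < 2 * Real.pi := by
  have h0 := Complex.slitPlane_ne_zero hy
  refine ⟨-Complex.log (-y) + Real.pi * Complex.I, ?_, ?_, ?_⟩
  · rw [neg_add, neg_neg, ← sub_eq_add_neg, Complex.exp_sub, Complex.exp_log h0,
      Complex.exp_pi_mul_I]
    ring
  · have := (Complex.arg_le_pi (-y)).lt_of_ne (Complex.mem_slitPlane_iff_arg.1 hy).1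
    simp [Complex.log_im]; linarith
  · have := Complex.neg_pi_lt_arg (-y)
    simp [Complex.log_im]; linarith

theorem norm_exp_neg_cpow (w s : ℂ) : (‖Complex.exp (-w)‖ : ℂ) ^ s
    = Complex.exp (-(w + conj w) / 2 * s) := by
  rw [Complex.norm_exp, ofReal_exp_cpow, Complex.add_conj, Complex.neg_re]
  congr 1
  push_cast
  ring

theorem expF_mem_planeDomain (hb : 0 < b.re) (hcb : b.re < c.re) (hac : c.re < a.re + 1)
    (ha : a.re < 1) : expF a b c ∈ planeDomain := by
  constructor
  · intro i
    fin_cases i <;> simp [expF] <;> linarith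
  · simp [expF, Fin.sum_univ_three]; linarith

theorem expG_mem_planeDomain (hb : -(1 / 2) < b.re) (hcb : b.re < c.re + 1 / 2)
    (hac : c.re + 1 / 2 < a.re + 1) (ha : a.re + 1 < 3 / 2) : expG a b c ∈ planeDomain := by
  constructor
  · intro i
    fin_cases i <;> simp [expG] <;> linarith
  · simp [expG, Fin.sum_univ_three]; linarith

theorem ne_of_neg_mem_slitPlane (hy : -y ∈ Complex.slitPlane) :
    y ≠ 0 ∧ y ≠ 1 ∧ y ∈ cutPlane := by
  refine ⟨?_, ?_, ?_⟩
  · rintro rfl; simp at hy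
  · rintro rfl
    simp [Complex.mem_slitPlane_iff] at hy
    linarith
  · rw [Complex.mem_slitPlane_iff] at hy
    change 1 - y ∈ Complex.slitPlane
    rw [Complex.mem_slitPlane_iff]
    rcases hy with h | h
    · left; simp at h ⊢; linarith
    · right; simpa using h

theorem integral_expF_of_neg_mem_slitPlane (h : (a, b, c) ∈ genericParams)
    (hb : 0 < b.re) (hcb : b.re < c.re) (hac : c.re < a.re + 1) (ha : a.re < 1)
    (hy : -y ∈ Complex.slitPlane) :
    Complex.sin (Real.pi * c) * ∫ z, planePow y (expF a b c) z * 1 = bilinF a b c y := by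
  obtain ⟨hy0, hy1, hyc⟩ := ne_of_neg_mem_slitPlane hy
  have hyc' := conj_mem_cutPlane hyc
  have hint := integrable_planePow hy0 hy1 (expF_mem_planeDomain hb hcb hac ha)
    (u := fun _ => 1) (k := 1) measurable_const (fun _ => by simp)
  obtain ⟨w, rfl, hw0, hw1⟩ := exists_log_of_neg_mem_slitPlane hy
  obtain ⟨h1, h2⟩ := log_polar_transfer
    (f := fun z => planePow (Complex.exp (-w)) (expF a b c) z * 1)
    ((measurable_planePow _ _).mul measurable_const) hint
    fun θ h0 h1 ρ => planePow_expF_log a b c h0 h1 hw0 hw1 ρ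
  rw [h2, plane_formula_F h hb hcb hac ha hw0 hw1 h1, bilinF]
  rw [← Complex.exp_conj, map_neg] at hyc' ⊢
  rw [eulerIntegral_eq hb (by simpa using hcb) hyc, eulerIntegral_eq hb (by simpa using hcb) hyc',
    norm_exp_neg_cpow, show -(w + conj w) / 2 * (2 * (1 - c)) = (c - 1) * (w + conj w) by ring]
  ring

theorem integral_expG_of_neg_mem_slitPlane (h : (a, b, c) ∈ genericParams)
    (hb : 0 < b.re) (hcb : b.re < c.re) (hac : c.re < a.re + 1 / 2) (ha : a.re < 0)
    (hy : -y ∈ Complex.slitPlane) :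
    Complex.sin (Real.pi * c) * ∫ z, planePow y (expG a b c) z * phaseG y z = bilinG a b c y := by
  obtain ⟨hy0, hy1, hyc⟩ := ne_of_neg_mem_slitPlane hy
  have hyc' := conj_mem_cutPlane hyc
  have hint := integrable_planePow hy0 hy1 (expG_mem_planeDomain (a := a) (b := b) (c := c)
    (by linarith) (by linarith) (by linarith) (by linarith)) (measurable_phaseG y)
    (norm_phaseG_le y)
  obtain ⟨w, rfl, hw0, hw1⟩ := exists_log_of_neg_mem_slitPlane hy
  obtain ⟨h1, h2⟩ := log_polar_transfer
    (f := fun z => planePow (Complex.exp (-w)) (expG a b c) z * phaseG (Complex.exp (-w)) z)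
    ((measurable_planePow _ _).mul (measurable_phaseG _)) hint
    fun θ h0 h1 ρ => planePow_expG_log a b c h0 h1 hw0 hw1 ρ
  rw [h2, plane_formula_G h hb hcb hac ha hw0 hw1 h1, bilinG]
  rw [← Complex.exp_conj, map_neg] at hyc' ⊢
  have e : Complex.exp ((c - 1) * w + (c + 1) * conj w)
      = Complex.exp ((c - 1) * (w + conj w)) * (Complex.exp (-conj w) ^ 2)⁻¹ := by
    rw [sq, ← Complex.exp_add, ← Complex.exp_neg, ← Complex.exp_add]; ring_nf
  rw [eulerIntegral_eq hb (by simpa using hcb) hyc, eulerIntegral_eq (by simp; linarith)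
    (by simp; linarith) hyc', norm_exp_neg_cpow, e,
    show -(w + conj w) / 2 * (2 * (1 - c)) = (c - 1) * (w + conj w) by ring]
  ring

end PlaneValues

/-! ### The case `0 < y < 1` by continuity -/

section PositiveArgument

variable {a b c y : ℂ} {r : ℝ}

theorem continuousAt_hypF (hc : ∀ k : ℕ, c ≠ -k) (hy : y ∈ cutPlane) :
    ContinuousAt (hypF a b c) y := by
  have := (differentiableAt_hypF (a := a) (b := b) hc hy).continuousAt
  exact this.comp (f := fun y : ℂ => (a, b, c, y)) (by fun_prop)

theorem continuousAt_compH (h : (a, b, c) ∈ genericParams) (hy : y ∈ cutPlane) :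
    ContinuousAt (compH a b c) y := by
  refine ContinuousAt.mul continuousAt_const (continuousAt_hypF ?_ hy)
  intro k hk
  exact h.2.2.1 (2 + k) (by push_cast; linear_combination -hk)

theorem continuousAt_bilinF (h : (a, b, c) ∈ genericParams) (hy : y ∈ cutPlane) (hy0 : y ≠ 0) :
    ContinuousAt (bilinF a b c) y := by
  have h1 : ContinuousAt (fun y : ℂ => conj y) y := Complex.continuous_conj.continuousAt
  have h2 := (continuousAt_hypF (a := a) (b := b) h.2.2.1.ne_neg_nat (conj_mem_cutPlane hy)).comp
    (f := fun y : ℂ => conj y) h1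
  have h3 := (continuousAt_compH h (conj_mem_cutPlane hy)).comp (f := fun y : ℂ => conj y) h1
  have h4 : ContinuousAt (fun y : ℂ => (‖y‖ : ℂ) ^ (2 * (1 - c))) y :=
    ContinuousAt.cpow (by fun_prop) continuousAt_const (Complex.ofReal_mem_slitPlane.2 (norm_pos_iff.2 hy0))
  have h5 := continuousAt_hypF (a := a) (b := b) h.2.2.1.ne_neg_nat hy
  have h6 := continuousAt_compH h hy
  exact ((continuousAt_const.mul h5).mul h2).sub (((continuousAt_const.mul h4).mul h6).mul h3)

theorem continuousAt_bilinG (h : (a, b, c) ∈ genericParams) (hy : y ∈ cutPlane) (hy0 : y ≠ 0) :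
    ContinuousAt (bilinG a b c) y := by
  have h' : (a + 1, b + 1, c + 2) ∈ genericParams := by
    have := mem_genericParams_shift h 1 1 2
    simpa [add_comm] using this
  have h1 : ContinuousAt (fun y : ℂ => conj y) y := Complex.continuous_conj.continuousAt
  have h2 := (continuousAt_hypF (a := a + 1) (b := b + 1) h'.2.2.1.ne_neg_nat
    (conj_mem_cutPlane hy)).comp (f := fun y : ℂ => conj y) h1
  have h3 := (continuousAt_compH h' (conj_mem_cutPlane hy)).comp (f := fun y : ℂ => conj y) h1
  have h4 : ContinuousAt (fun y : ℂ => (‖y‖ : ℂ) ^ (2 * (1 - c))) y :=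
    ContinuousAt.cpow (by fun_prop) continuousAt_const (Complex.ofReal_mem_slitPlane.2 (norm_pos_iff.2 hy0))
  have h5 := continuousAt_hypF (a := a) (b := b) h.2.2.1.ne_neg_nat hy
  have h6 := continuousAt_compH h hy
  have h7 : ContinuousAt (fun y : ℂ => (conj y ^ 2)⁻¹) y :=
    (h1.pow 2).inv₀ (pow_ne_zero 2 (by simpa using hy0))
  exact ((continuousAt_const.mul h5).mul h2).sub
    ((((continuousAt_const.mul h4).mul h7).mul h6).mul h3)

/-- The radial lower bounds for the distances to the branch points. -/
def radialDist (r : ℝ) : Fin 3 → ℂ → ℝ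
  | 0 => fun z => ‖z‖
  | 1 => fun z => ‖1 - z‖
  | 2 => fun z => r * |‖z‖ - r⁻¹|

theorem integrable_radialDist (hr0 : 0 < r) (hr1 : r < 1) {e : Fin 3 → ℝ} (h0 : -2 < e 0)
    (h1 : -2 < e 1) (h2 : -1 < e 2) (hsum : ∑ i, e i < -2) :
    Integrable fun z => ∏ i, radialDist r i z ^ e i := by
  have hri : 1 < r⁻¹ := (one_lt_inv₀ hr0).2 hr1
  set δ := min 1 (r⁻¹ - 1) / 2
  have hδ : 0 < δ := half_pos (lt_min one_pos (by linarith))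
  have hδ1 : 2 * δ ≤ 1 := by
    have := min_le_left 1 (r⁻¹ - 1)
    simp only [δ]; linarith
  have hδ2 : 2 * δ ≤ r⁻¹ - 1 := by
    have := min_le_right 1 (r⁻¹ - 1)
    simp only [δ]; linarith
  refine integrable_prod_rpow (δ := ![δ, δ, r * δ]) (e₀ := ![-2, -2, -1]) (fun i => ?_) ?_ ?_ hsum
  · fin_cases i
    · simpa [radialDist] using singDist_norm_sub 0 hδ
    · have := singDist_norm_sub 1 hδ
      simp_rw [norm_sub_rev _ (1 : ℂ)] at this
      exact this
    · exact (singDist_abs_norm_sub (inv_pos.2 hr0).le hδ (by linarith)).const_mul hr0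
  · have key (z : ℂ) : ¬ (‖z‖ < δ ∧ ‖1 - z‖ < δ) := by
      rintro ⟨h, h'⟩
      have := norm_add_le z (1 - z)
      rw [add_sub_cancel, norm_one] at this
      linarith
    have key2 (z : ℂ) : ¬ (‖z‖ < δ ∧ r * |‖z‖ - r⁻¹| < r * δ) := by
      rintro ⟨h, h'⟩
      have h' := abs_lt.1 ((mul_lt_mul_iff_right₀ hr0).1 h')
      linarith [h'.1]
    have key3 (z : ℂ) : ¬ (‖1 - z‖ < δ ∧ r * |‖z‖ - r⁻¹| < r * δ) := by
      rintro ⟨h, h'⟩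
      have h' := abs_lt.1 ((mul_lt_mul_iff_right₀ hr0).1 h')
      have := norm_sub_le (1 : ℂ) (1 - z)
      rw [sub_sub_cancel, norm_one] at this
      linarith [h'.1]
    intro i j z h h'
    fin_cases i <;> fin_cases j <;> first | rfl | exfalso
    · exact key z ⟨h, h'⟩
    · exact key2 z ⟨h, h'⟩
    · exact key z ⟨h', h⟩
    · exact key3 z ⟨h, h'⟩
    · exact key2 z ⟨h', h⟩
    · exact key3 z ⟨h', h⟩
  · intro i
    fin_cases i
    · exact h0
    · exact h1
    · exact h2

/-- The reverse triangle inequality bounds the third distance below by a quantity depending on `y`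
only through `|y|`, hence uniformly on a circle. -/
theorem radialDist_le (hr : 0 < r) (hy : ‖y‖ = r) (z : ℂ) : radialDist r 2 z ≤ branchDist y 2 z := by
  have := abs_norm_sub_norm_le (z * y) 1
  rw [norm_sub_rev, norm_mul, hy, norm_one] at this
  have e : |‖z‖ * r - 1| = r * |‖z‖ - r⁻¹| := by
    rw [← abs_of_pos hr, ← abs_mul, abs_of_pos hr, mul_sub, mul_inv_cancel₀ hr.ne', mul_comm]
  rw [e] at this
  exact this

theorem ae_radialDist_pos (hr : 0 < r) : ∀ᵐ z, 0 < radialDist r 2 z := by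
  have h1 : ∀ᵐ z : ℂ, z ∉ Metric.sphere 0 r⁻¹ :=
    compl_mem_ae_iff.2 (Measure.addHaar_sphere_of_ne_zero volume 0 (inv_pos.2 hr).ne')
  filter_upwards [h1] with z hz
  refine mul_pos hr (abs_pos.2 (sub_ne_zero.2 fun h => hz ?_))
  simpa using h

/-- Continuity of the plane integral along the circle through a point of `(0, 1)`. -/
theorem tendsto_integral_planePow (hr0 : 0 < r) (hr1 : r < 1) {s : Fin 3 → ℂ}
    (hs : s ∈ planeDomain) (h2 : -1 < (s 2).re) (h2' : (s 2).re ≤ 0) {l : Filter ℝ}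
    [l.IsCountablyGenerated] {Y : ℝ → ℂ} (hY : ∀ φ, ‖Y φ‖ = r) (hl : Tendsto Y l (𝓝 (r : ℂ)))
    {u : ℂ → ℂ → ℂ} {k : ℝ} (hu : ∀ y, Measurable (u y)) (hu1 : ∀ y z, ‖u y z‖ ≤ k)
    (hul : ∀ᵐ z, ContinuousAt (fun y => u y z) r) :
    Tendsto (fun φ => ∫ z, planePow (Y φ) s z * u (Y φ) z) l
      (𝓝 (∫ z, planePow r s z * u r z)) := by
  refine tendsto_integral_filter_of_dominated_convergence
    (fun z => (∏ i, radialDist r i z ^ (s i).re) * k) (Eventually.of_forall fun φ =>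
      ((measurable_planePow _ s).mul (hu _)).aestronglyMeasurable) (Eventually.of_forall fun φ => ?_)
    ((integrable_radialDist hr0 hr1 (hs.1 0) (hs.1 1) h2 hs.2).mul_const k) ?_
  · filter_upwards [ae_radialDist_pos hr0] with z hz
    have hnn (i : Fin 3) : 0 ≤ radialDist r i z := by
      fin_cases i
      · exact norm_nonneg _
      · exact norm_nonneg _
      · exact hz.le
    rw [norm_mul]
    refine mul_le_mul ((norm_planePow_le _ s z).trans (Finset.prod_le_prod
      (fun i _ => Real.rpow_nonneg (branchDist_nonneg _ i z) _) fun i _ => ?_)) (hu1 _ z)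
      (norm_nonneg _) (Finset.prod_nonneg fun i _ => Real.rpow_nonneg (hnn i) _)
    fin_cases i
    · exact le_rfl
    · exact le_rfl
    · exact Real.rpow_le_rpow_of_nonpos hz (radialDist_le hr0 (hY φ) z) h2'
  · filter_upwards [ae_branchDist_pos (r : ℂ), hul] with z hz hz2
    refine Tendsto.comp (g := fun y => planePow y s z * u y z) ?_ hl
    refine Tendsto.mul ?_ hz2
    simp only [planePow, Fin.prod_univ_three]
    refine Tendsto.mul (Tendsto.mul tendsto_const_nhds tendsto_const_nhds) ?_
    refine ContinuousAt.tendsto (f := fun y : ℂ => (branchDist y 2 z : ℂ) ^ s 2) ?_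
    refine ContinuousAt.cpow ?_ continuousAt_const (Complex.ofReal_mem_slitPlane.2 (hz 2))
    simp only [branchDist]
    fun_prop

/-- The points `r e^(iφ)` with small `φ > 0` lie off the real axis, where the identity is known, and
they tend to `r`. -/
theorem eq_of_tendsto_circle {I R : ℂ → ℂ} {r : ℝ} (hr0 : 0 < r)
    (hI : ∀ Y : ℝ → ℂ, (∀ φ, ‖Y φ‖ = r) → Tendsto Y (𝓝[>] 0) (𝓝 (r : ℂ)) →
      Tendsto (fun φ => I (Y φ)) (𝓝[>] 0) (𝓝 (I r)))
    (hR : ContinuousAt R r) (h : ∀ y, -y ∈ Complex.slitPlane → I y = R y) : I r = R r := by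
  set Y : ℝ → ℂ := fun φ => r * Complex.exp (φ * Complex.I)
  have hYn (φ : ℝ) : ‖Y φ‖ = r := by
    simp only [Y, norm_mul, Complex.norm_exp_ofReal_mul_I, mul_one, Complex.norm_real,
      Real.norm_of_nonneg hr0.le]
  have hYt : Tendsto Y (𝓝[>] 0) (𝓝 (r : ℂ)) := by
    have : Continuous Y := by fun_prop
    have h1 := this.tendsto 0
    simp only [Y, Complex.ofReal_zero, zero_mul, Complex.exp_zero, mul_one] at h1
    exact h1.mono_left nhdsWithin_le_nhds
  refine tendsto_nhds_unique ((hI Y hYn hYt).congr' ?_) (hR.tendsto.comp hYt)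
  filter_upwards [Ioo_mem_nhdsGT Real.pi_pos] with φ hφ
  refine h _ ?_
  rw [Complex.mem_slitPlane_iff]
  right
  simp only [Y, Complex.neg_im, Complex.im_ofReal_mul, Complex.exp_ofReal_mul_I_im, neg_ne_zero]
  exact (mul_pos hr0 (Real.sin_pos_of_pos_of_lt_pi hφ.1 hφ.2)).ne'

theorem eq_ofReal_of_notMem (hy : y ∈ cutPlane) (hy0 : y ≠ 0) (h : -y ∉ Complex.slitPlane) :
    ∃ r : ℝ, 0 < r ∧ r < 1 ∧ y = r := by
  rw [Complex.mem_slitPlane_iff] at h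
  push Not at h
  have him : y.im = 0 := by simpa using h.2
  have hre : 0 ≤ y.re := by simpa using h.1
  have e : y = (y.re : ℂ) := Complex.ext (by simp) (by simpa using him)
  refine ⟨y.re, hre.lt_of_ne fun h0 => hy0 (by rw [e, ← h0]; simp), ?_, e⟩
  have hy : 1 - y ∈ Complex.slitPlane := hy
  rw [Complex.mem_slitPlane_iff] at hy
  simp [him] at hy
  linarith

/-- For `0 < y < 1` both branch points lie on one ray and the strip argument does not apply.
Dominated convergence along the circle does, as soon as the third exponent has real part `-2 Re a`
in `(-1, 0]`; hence the restriction on `Re a`. -/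
theorem integral_expF (h : (a, b, c) ∈ genericParams) (hb : 0 < b.re) (hcb : b.re < c.re)
    (hac : c.re < a.re + 1) (ha0 : 0 < a.re) (ha : a.re < 1 / 2) (hy : y ∈ cutPlane)
    (hy0 : y ≠ 0) :
    Complex.sin (Real.pi * c) * ∫ z, planePow y (expF a b c) z * 1 = bilinF a b c y := by
  by_cases hs : -y ∈ Complex.slitPlane
  · exact integral_expF_of_neg_mem_slitPlane h hb hcb hac (by linarith) hs
  obtain ⟨r, hr0, hr1, rfl⟩ := eq_ofReal_of_notMem hy hy0 hs
  refine eq_of_tendsto_circle hr0 (fun Y hY hYt => ?_) (continuousAt_bilinF h hy hy0)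
    fun y hy => integral_expF_of_neg_mem_slitPlane h hb hcb hac (by linarith) hy
  refine Tendsto.const_mul _ (tendsto_integral_planePow hr0 hr1
    (expF_mem_planeDomain hb hcb hac (by linarith)) ?_ ?_ hY hYt (u := fun _ _ => 1) (k := 1)
    (fun _ => measurable_const) (fun _ _ => by simp) (ae_of_all _ fun _ => continuousAt_const))
  · simp [expF]; linarith
  · simp [expF]; linarith

/-- The third exponent has real part `-2 Re a - 1`, which lies in `(-1, 0]` because the hypotheses
force `-1/2 < Re a < 0`. -/
theorem integral_expG (h : (a, b, c) ∈ genericParams) (hb : 0 < b.re) (hcb : b.re < c.re)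
    (hac : c.re < a.re + 1 / 2) (ha : a.re < 0) (hy : y ∈ cutPlane) (hy0 : y ≠ 0) :
    Complex.sin (Real.pi * c) * ∫ z, planePow y (expG a b c) z * phaseG y z = bilinG a b c y := by
  by_cases hs : -y ∈ Complex.slitPlane
  · exact integral_expG_of_neg_mem_slitPlane h hb hcb hac ha hs
  obtain ⟨r, hr0, hr1, rfl⟩ := eq_ofReal_of_notMem hy hy0 hs
  refine eq_of_tendsto_circle hr0 (fun Y hY hYt => ?_) (continuousAt_bilinG h hy hy0)
    fun y hy => integral_expG_of_neg_mem_slitPlane h hb hcb hac ha hy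
  refine Tendsto.const_mul _ (tendsto_integral_planePow hr0 hr1
    (expG_mem_planeDomain (a := a) (b := b) (c := c) (by linarith) (by linarith) (by linarith)
      (by linarith)) ?_ ?_ hY hYt (u := phaseG) measurable_phaseG norm_phaseG_le ?_)
  · simp [expG]; linarith
  · simp [expG]; linarith
  · filter_upwards [ae_branchDist_pos (r : ℂ)] with z hz
    have h1 : 1 - conj (r : ℂ) * conj z ≠ 0 := by
      have := norm_pos_iff.1 (hz 2)
      rw [← map_mul, mul_comm, ← map_one (starRingEnd ℂ), ← map_sub]
      exact (map_ne_zero _).2 this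
    unfold phaseG
    refine ContinuousAt.mul continuousAt_const (ContinuousAt.div (by fun_prop) ?_ h1)
    exact Continuous.continuousAt (by
      have := Complex.continuous_conj
      fun_prop)

end PositiveArgument

/-! ### Euler's beta function and its single-valued version -/

section Beta

theorem NotInt.ne_zero {s : ℂ} (hs : NotInt s) : s ≠ 0 := by simpa using hs 0

theorem NotInt.sin_ne_zero {s : ℂ} (hs : NotInt s) : Complex.sin (Real.pi * s) ≠ 0 := by
  rw [Complex.sin_ne_zero_iff]
  intro k h
  have hpi : (Real.pi : ℂ) ≠ 0 := by exact_mod_cast Real.pi_ne_zero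
  refine hs k (mul_left_cancel₀ hpi ?_)
  rw [h, mul_comm]

theorem Gamma_mul_Gamma_neg {s : ℂ} (hs : s ≠ 0) :
    Complex.Gamma s * Complex.Gamma (-s) = -(Real.pi / (s * Complex.sin (Real.pi * s))) := by
  have h1 := Complex.Gamma_mul_Gamma_one_sub s
  rw [show 1 - s = -s + 1 by ring, Complex.Gamma_add_one _ (neg_ne_zero.2 hs)] at h1
  rw [mul_comm s, ← div_div, ← h1]
  field_simp

theorem eulerBeta_mul_neg {s t : ℂ} (hs : NotInt s) (ht : NotInt t) (hst : NotInt (s + t)) :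
    eulerBeta s t * eulerBeta (-s) (-t) = -(Real.pi * (s + t) * Complex.sin (Real.pi * (s + t))
      / (s * t * Complex.sin (Real.pi * s) * Complex.sin (Real.pi * t))) := by
  have h1 := Gamma_mul_Gamma_neg hs.ne_zero
  have h2 := Gamma_mul_Gamma_neg ht.ne_zero
  have h3 := Gamma_mul_Gamma_neg hst.ne_zero
  have hpi : (Real.pi : ℂ) ≠ 0 := by exact_mod_cast Real.pi_ne_zero
  have k1 := hs.ne_zero
  have k2 := ht.ne_zero
  have k3 := hst.ne_zero
  have k4 := hs.sin_ne_zero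
  have k5 := ht.sin_ne_zero
  have k6 := hst.sin_ne_zero
  rw [eulerBeta, eulerBeta, show -s + -t = -(s + t) by ring, div_mul_div_comm, h3,
    show Complex.Gamma s * Complex.Gamma t * (Complex.Gamma (-s) * Complex.Gamma (-t))
    = (Complex.Gamma s * Complex.Gamma (-s)) * (Complex.Gamma t * Complex.Gamma (-t)) by ring,
    h1, h2]
  field_simp

theorem eulerBeta_add_one {s t : ℂ} (hs : NotInt s) (ht : NotInt t) (hst : NotInt (s + t)) :
    eulerBeta (s + 1) (t + 1) = s * t / ((s + t) * (s + t + 1)) * eulerBeta s t := by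
  have h1 : s + t + 1 ≠ 0 := fun h => hst (-1) (by push_cast; linear_combination h)
  have h2 := Complex.Gamma_ne_zero hst.ne_neg_nat
  have k3 := hst.ne_zero
  rw [eulerBeta, eulerBeta, show s + 1 + (t + 1) = s + t + 1 + 1 by ring,
    Complex.Gamma_add_one _ hs.ne_zero, Complex.Gamma_add_one _ ht.ne_zero,
    Complex.Gamma_add_one _ h1, Complex.Gamma_add_one _ k3]
  field_simp

theorem NotInt.eulerBeta_ne_zero {s t : ℂ} (hs : NotInt s) (ht : NotInt t)
    (hst : NotInt (s + t)) : eulerBeta s t ≠ 0 :=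
  _root_.eulerBeta_ne_zero hs.ne_neg_nat ht.ne_neg_nat hst.ne_neg_nat

theorem eulerIntegral_zero {b c : ℂ} (hb : 0 < b.re) (hcb : b.re < c.re) (y : ℂ) :
    eulerIntegral 0 b c y = eulerBeta b (c - b) := by
  have h1 : eulerIntegral 0 b c y = eulerIntegral 0 b c 0 := by
    simp only [eulerIntegral, neg_zero, Complex.cpow_zero]
  rw [h1, eulerIntegral_eq_of_norm_lt_one hb (by simpa using hcb) (by simp)]
  simp

/-- For `a = 0` the third factor is `1`, so any argument may be used, here `-1`, and `sin(πa) = 0`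
removes the companion terms. The triple `(0, b, c)` is not generic, hence the detour through
`plane_formula_aux`. -/
theorem integral_expF_zero {b c : ℂ} (hb : 0 < b.re) (hcb : b.re < c.re) (hc : c.re < 1) :
    Complex.sin (Real.pi * c) * ∫ z, planePow (-1) (expF 0 b c) z * 1
      = Complex.sin (Real.pi * b) * Complex.sin (Real.pi * (c - b)) * eulerBeta b (c - b) ^ 2 := by
  have hint := integrable_planePow (y := -1) (by simp) (by norm_num)
    (expF_mem_planeDomain (a := 0) hb hcb (by simpa using hc) (by simp))
    (u := fun _ => 1) (k := 1) measurable_const (fun _ => by simp)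
  obtain ⟨w, hw, hw0, hw1⟩ := exists_log_of_neg_mem_slitPlane (y := -1) (by simp)
  rw [← hw] at hint ⊢
  obtain ⟨h1, h2⟩ := log_polar_transfer
    (f := fun z => planePow (Complex.exp (-w)) (expF 0 b c) z * 1)
    ((measurable_planePow _ _).mul measurable_const) hint
    fun θ h0 h1 ρ => planePow_expF_log 0 b c h0 h1 hw0 hw1 ρ
  have hmin1 := min_le_left b.re (1 - c.re)
  have hmin2 := min_le_right b.re (1 - c.re)
  have hmin : 0 < min b.re (1 - c.re) := lt_min hb (by linarith)
  rw [h2, plane_formula_aux (k := 0) (m := 0) (n := 0) (lam := min b.re (1 - c.re) / 2)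
    ?_ hb hcb (by simpa using hc) (by simp) hw0 hw1 (by simp) (by simp) (by simp) h1,
    eulerIntegral_zero hb hcb, eulerIntegral_zero hb hcb]
  · simp only [mul_zero, Complex.sin_zero, zero_mul, sub_zero, add_zero]
    ring
  · constructor <;> (try simp only [Complex.sub_re, Complex.one_re, Complex.neg_re,
      Complex.zero_re]) <;> linarith

/-- The linear forms that must not be integers for the single-valued beta function. -/
def betaForms : Fin 3 → (ℂ × ℂ →ₗ[ℂ] ℂ) :=
  ![LinearMap.fst ℂ ℂ ℂ, LinearMap.snd ℂ ℂ ℂ, LinearMap.fst ℂ ℂ ℂ + LinearMap.snd ℂ ℂ ℂ]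

theorem svBeta_eq {s t : ℂ} (hs : NotInt s) (ht : NotInt t) (hst : NotInt (s + t)) :
    svBeta s t = eulerBeta s t ^ 2 * Complex.sin (Real.pi * s) * Complex.sin (Real.pi * t)
      / (Real.pi * Complex.sin (Real.pi * (s + t))) := by
  have hpi : (Real.pi : ℂ) ≠ 0 := by exact_mod_cast Real.pi_ne_zero
  set D := {p : ℂ × ℂ | NotInt p.1 ∧ NotInt p.2 ∧ NotInt (p.1 + p.2)}
  have hD : D = {p | ∀ i, NotInt (betaForms i p)} := by
    ext p
    simp [D, betaForms, Fin.forall_fin_succ]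
  have hDo : IsOpen D := by
    have e : D = ⋂ i, {p | NotInt (betaForms i p)} := by rw [hD]; ext; simp
    rw [e]
    exact isOpen_iInter_of_finite fun i =>
      isOpen_setOf_notInt.preimage (betaForms i).continuous_of_finiteDimensional
  have hDl : LineGeneric D := by rw [hD]; exact lineGeneric_iInter_notInt _
  have hU : IsOpen {p : ℂ × ℂ | 0 < p.1.re ∧ 0 < p.2.re ∧ (p.1 + p.2).re < 1} :=
    (isOpen_lt continuous_const (Complex.continuous_re.comp continuous_fst)).inter
      ((isOpen_lt continuous_const (Complex.continuous_re.comp continuous_snd)).inter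
      (isOpen_lt (Complex.continuous_re.comp (continuous_fst.add continuous_snd)) continuous_const))
  have hni (x : ℝ) (h0 : 0 < x) (h1 : x < 1) : NotInt (x : ℂ) := by
    intro n h
    have h : x = n := by exact_mod_cast h
    rw [h] at h0 h1
    have h0 : (0 : ℤ) < n := by exact_mod_cast h0
    have h1 : n < (1 : ℤ) := by exact_mod_cast h1
    omega
  refine holoCont_eq_of_lineGeneric (p := (s, t)) (f := fun p : ℂ × ℂ => eulerBeta p.1 p.2 ^ 2
    * Complex.sin (Real.pi * p.1) * Complex.sin (Real.pi * p.2)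
    / (Real.pi * Complex.sin (Real.pi * (p.1 + p.2)))) hDo hDl hU ?_ ?_ ?_ ⟨hs, ht, hst⟩
  · refine ⟨(((1 / 4 : ℝ) : ℂ), ((1 / 4 : ℝ) : ℂ)), ⟨hni _ (by norm_num) (by norm_num),
      hni _ (by norm_num) (by norm_num), ?_⟩, ?_⟩
    · rw [← Complex.ofReal_add]
      exact hni _ (by norm_num) (by norm_num)
    · refine ⟨?_, ?_, ?_⟩ <;> simp <;> norm_num
  · intro p hp
    refine DifferentiableAt.differentiableWithinAt (DifferentiableAt.div_of_ne ?_ (by fun_prop)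
      (mul_ne_zero hpi hp.2.2.sin_ne_zero))
    refine DifferentiableAt.mul (DifferentiableAt.mul (DifferentiableAt.pow ?_ 2) (by fun_prop))
      (by fun_prop)
    exact DifferentiableAt.eulerBeta (by fun_prop) (by fun_prop) hp.1.ne_neg_nat hp.2.1.ne_neg_nat
      hp.2.2.ne_neg_nat
  · rintro p ⟨hp, h1, h2, h3⟩
    have key := integral_expF_zero (b := p.1) (c := p.1 + p.2) h1 (by simpa using h2) h3
    have e := svIntegral_F 0 p.1 (p.1 + p.2) (-1)
    have hsin := hp.2.2.sin_ne_zero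
    simp only [svWeight, mul_zero, Complex.cpow_zero, mul_one, add_sub_cancel_left] at e key
    simp only
    rw [e]
    field_simp
    linear_combination -key

end Beta

/-! ### Holomorphic dependence of the bilinear forms on the parameters -/

section Continuation

variable {a b c y : ℂ}

theorem differentiableAt_hypF_params {p : ℂ × ℂ × ℂ} (hp : ∀ k : ℕ, p.2.2 ≠ -k)
    (hy : y ∈ cutPlane) :
    DifferentiableAt ℂ (fun p : ℂ × ℂ × ℂ => hypF p.1 p.2.1 p.2.2 y) p := by
  have := differentiableAt_hypF (a := p.1) (b := p.2.1) hp hy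
  exact this.comp (f := fun p : ℂ × ℂ × ℂ => (p.1, p.2.1, p.2.2, y)) p (by fun_prop)

theorem differentiableAt_norm_cpow {p : ℂ × ℂ × ℂ} (hy0 : y ≠ 0) :
    DifferentiableAt ℂ (fun p : ℂ × ℂ × ℂ => (‖y‖ : ℂ) ^ (2 * (1 - p.2.2))) p :=
  DifferentiableAt.const_cpow (by fun_prop) (Or.inl (by simpa using hy0))

theorem differentiableAt_bilinF {p : ℂ × ℂ × ℂ} (hp : p ∈ genericParams) (hy : y ∈ cutPlane)
    (hy0 : y ≠ 0) : DifferentiableAt ℂ (fun p : ℂ × ℂ × ℂ => bilinF p.1 p.2.1 p.2.2 y) p := by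
  obtain ⟨h1, h2, h3, h4, h5⟩ := id hp
  have hβ : DifferentiableAt ℂ (fun p : ℂ × ℂ × ℂ => eulerBeta p.2.1 (p.2.2 - p.2.1)) p :=
    DifferentiableAt.eulerBeta (by fun_prop) (by fun_prop) h2.ne_neg_nat h5.ne_neg_nat
      (by rw [add_sub_cancel]; exact h3.ne_neg_nat)
  have hF := differentiableAt_hypF_params h3.ne_neg_nat hy
  have hF' := differentiableAt_hypF_params h3.ne_neg_nat (conj_mem_cutPlane hy)
  have hH := differentiableAt_compH hp hy
  have hH' := differentiableAt_compH hp (conj_mem_cutPlane hy)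
  unfold bilinF
  exact ((((DifferentiableAt.mul (by fun_prop) (hβ.pow 2))).mul hF).mul hF').sub
    (((DifferentiableAt.mul (by fun_prop) (differentiableAt_norm_cpow hy0)).mul hH).mul hH')

theorem differentiableAt_bilinG {p : ℂ × ℂ × ℂ} (hp : p ∈ genericParams) (hy : y ∈ cutPlane)
    (hy0 : y ≠ 0) : DifferentiableAt ℂ (fun p : ℂ × ℂ × ℂ => bilinG p.1 p.2.1 p.2.2 y) p := by
  obtain ⟨h1, h2, h3, h4, h5⟩ := id hp
  have hp' : (p.1 + 1, p.2.1 + 1, p.2.2 + 2) ∈ genericParams := by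
    have := mem_genericParams_shift hp 1 1 2
    simpa [add_comm] using this
  have hd : DifferentiableAt ℂ (fun p : ℂ × ℂ × ℂ => (p.1 + 1, p.2.1 + 1, p.2.2 + 2)) p := by
    fun_prop
  have hβ : DifferentiableAt ℂ (fun p : ℂ × ℂ × ℂ => eulerBeta p.2.1 (p.2.2 - p.2.1)) p :=
    DifferentiableAt.eulerBeta (by fun_prop) (by fun_prop) h2.ne_neg_nat h5.ne_neg_nat
      (by rw [add_sub_cancel]; exact h3.ne_neg_nat)
  have hβ' : DifferentiableAt ℂ
      (fun p : ℂ × ℂ × ℂ => eulerBeta (p.2.1 + 1) (p.2.2 + 2 - (p.2.1 + 1))) p :=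
    DifferentiableAt.eulerBeta (by fun_prop) (by fun_prop) hp'.2.1.ne_neg_nat
      hp'.2.2.2.2.ne_neg_nat (by rw [add_sub_cancel]; exact hp'.2.2.1.ne_neg_nat)
  have hF := differentiableAt_hypF_params h3.ne_neg_nat hy
  have hF' := (differentiableAt_hypF_params (p := (p.1 + 1, p.2.1 + 1, p.2.2 + 2))
    hp'.2.2.1.ne_neg_nat (conj_mem_cutPlane hy)).comp p hd
  have hH := differentiableAt_compH hp hy
  have hH' := (differentiableAt_compH hp' (conj_mem_cutPlane hy)).comp p hd
  unfold bilinG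
  exact (((((DifferentiableAt.mul (by fun_prop) hβ).mul hβ')).mul hF).mul hF').sub
    ((((DifferentiableAt.mul (by fun_prop) (differentiableAt_norm_cpow hy0)).mul_const _).mul
      hH).mul hH')

theorem differentiable_expF : Differentiable ℂ fun p : ℂ × ℂ × ℂ => expF p.1 p.2.1 p.2.2 := by
  rw [differentiable_pi]
  intro i
  fin_cases i <;> simp [expF] <;> fun_prop

theorem differentiable_expG : Differentiable ℂ fun p : ℂ × ℂ × ℂ => expG p.1 p.2.1 p.2.2 := by
  rw [differentiable_pi]
  intro i
  fin_cases i <;> simp [expG] <;> fun_prop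

end Continuation

/-! ### Evaluation of the single-valued functions at all generic parameters -/

section SingleValued

variable {a b c y : ℂ}

/-- An integral which is holomorphic on the convex open set `U` is continued by any holomorphic
function on the generic parameters which agrees with it on a nonempty open subset of `U`. -/
theorem holoCont_genericParams_eq {U W : Set (ℂ × ℂ × ℂ)} (hU : IsOpen U) (hUc : Convex ℝ U)
    (hW : IsOpen W) (hne : W.Nonempty) (hWU : W ⊆ U) {I f : ℂ × ℂ × ℂ → ℂ}
    (hI : ∀ p ∈ U, DifferentiableAt ℂ I p) (hf : ∀ p ∈ genericParams, DifferentiableAt ℂ f p)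
    (hfI : ∀ p ∈ genericParams ∩ W, f p = I p) {p : ℂ × ℂ × ℂ} (hp : p ∈ genericParams) :
    holoCont genericParams U I p = f p := by
  obtain ⟨q, hq⟩ := exists_generic_mem_of_isOpen hW hne
  have key := eqOn_of_eventuallyEq_of_lineGeneric hU hUc isOpen_genericParams
    lineGeneric_genericParams (f := f) (g := I) ⟨hWU hq.2, hq.1⟩
    (fun p hp => (hf p hp.2).differentiableWithinAt)
    (fun p hp => (hI p hp.1).differentiableWithinAt)
    (Filter.eventuallyEq_of_mem ((isOpen_genericParams.inter hW).mem_nhds hq) hfI)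
  exact holoCont_eq_of_lineGeneric isOpen_genericParams lineGeneric_genericParams hU
    ⟨q, hq.1, hWU hq.2⟩ (fun p hp => (hf p hp).differentiableWithinAt)
    (fun p hp => key ⟨hp.2, hp.1⟩) hp

theorem convex_setOf_re_lt (r s t : ℝ) (x : ℝ) :
    Convex ℝ {p : ℂ × ℂ × ℂ | r * p.1.re + s * p.2.1.re + t * p.2.2.re < x} :=
  convex_halfSpace_lt ⟨fun p q => by simp; ring, fun k p => by simp; ring⟩ x

theorem isOpen_setOf_re_combination_lt (r s t : ℝ) (x : ℝ) :
    IsOpen {p : ℂ × ℂ × ℂ | r * p.1.re + s * p.2.1.re + t * p.2.2.re < x} :=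
  isOpen_lt (by fun_prop) continuous_const

theorem ne_one_of_mem_cutPlane (hy : y ∈ cutPlane) : y ≠ 1 := by
  rintro rfl
  simp [cutPlane] at hy

theorem svCalF_eq (h : (a, b, c) ∈ genericParams) (hy : y ∈ cutPlane) (hy0 : y ≠ 0) :
    svCalF a b c y = bilinF a b c y / (Real.pi * Complex.sin (Real.pi * c)) := by
  have hU : {p : ℂ × ℂ × ℂ | 0 < p.2.1.re ∧ p.2.1.re < p.2.2.re ∧ p.2.2.re < p.1.re + 1 ∧
      p.1.re + 1 < 2} = {p | 0 * p.1.re + (-1) * p.2.1.re + 0 * p.2.2.re < 0} ∩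
      ({p | 0 * p.1.re + 1 * p.2.1.re + (-1) * p.2.2.re < 0} ∩
      ({p | (-1) * p.1.re + 0 * p.2.1.re + 1 * p.2.2.re < 1} ∩
      {p | 1 * p.1.re + 0 * p.2.1.re + 0 * p.2.2.re < 1})) := by
    ext p
    constructor
    · rintro ⟨h1, h2, h3, h4⟩
      exact ⟨by simp; linarith, by simp; linarith, by simp; linarith, by simp; linarith⟩
    · rintro ⟨h1, h2, h3, h4⟩
      simp at h1 h2 h3 h4
      exact ⟨h1, by linarith, by linarith, by linarith⟩
  have hO := fun r s t x => isOpen_setOf_re_combination_lt r s t x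
  have hC := fun r s t x => convex_setOf_re_lt r s t x
  refine holoCont_genericParams_eq
    (f := fun p => bilinF p.1 p.2.1 p.2.2 y / (Real.pi * Complex.sin (Real.pi * p.2.2)))
    -- The smaller region adds `0 < Re a < 1/2`, where the value of the integral is known for every
    -- `y`, including `0 < y < 1`. The integral being holomorphic on the whole convex region of
    -- convergence, this is enough.
    (W := {p | 0 < p.2.1.re ∧ p.2.1.re < p.2.2.re ∧ p.2.2.re < p.1.re + 1 ∧ p.1.re + 1 < 2} ∩
      ({p | (-1) * p.1.re + 0 * p.2.1.re + 0 * p.2.2.re < 0} ∩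
      {p | 1 * p.1.re + 0 * p.2.1.re + 0 * p.2.2.re < 1 / 2}))
    ?_ ?_ ?_ ⟨(1 / 4, 1 / 4, 1 / 2), ?_⟩ inter_subset_left ?_ ?_ ?_ h
  · rw [hU]
    exact (hO _ _ _ _).inter ((hO _ _ _ _).inter ((hO _ _ _ _).inter (hO _ _ _ _)))
  · rw [hU]
    exact (hC _ _ _ _).inter ((hC _ _ _ _).inter ((hC _ _ _ _).inter (hC _ _ _ _)))
  · rw [hU]
    exact ((hO _ _ _ _).inter ((hO _ _ _ _).inter ((hO _ _ _ _).inter (hO _ _ _ _)))).inter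
      ((hO _ _ _ _).inter (hO _ _ _ _))
  · norm_num
  · rintro p ⟨h1, h2, h3, h4⟩
    simp_rw [svIntegral_F]
    exact ((differentiableAt_integral_planePow hy0 (ne_one_of_mem_cutPlane hy)
      (expF_mem_planeDomain h1 h2 h3 (by linarith)) measurable_const
      (fun _ => (norm_one (α := ℂ)).le)).comp p differentiable_expF.differentiableAt).const_mul _
  · intro p hp
    exact (differentiableAt_bilinF hp hy hy0).div_of_ne (by fun_prop)
      (mul_ne_zero (by simp [Real.pi_ne_zero]) hp.2.2.1.sin_ne_zero)
  · rintro p ⟨hp, ⟨h1, h2, h3, h4⟩, h5, h6⟩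
    simp at h5 h6
    have hs := hp.2.2.1.sin_ne_zero
    have hπ : (Real.pi : ℂ) ≠ 0 := by simp [Real.pi_ne_zero]
    simp_rw [svIntegral_F]
    rw [← integral_expF hp h1 h2 h3 h5 (by linarith) hy hy0]
    field_simp

theorem svCalG_eq (h : (a, b, c) ∈ genericParams) (hy : y ∈ cutPlane) (hy0 : y ≠ 0) :
    svCalG a b c y = conj y * bilinG a b c y / (Real.pi * Complex.sin (Real.pi * c)) := by
  have hU : {p : ℂ × ℂ × ℂ | -(1 / 2) < p.2.1.re ∧ p.2.1.re < p.2.2.re + 1 / 2 ∧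
      p.2.2.re + 1 / 2 < p.1.re + 1 ∧ p.1.re + 1 < 3 / 2} =
      {p | 0 * p.1.re + (-1) * p.2.1.re + 0 * p.2.2.re < 1 / 2} ∩
      ({p | 0 * p.1.re + 1 * p.2.1.re + (-1) * p.2.2.re < 1 / 2} ∩
      ({p | (-1) * p.1.re + 0 * p.2.1.re + 1 * p.2.2.re < 1 / 2} ∩
      {p | 1 * p.1.re + 0 * p.2.1.re + 0 * p.2.2.re < 1 / 2})) := by
    ext p
    simp only [mem_inter_iff, mem_ofPred_eq]
    constructor
    · rintro ⟨h1, h2, h3, h4⟩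
      exact ⟨by linarith, by linarith, by linarith, by linarith⟩
    · rintro ⟨h1, h2, h3, h4⟩
      exact ⟨by linarith, by linarith, by linarith, by linarith⟩
  have hO := fun r s t x => isOpen_setOf_re_combination_lt r s t x
  have hC := fun r s t x => convex_setOf_re_lt r s t x
  refine holoCont_genericParams_eq
    (f := fun p => conj y * bilinG p.1 p.2.1 p.2.2 y
      / (Real.pi * Complex.sin (Real.pi * p.2.2)))
    -- Here the smaller region adds `0 < Re b < Re c` and `Re a < 0`, so that Euler's integrals
    -- converge for both triples.
    (W := {p | -(1 / 2) < p.2.1.re ∧ p.2.1.re < p.2.2.re + 1 / 2 ∧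
      p.2.2.re + 1 / 2 < p.1.re + 1 ∧ p.1.re + 1 < 3 / 2} ∩
      ({p | 0 * p.1.re + (-1) * p.2.1.re + 0 * p.2.2.re < 0} ∩
      ({p | 0 * p.1.re + 1 * p.2.1.re + (-1) * p.2.2.re < 0} ∩
      {p | 1 * p.1.re + 0 * p.2.1.re + 0 * p.2.2.re < 0})))
    ?_ ?_ ?_ ⟨(-1 / 8, 1 / 8, 1 / 4), ?_⟩ inter_subset_left ?_ ?_ ?_ h
  · rw [hU]
    exact (hO _ _ _ _).inter ((hO _ _ _ _).inter ((hO _ _ _ _).inter (hO _ _ _ _)))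
  · rw [hU]
    exact (hC _ _ _ _).inter ((hC _ _ _ _).inter ((hC _ _ _ _).inter (hC _ _ _ _)))
  · rw [hU]
    exact ((hO _ _ _ _).inter ((hO _ _ _ _).inter ((hO _ _ _ _).inter (hO _ _ _ _)))).inter
      ((hO _ _ _ _).inter ((hO _ _ _ _).inter (hO _ _ _ _)))
  · norm_num
  · rintro p ⟨h1, h2, h3, h4⟩
    simp_rw [svIntegral_G]
    exact ((differentiableAt_integral_planePow hy0 (ne_one_of_mem_cutPlane hy)
      (expG_mem_planeDomain h1 h2 h3 h4) (measurable_phaseG y)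
      (norm_phaseG_le y)).comp p differentiable_expG.differentiableAt).const_mul _
  · intro p hp
    exact ((differentiableAt_bilinG hp hy hy0).const_mul _).div_of_ne (by fun_prop)
      (mul_ne_zero (by simp [Real.pi_ne_zero]) hp.2.2.1.sin_ne_zero)
  · rintro p ⟨hp, ⟨h1, h2, h3, h4⟩, h5, h6, h7⟩
    simp only [mem_ofPred_eq] at h5 h6 h7
    have hs := hp.2.2.1.sin_ne_zero
    have hπ : (Real.pi : ℂ) ≠ 0 := by simp [Real.pi_ne_zero]
    simp_rw [svIntegral_G]
    rw [← integral_expG hp (by linarith) (by linarith) (by linarith) (by linarith) hy hy0]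
    field_simp

end SingleValued

/-! ### Products of companion functions and matching of constants -/

section Products

variable {a b c y lam mu : ℂ}

/-- A logarithm of `-1` is purely imaginary, so its contributions at `y` and `ȳ` cancel, while `lam
+ conj lam = 2 log |y|`. This is why the formulas do not depend on the determinations. -/
theorem exp_mul_exp_conj (hlam : Complex.exp lam = y) (hmu : Complex.exp mu = -1) (r s t : ℂ) :
    Complex.exp (r * lam + t * mu) * Complex.exp ((r - s) * conj lam + t * conj mu)
      = (‖y‖ : ℂ) ^ (2 * r) * Complex.exp (-s * conj lam) := by
  have h1 : mu.re = 0 := by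
    have := congrArg norm hmu
    rwa [Complex.norm_exp, norm_neg, norm_one, Real.exp_eq_one_iff] at this
  have h2 : mu + conj mu = 0 := by rw [Complex.add_conj, h1]; simp
  have h3 := norm_exp_neg_cpow (-lam) (2 * r)
  rw [neg_neg, hlam] at h3
  rw [h3, ← Complex.exp_add, ← Complex.exp_add]
  congr 1
  simp only [map_neg]
  linear_combination t * h2

theorem hypG_eq (h : (a, b, c) ∈ genericParams) (hy : y ∈ cutPlane)
    (hlam : Complex.exp lam = y) :
    hypG a b c y lam mu = Complex.sin (Real.pi * a) * Complex.sin (Real.pi * (c - a))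
      / (Real.pi * Complex.sin (Real.pi * c)) * (eulerBeta b (c - b))⁻¹
      * (Complex.exp ((1 - c) * lam + (c - b - a) * mu) * compH a b c y) := by
  rw [hypG, calG_eq mu h hy hlam]

theorem exp_conj_eq (hlam : Complex.exp lam = y) : Complex.exp (conj lam) = conj y := by
  rw [Complex.exp_conj, hlam]

theorem hypG_mul_hypG_conj (h : (a, b, c) ∈ genericParams) (hy : y ∈ cutPlane)
    (hlam : Complex.exp lam = y) (hmu : Complex.exp mu = -1) :
    hypG a b c y lam mu * hypG a b c (conj y) (conj lam) (conj mu)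
      = (Complex.sin (Real.pi * a) * Complex.sin (Real.pi * (c - a))
        / (Real.pi * Complex.sin (Real.pi * c)) * (eulerBeta b (c - b))⁻¹) ^ 2
        * ((‖y‖ : ℂ) ^ (2 * (1 - c)) * compH a b c y * compH a b c (conj y)) := by
  have hE := exp_mul_exp_conj hlam hmu (1 - c) 0 (c - b - a)
  simp only [sub_zero, neg_zero, zero_mul, Complex.exp_zero, mul_one] at hE
  rw [hypG_eq h hy hlam, hypG_eq h (conj_mem_cutPlane hy) (exp_conj_eq hlam), ← hE]
  ring

theorem sin_pi_mul_add_one (s : ℂ) :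
    Complex.sin (Real.pi * (s + 1)) = -Complex.sin (Real.pi * s) := by
  rw [mul_add, mul_one, Complex.sin_add_pi]

theorem sin_pi_mul_add_two (s : ℂ) :
    Complex.sin (Real.pi * (s + 2)) = Complex.sin (Real.pi * s) := by
  rw [show s + 2 = s + 1 + 1 by ring, sin_pi_mul_add_one, sin_pi_mul_add_one, neg_neg]

theorem eulerBeta_comm (s t : ℂ) : eulerBeta s t = eulerBeta t s := by
  rw [eulerBeta, eulerBeta, mul_comm, add_comm]

theorem eulerBeta_sub_neg (h1 : NotInt a) (h2 : NotInt c) (h3 : NotInt (c - a)) :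
    eulerBeta (a - c) (-a) = -(Real.pi * c * Complex.sin (Real.pi * c)
      / (a * (c - a) * Complex.sin (Real.pi * a) * Complex.sin (Real.pi * (c - a))))
        * (eulerBeta a (c - a))⁻¹ := by
  have h := eulerBeta_mul_neg h1 h3 (by rwa [add_sub_cancel])
  rw [add_sub_cancel, neg_sub] at h
  rw [eulerBeta_comm (a - c), ← h]
  have := h1.eulerBeta_ne_zero h3 (by rwa [add_sub_cancel])
  field_simp

theorem eulerBeta_shift (h1 : NotInt a) (h2 : NotInt c) (h3 : NotInt (c - a)) :
    eulerBeta (a + 1) (c + 2 - (a + 1))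
      = a * (c - a) / (c * (c + 1)) * eulerBeta a (c - a) := by
  have h := eulerBeta_add_one h1 h3 (by rwa [add_sub_cancel])
  rw [add_sub_cancel] at h
  rw [← h]
  congr 1
  ring

/-- The companion of `(b+1, a+1, c+2)` contains `F(a-c, b-c, -c; ȳ)`, which is symmetric in the
first two parameters and so also occurs in the companion of `(a+1, b+1, c+2)` in `bilinG`. Only the
beta factors differ, and reflection expresses them through `β(b, c-b)` and `β(a, c-a)`. -/
theorem hypG_mul_hypG_shift (h : (a, b, c) ∈ genericParams) (hy : y ∈ cutPlane)
    (hlam : Complex.exp lam = y) (hmu : Complex.exp mu = -1) :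
    hypG a b c y lam mu * hypG (b + 1) (a + 1) (c + 2) (conj y) (conj lam) (conj mu)
      = -(Complex.sin (Real.pi * a) * Complex.sin (Real.pi * (c - a)) * c ^ 2 * (c + 1)
        / (Real.pi * Complex.sin (Real.pi * c) * (a * (c - a) * b * (c - b)))
        * ((eulerBeta b (c - b))⁻¹ ^ 2 * (eulerBeta a (c - a))⁻¹)
        * ((‖y‖ : ℂ) ^ (2 * (1 - c)) * (conj y ^ 2)⁻¹ * compH a b c y
          * hypF (a - c) (b - c) (-c) (conj y))) := by
  obtain ⟨h1, h2, h3, h4, h5⟩ := id h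
  have hE := exp_mul_exp_conj hlam hmu (1 - c) 2 (c - b - a)
  have hE' : Complex.exp (-2 * conj lam) = (conj y ^ 2)⁻¹ := by
    rw [← exp_conj_eq hlam, ← Complex.exp_nat_mul, ← Complex.exp_neg]
    congr 1
    push_cast; ring
  rw [hE'] at hE
  have h' : (b + 1, a + 1, c + 2) ∈ genericParams := by
    have : (b, a, c) ∈ genericParams := ⟨h2, h1, h3, h5, h4⟩
    have := mem_genericParams_shift this 1 1 2
    simpa [add_comm] using this
  have hc1 : c + 1 ≠ 0 := fun h => h3 (-1) (by push_cast; linear_combination h)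
  rw [hypG_eq h hy hlam, hypG_eq h' (conj_mem_cutPlane hy) (exp_conj_eq hlam),
    show 1 - (c + 2) = 1 - c - 2 by ring, show c + 2 - (a + 1) - (b + 1) = c - b - a by ring,
    eulerBeta_shift h1 h3 h4, sin_pi_mul_add_one, sin_pi_mul_add_two,
    show c + 2 - (b + 1) = c - b + 1 by ring, sin_pi_mul_add_one,
    show compH (b + 1) (a + 1) (c + 2) (conj y)
      = eulerBeta (b - c) (-b) * hypF (a - c) (b - c) (-c) (conj y) by rw [compH]; ring_nf,
    eulerBeta_sub_neg h2 h3 h5]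
  have k1 := h1.ne_zero
  have k2 := h2.ne_zero
  have k3 := h3.ne_zero
  have k4 := h4.ne_zero
  have k5 := h5.ne_zero
  have l1 := h1.sin_ne_zero
  have l2 := h2.sin_ne_zero
  have l3 := h3.sin_ne_zero
  have l4 := h4.sin_ne_zero
  have l5 := h5.sin_ne_zero
  have hpi : (Real.pi : ℂ) ≠ 0 := by exact_mod_cast Real.pi_ne_zero
  have m1 := h1.eulerBeta_ne_zero h4 (by rwa [add_sub_cancel])
  have m2 := h2.eulerBeta_ne_zero h5 (by rwa [add_sub_cancel])
  rw [mul_mul_mul_comm, mul_mul_mul_comm (Complex.exp _), hE]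
  field_simp

theorem bilinG_eq (h : (a, b, c) ∈ genericParams) :
    bilinG a b c y = b * (c - b) / (c * (c + 1)) * (Complex.sin (Real.pi * b)
        * Complex.sin (Real.pi * (c - b)) * eulerBeta b (c - b) ^ 2
        * (hypF a b c y * hypF (b + 1) (a + 1) (c + 2) (conj y)))
      + Real.pi * c * Complex.sin (Real.pi * c) / (a * (c - a)) * (eulerBeta a (c - a))⁻¹
        * ((‖y‖ : ℂ) ^ (2 * (1 - c)) * (conj y ^ 2)⁻¹ * compH a b c y
          * hypF (a - c) (b - c) (-c) (conj y)) := by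
  obtain ⟨h1, h2, h3, h4, h5⟩ := id h
  rw [bilinG, eulerBeta_shift h2 h3 h5, hypF_symm (a + 1),
    show compH (a + 1) (b + 1) (c + 2) (conj y)
      = eulerBeta (a - c) (-a) * hypF (a - c) (b - c) (-c) (conj y) by
        rw [compH, hypF_symm]; ring_nf,
    eulerBeta_sub_neg h1 h3 h4]
  have l1 := h1.sin_ne_zero
  have l4 := h4.sin_ne_zero
  have k1 := h1.ne_zero
  have k4 := h4.ne_zero
  field_simp
  ring

end Products

end

/-! ### The two double copy formulas -/

theorem mainTheorem7 (a b c : ℂ) (habc : (a, b, c) ∈ genericParams)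
    (y : ℂ) (hy0 : y ≠ 0) (hy : y ∈ cutPlane)
    (lam mu : ℂ) (hlam : Complex.exp lam = y) (hmu : Complex.exp mu = -1) :
    svF a b c y
      = hypF a b c y * hypF a b c (conj y)
        - wFactor a (c - a) * wFactor b (c - b)
          * (hypG a b c y lam mu * hypG a b c (conj y) (conj lam) (conj mu)) ∧
    svG a b c y
      = a * (c - a) * b * (c - b) * conj y / (c ^ 2 * (1 + c))
        * (hypF a b c y * hypF (b + 1) (a + 1) (c + 2) (conj y)
          - wFactor a (c - a) * wFactor b (c - b)
            * (hypG a b c y lam mu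
              * hypG (b + 1) (a + 1) (c + 2) (conj y) (conj lam) (conj mu))) := by
  obtain ⟨h1, h2, h3, h4, h5⟩ :
      NotInt a ∧ NotInt b ∧ NotInt c ∧ NotInt (c - a) ∧ NotInt (c - b) := id habc
  have hc1 : 1 + c ≠ 0 := fun h => h3 (-1) (by push_cast; linear_combination h)
  have hc2 : c + 1 ≠ 0 := by rwa [add_comm]
  have k1 := h1.ne_zero
  have k2 := h2.ne_zero
  have k3 := h3.ne_zero
  have k4 := h4.ne_zero
  have k5 := h5.ne_zero
  have l1 := h1.sin_ne_zero
  have l2 := h2.sin_ne_zero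
  have l3 := h3.sin_ne_zero
  have l4 := h4.sin_ne_zero
  have l5 := h5.sin_ne_zero
  have hpi : (Real.pi : ℂ) ≠ 0 := by exact_mod_cast Real.pi_ne_zero
  have m1 := h1.eulerBeta_ne_zero h4 (by rwa [add_sub_cancel])
  have m2 := h2.eulerBeta_ne_zero h5 (by rwa [add_sub_cancel])
  -- This says `β^s(b, c-b) = β(b, c-b)² / w_{b,c-b}`; dividing by it normalises the coefficient of
  -- `F·F` and brings in the factor `w_{b,c-b}`.
  have hβ := svBeta_eq h2 h5 (by rwa [add_sub_cancel])
  rw [add_sub_cancel] at hβ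
  constructor
  · rw [svF, svCalF_eq habc hy hy0, hβ, hypG_mul_hypG_conj habc hy hlam hmu, wFactor, wFactor,
      add_sub_cancel, add_sub_cancel, bilinF]
    generalize Complex.sin (Real.pi * a) = sa at *
    generalize Complex.sin (Real.pi * b) = sb at *
    generalize Complex.sin (Real.pi * c) = sc at *
    generalize Complex.sin (Real.pi * (c - a)) = sca at *
    generalize Complex.sin (Real.pi * (c - b)) = scb at *
    field_simp
  · rw [svG, svCalG_eq habc hy hy0, hβ, hypG_mul_hypG_shift habc hy hlam hmu, wFactor, wFactor,
      add_sub_cancel, add_sub_cancel, bilinG_eq habc, add_comm 1 c]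
    generalize (‖y‖ : ℂ) ^ (2 * (1 - c)) * (conj y ^ 2)⁻¹ * compH a b c y
      * hypF (a - c) (b - c) (-c) (conj y) = X
    generalize Complex.sin (Real.pi * a) = sa at *
    generalize Complex.sin (Real.pi * b) = sb at *
    generalize Complex.sin (Real.pi * c) = sc at *
    generalize Complex.sin (Real.pi * (c - a)) = sca at *
    generalize Complex.sin (Real.pi * (c - b)) = scb at *
    field_simp
    ring
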